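/- Let $k$ be an algebraically closed field of characteristic zero, $\mathfrak g$ a finite-dimensional semisimple Lie algebra over $k$, and $\sigma\ne\mathrm{id}$ an involution of $\mathfrak g$ which is simple, i.e. $\mathfrak g\neq 0$ has no $\sigma$-stable ideals other than $0$ and $\mathfrak g$. Let $\mathfrak t$ be a $\sigma$-stable Cartan subalgebra whose $(-1)$-eigenspace for $\sigma$ has maximal dimension among all $\sigma$-stable Cartan subalgebras, $\Phi$ the roots of $(\mathfrak g,\mathfrak t)$, $\kappa$ the form on $\mathfrak t^*$ induced by the Killing form, and $\Phi^+$ a choice of positive roots with simple roots $\Delta$ such that for $\alpha\in\Phi^+$ either $\sigma(\alpha)=\alpha$ or $\sigma(\alpha)$ is negative. For $\alpha\in\Phi$ with $\sigma(\alpha)\neq\alpha$ put $\tilde\alpha=\alpha-\sigma(\alpha)$; let $\tilde\Phi$ be the (possibly non-reduced) restricted root system of all these $\tilde\alpha$, with simple roots $\tilde\alpha_1,\dots,\tilde\alpha_\ell$ (the $\tilde\alpha$ with $\alpha\in\Delta$, $\sigma(\alpha)\ne\alpha$), and let $\tilde\alpha^\vee\in\mathfrak t$ be defined by $\langle\lambda,\tilde\alpha^\vee\rangle=2\kappa(\lambda,\tilde\alpha)/\kappa(\tilde\alpha,\tilde\alpha)$.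 Let $\varepsilon$ be a dominant spherical weight, i.e. a dominant integral weight of $\Phi$ with $\sigma(\varepsilon)=-\varepsilon$ and $\langle\varepsilon,\tilde\alpha^\vee\rangle\in\mathbb Z$ for all $\tilde\alpha\in\tilde\Phi$. Let ${}^e\mathfrak g$ be the Kac–Moody algebra, defined from a realization (in the sense of Kac), whose generalized Cartan matrix is indexed by $\Delta\cup\{\alpha_0\}$ and extends that of $\mathfrak g$ by $\langle\alpha_0,\alpha_0^\vee\rangle=2$, $\langle\alpha_0,\alpha^\vee\rangle=-\langle\varepsilon,\alpha^\vee\rangle$, and $\langle\alpha,\alpha_0^\vee\rangle=0$ if $\langle\varepsilon,\alpha^\vee\rangle=0$, $=-1$ otherwise ($\alpha\in\Delta$). Regard $\mathfrak t$ and $\mathfrak t^*$ as subspaces of the Cartan subalgebra of ${}^e\mathfrak g$ and of its dual, through the simple coroots and the simple roots in $\Delta$, put $\tilde\alpha_0=2\alpha_0$, $\tilde\alpha_0^\vee=\tfrac12\alpha_0^\vee$, and let $\tilde{\mathbf A}=(\langle\tilde\alpha_i,\tilde\alpha_j^\vee\rangle)_{0\le i,j\le\ell}$ be the restricted Cartan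 matrix. Then: (i) ${}^e\mathfrak g$ is finite dimensional if and only if $\tilde{\mathbf A}$ is of finite type. (ii) ${}^e\mathfrak g$ is of affine type if and only if $\tilde{\mathbf A}$ is of affine type. (iii) Suppose moreover that $\tilde\Phi$ is of type $X$, where $X$ is one of $A_\ell$ ($\ell\ge1$), $B_\ell$ ($\ell\ge1$), $C_\ell$ ($\ell\ge2$), $D_\ell$ ($\ell\ge4$), $BC_\ell$ ($\ell\ge1$), $E_6,E_7,E_8,F_4,G_2$, with simple roots numbered as in Bourbaki, and that $\varepsilon$ is the first fundamental weight $\tilde\omega_1$ of $\tilde\Phi$, respectively $2\tilde\omega_1$ if $X=B_1$. (A rank one reduced system may be regarded as being of type $A_1$ or of type $B_1$, which changes the condition on $\varepsilon$; a system of type $B_2=C_2$ may be numbered in either way; for type $BC_1$ the fundamental weight is normalized by $\langle\tilde\omega_1,\tilde\alpha_1^\vee\rangle=2$.) Then ${}^e\mathfrak g$ is finite dimensional, equivalently $\tilde{\mathbf A}$ is of finite type, if and only if $X$ is of type $A$; and ${}^e\mathfrak g$ is of affine type, equivalently $\tilde{\mathbf A}$ is of affine type, if and only if $X$ is of type $B$,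 $BC$, $C$ or $D$. Here a generalized Cartan matrix $A$ is of finite type if each of its indecomposable components $B$ has $\det B\ne0$, admits a real vector $u>0$ with $Bu>0$, and satisfies $Bv\ge0\Rightarrow v>0$ or $v=0$; it is of affine type if it is indecomposable, has corank $1$, admits $u>0$ with $Au=0$, and satisfies $Av\ge0\Rightarrow Av=0$. A Kac–Moody algebra is of affine type if its generalized Cartan matrix is. -/

import Mathlib

open Module LieAlgebra LieAlgebra.IsKilling

noncomputable section

namespace ExtKM

/-! ### Generalized Cartan matrices of finite and of affine type -/

section MatrixTypes

variable {ι : Type*}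

/-- Generalized Cartan matrices. -/
structure IsGCM (A : Matrix ι ι ℤ) : Prop where
  diag : ∀ i, A i i = 2
  nonpos : ∀ i j, i ≠ j → A i j ≤ 0
  zero_symm : ∀ i j, A i j = 0 → A j i = 0

/-- A matrix is indecomposable if its index set is non-empty and is not the union of two disjoint
non-empty subsets `S` and `Sᶜ` such that the blocks `S × Sᶜ` and `Sᶜ × S` vanish. -/
def Indecomposable (A : Matrix ι ι ℤ) : Prop :=
  Nonempty ι ∧ ∀ S : Set ι, S.Nonempty → Sᶜ.Nonempty →
    ∃ i ∈ S, ∃ j ∈ Sᶜ, A i j ≠ 0 ∨ A j i ≠ 0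

/-- The block of `A` with rows and columns in `S`. -/
def block (A : Matrix ι ι ℤ) (S : Finset ι) : Matrix S S ℤ :=
  A.submatrix Subtype.val Subtype.val

/-- `S` is (the index set of) an indecomposable component of `A`. -/
def IsComponent (A : Matrix ι ι ℤ) (S : Finset ι) : Prop :=
  Indecomposable (block A S) ∧ ∀ i ∈ S, ∀ j ∉ S, A i j = 0 ∧ A j i = 0

variable [Fintype ι]

/-- The integer matrix `A`, acting on real column vectors. -/
def realMulVec (A : Matrix ι ι ℤ) (v : ι → ℝ) : ι → ℝ :=
  (A.map (Int.cast : ℤ → ℝ)).mulVec v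

open Classical in
/-- Condition (Fin) of the trichotomy for indecomposable generalized Cartan matrices. -/
structure SatisfiesFin (A : Matrix ι ι ℤ) : Prop where
  det_ne_zero : A.det ≠ 0
  exists_pos : ∃ u : ι → ℝ, (∀ i, 0 < u i) ∧ ∀ i, 0 < realMulVec A u i
  pos_or_zero : ∀ v : ι → ℝ, (∀ i, 0 ≤ realMulVec A v i) → (∀ i, 0 < v i) ∨ v = 0

/-- Condition (Aff) of the trichotomy for indecomposable generalized Cartan matrices. -/
structure SatisfiesAff (A : Matrix ι ι ℤ) : Prop where
  corank : (A.map (Int.cast : ℤ → ℝ)).rank + 1 = Fintype.card ι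
  exists_pos : ∃ u : ι → ℝ, (∀ i, 0 < u i) ∧ realMulVec A u = 0
  eq_zero : ∀ v : ι → ℝ, (∀ i, 0 ≤ realMulVec A v i) → realMulVec A v = 0

variable {k : Type*} [Field k]

/-- A matrix over `k` is of finite type if it is a generalized Cartan matrix (in particular has
integral entries) all of whose indecomposable components satisfy (Fin). -/
def IsFiniteType (M : Matrix ι ι k) : Prop :=
  ∃ A : Matrix ι ι ℤ, A.map (Int.cast : ℤ → k) = M ∧ IsGCM A ∧
    ∀ S : Finset ι, IsComponent A S → SatisfiesFin (block A S)

/-- A matrix over `k` is of affine type if it is an indecomposable generalized Cartan matrix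
which satisfies (Aff). -/
def IsAffineType (M : Matrix ι ι k) : Prop :=
  ∃ A : Matrix ι ι ℤ, A.map (Int.cast : ℤ → k) = M ∧ IsGCM A ∧ Indecomposable A ∧
    SatisfiesAff A

end MatrixTypes

/-! ### Realizations and Kac–Moody algebras -/

section KacMoody

variable {k : Type*} [Field k] {ι : Type*} [Fintype ι]

/-- A realization `(𝔥, Π, Π^∨)` of the matrix `A`, where `A i j = ⟨α_i^∨, α_j⟩`. -/
structure Realization (A : Matrix ι ι k) (𝔥 : Type*) [AddCommGroup 𝔥] [Module k 𝔥] where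
  /-- the simple roots -/
  root : ι → Dual k 𝔥
  /-- the simple coroots -/
  coroot : ι → 𝔥
  finiteDimensional : FiniteDimensional k 𝔥
  root_linearIndependent : LinearIndependent k root
  coroot_linearIndependent : LinearIndependent k coroot
  root_coroot : ∀ i j, root j (coroot i) = A i j
  finrank_add_rank : finrank k 𝔥 + A.rank = 2 * Fintype.card ι

/-- Generators `e_i`, `f_i` and `h ∈ 𝔥`. -/
inductive Gen (ι 𝔥 : Type*)
  | e : ι → Gen ι 𝔥
  | f : ι → Gen ι 𝔥
  | h : 𝔥 → Gen ι 𝔥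

section Generators

variable (k ι 𝔥 : Type*) [Field k]

/-- The generator `e_i` of the free Lie algebra. -/
def genE (i : ι) : FreeLieAlgebra k (Gen ι 𝔥) := FreeLieAlgebra.of k (Gen.e i)

/-- The generator `f_i` of the free Lie algebra. -/
def genF (i : ι) : FreeLieAlgebra k (Gen ι 𝔥) := FreeLieAlgebra.of k (Gen.f i)

/-- The generator `h ∈ 𝔥` of the free Lie algebra. -/
def genH (x : 𝔥) : FreeLieAlgebra k (Gen ι 𝔥) := FreeLieAlgebra.of k (Gen.h x)

end Generators

variable {A : Matrix ι ι k} {𝔥 : Type*} [AddCommGroup 𝔥] [Module k 𝔥]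

namespace Realization

variable (R : Realization A 𝔥)

/-- The defining relators of the auxiliary Lie algebra: the linear relations of `𝔥` and
`[e_i, f_j] = δ_ij α_i^∨`, `[h, h'] = 0`, `[h, e_i] = α_i(h) e_i`, `[h, f_i] = -α_i(h) f_i`. -/
inductive IsRelator : FreeLieAlgebra k (Gen ι 𝔥) → Prop
  | add (x y : 𝔥) : IsRelator (genH k ι 𝔥 (x + y) - genH k ι 𝔥 x - genH k ι 𝔥 y)
  | smul (c : k) (x : 𝔥) : IsRelator (genH k ι 𝔥 (c • x) - c • genH k ι 𝔥 x)
  | ef_eq (i : ι) : IsRelator (⁅genE k ι 𝔥 i, genF k ι 𝔥 i⁆ - genH k ι 𝔥 (R.coroot i))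
  | ef_ne (i j : ι) (hij : i ≠ j) : IsRelator ⁅genE k ι 𝔥 i, genF k ι 𝔥 j⁆
  | hh (x y : 𝔥) : IsRelator ⁅genH k ι 𝔥 x, genH k ι 𝔥 y⁆
  | he (x : 𝔥) (i : ι) : IsRelator (⁅genH k ι 𝔥 x, genE k ι 𝔥 i⁆ - R.root i x • genE k ι 𝔥 i)
  | hf (x : 𝔥) (i : ι) : IsRelator (⁅genH k ι 𝔥 x, genF k ι 𝔥 i⁆ + R.root i x • genF k ι 𝔥 i)

/-- The ideal of the free Lie algebra generated by the relators. -/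
def relIdeal : LieIdeal k (FreeLieAlgebra k (Gen ι 𝔥)) :=
  LieSubmodule.lieSpan k _ {x | R.IsRelator x}

/-- The auxiliary Lie algebra `𝔤̃(A)`. -/
abbrev Aux : Type _ := FreeLieAlgebra k (Gen ι 𝔥) ⧸ R.relIdeal

/-- The image of `h ∈ 𝔥` in the auxiliary Lie algebra. -/
def torus (x : 𝔥) : R.Aux :=
  LieSubmodule.Quotient.mk (N := R.relIdeal) (genH k ι 𝔥 x)

/-- The maximal ideal of the auxiliary Lie algebra which intersects `𝔥` trivially. -/
def maxIdeal : LieIdeal k R.Aux :=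
  sSup {I : LieIdeal k R.Aux | ∀ x : 𝔥, R.torus x ∈ I → R.torus x = 0}

/-- The Kac–Moody algebra `𝔤(A)` of the realization. -/
abbrev KacMoodyAlgebra : Type _ := R.Aux ⧸ R.maxIdeal

/-- By definition, the Lie algebra `𝔤(A)` is of affine type if the matrix `A` is so. -/
def IsOfAffineType (_R : Realization A 𝔥) : Prop := IsAffineType A

end Realization

end KacMoody

/-! ### Simple involutions, restricted roots -/

section Symmetric

variable (k L : Type*) [Field k] [IsAlgClosed k] [CharZero k]
  [LieRing L] [LieAlgebra k L] [FiniteDimensional k L] [LieAlgebra.IsSemisimple k L]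

variable {k L} in
/-- The `(-1)`-eigenspace of `σ` inside a subalgebra `H`. -/
def antiFixed (σ : L ≃ₗ⁅k⁆ L) (H : LieSubalgebra k L) : Submodule k L :=
  H.toSubmodule ⊓ LinearMap.ker ((σ : L →ₗ⁅k⁆ L).toLinearMap + LinearMap.id)

/-- A simple involution `σ` of the semisimple Lie algebra `L`, a maximally split `σ`-stable Cartan
subalgebra `H`, and a base of the root system such that every positive root is either fixed by
`σ` or sent to a negative root. -/
structure SymmetricDatum where
  /-- the involution -/
  σ : L ≃ₗ⁅k⁆ L
  σ_σ : ∀ x, σ (σ x) = x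
  σ_ne_id : ∃ x, σ x ≠ x
  simple : ∀ I : LieIdeal k L, (∀ x ∈ I, σ x ∈ I) → I = ⊥ ∨ I = ⊤
  /-- the Cartan subalgebra -/
  H : LieSubalgebra k L
  isCartan : H.IsCartanSubalgebra
  stable : ∀ x ∈ H, σ x ∈ H
  maxSplit : ∀ H' : LieSubalgebra k L, H'.IsCartanSubalgebra → (∀ x ∈ H', σ x ∈ H') →
    finrank k (antiFixed σ H') ≤ finrank k (antiFixed σ H)
  /-- the simple roots -/
  base : (rootSystem H).Base
  pos : ∀ α : H.root, base.IsPos α →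
    (∀ x : H, α.1 ⟨σ x, stable x x.2⟩ = α.1 x) ∨
    ∃ β : H.root, base.IsPos β ∧ ∀ x : H, α.1 ⟨σ x, stable x x.2⟩ = -β.1 x

variable {k L}

namespace SymmetricDatum

variable (D : SymmetricDatum k L)

instance : D.H.IsCartanSubalgebra := D.isCartan

/-- `σ` restricted to the Cartan subalgebra. -/
def σH : D.H →ₗ[k] D.H :=
  (D.σ : L →ₗ⁅k⁆ L).toLinearMap.restrict (p := D.H.toSubmodule) (q := D.H.toSubmodule) D.stable

/-- The action `(σ λ)(x) = λ(σ x)` of `σ = σ⁻¹` on the dual of the Cartan subalgebra. -/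
def σDual : Dual k D.H →ₗ[k] Dual k D.H := D.σH.dualMap

/-- The root `α`, as a linear functional. -/
def root (α : D.H.root) : Dual k D.H := (rootSystem D.H).root α

/-- The bilinear form on the dual of the Cartan subalgebra induced by the Killing form. -/
def κ (lam mu : Dual k D.H) : k := lam ((cartanEquivDual D.H).symm mu)

/-- `λ^∨ = 2λ/κ(λ, λ)` as an element of the Cartan subalgebra:
`⟨μ, λ^∨⟩ = 2 κ(μ, λ) / κ(λ, λ)` for all `μ`. -/
def check (lam : Dual k D.H) : D.H := (2 / D.κ lam lam) • (cartanEquivDual D.H).symm lam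

/-- The restricted root system: all `α - σ(α)` with `α` a root that is not fixed by `σ`. -/
def restrictedRoots : Set (Dual k D.H) :=
  {lam | ∃ α : D.H.root, D.σDual (D.root α) ≠ D.root α ∧
    lam = D.root α - D.σDual (D.root α)}

open Classical in
/-- The simple restricted roots: all `α - σ(α)` with `α` a simple root not fixed by `σ`. -/
def simpleRestricted : Finset (Dual k D.H) :=
  (D.base.support.filter fun α ↦ D.σDual (D.root α) ≠ D.root α).image
    fun α ↦ D.root α - D.σDual (D.root α)

/-- Dominant spherical weights: dominant integral weights `ε` with `σ(ε) = -ε` and with integral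
value on the coroot of every restricted root. -/
structure IsDominantSpherical (ε : Dual k D.H) : Prop where
  dominant : ∀ α ∈ D.base.support, ∃ n : ℕ, ε ((rootSystem D.H).coroot α) = n
  special : D.σDual ε = -ε
  spherical : ∀ β ∈ D.restrictedRoots, ∃ n : ℤ, ε (D.check β) = n

open Classical in
/-- The extended Cartan matrix `(⟨α_i^∨, α_j⟩)`, where `some α` stands for the simple root `α` and
`none` for the new node. -/
def extMatrix (ε : Dual k D.H) :
    Matrix (Option D.base.support) (Option D.base.support) k :=
  Matrix.of fun i j ↦ match i, j with
    | some α, some β => D.root β ((rootSystem D.H).coroot α)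
    | some α, none => -ε ((rootSystem D.H).coroot α)
    | none, some β => if ε ((rootSystem D.H).coroot β) = 0 then 0 else -1
    | none, none => 2

section Extended

variable {D} {ε : Dual k D.H} {𝔥 : Type*} [AddCommGroup 𝔥] [Module k 𝔥]
  (R : Realization (D.extMatrix ε) 𝔥)

/-- The inclusion of the Cartan subalgebra into the extended one, given by the inclusion of
simple coroots. -/
def incl : D.H →ₗ[k] 𝔥 :=
  D.base.toCoweightBasis.constr k fun α ↦ R.coroot (some α)

/-- The inclusion of the dual spaces, given by the inclusion of simple roots. -/
def inclDual : Dual k D.H →ₗ[k] Dual k 𝔥 :=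
  D.base.toWeightBasis.constr k fun α ↦ R.root (some α)

/-- The simple restricted roots of the extended algebra; as `σ(α₀) = -α₀`, the new one is
`α₀ - σ(α₀) = 2 α₀`. -/
def extRestrictedRoot : Option D.simpleRestricted → Dual k 𝔥
  | some s => inclDual R s.1
  | none => (2 : k) • R.root none

/-- The simple restricted coroots of the extended algebra; the new one is `½ α₀^∨`. -/
def extRestrictedCoroot : Option D.simpleRestricted → 𝔥
  | some s => incl R (D.check s.1)
  | none => (2⁻¹ : k) • R.coroot none

/-- The restricted Cartan matrix `Ã = (⟨α̃_i, α̃_j^∨⟩)`. -/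
def restrictedMatrix :
    Matrix (Option D.simpleRestricted) (Option D.simpleRestricted) k :=
  Matrix.of fun i j ↦ extRestrictedRoot R i (extRestrictedCoroot R j)

end Extended

end SymmetricDatum

/-! ### The type of the restricted root system -/

/-- Names of irreducible, not necessarily reduced, root systems. -/
inductive RootType
  | A (n : ℕ)
  | B (n : ℕ)
  | C (n : ℕ)
  | D (n : ℕ)
  | BC (n : ℕ)
  | E6
  | E7
  | E8
  | F4
  | G2

namespace RootType

/-- The rank. -/
def rank : RootType → ℕ
  | A n => n
  | B n => n
  | C n => n
  | D n => n
  | BC n => n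
  | E6 => 6
  | E7 => 7
  | E8 => 8
  | F4 => 4
  | G2 => 2

/-- The range of the ranks; `A 1` and `B 1` are both allowed (and are distinguished by the choice
of the weight `ε`), and so are `B 2` and `C 2` (which are numbered differently). -/
def Admissible : RootType → Prop
  | A n => 1 ≤ n
  | B n => 1 ≤ n
  | C n => 2 ≤ n
  | D n => 4 ≤ n
  | BC n => 1 ≤ n
  | _ => True

/-- The Cartan matrix `(⟨α_i, α_j^∨⟩)` in the numbering of Bourbaki. For type `BC` the simple
roots form a base of a subsystem of type `B`. -/
def cartanMatrix : (X : RootType) → Matrix (Fin X.rank) (Fin X.rank) ℤ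
  | A n => CartanMatrix.A n
  | B n => CartanMatrix.B n
  | C n => CartanMatrix.C n
  | D n => CartanMatrix.D n
  | BC n => CartanMatrix.B n
  | E6 => CartanMatrix.E₆
  | E7 => CartanMatrix.E₇
  | E8 => CartanMatrix.E₈
  | F4 => CartanMatrix.F₄
  | G2 => CartanMatrix.G₂.transpose

/-- Type `A`. -/
def IsA : RootType → Prop
  | A _ => True
  | _ => False

/-- Type `BC`. -/
def IsBC : RootType → Prop
  | BC _ => True
  | _ => False

/-- Type `B`, `BC`, `C` or `D`. -/
def IsBBCCD : RootType → Prop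
  | B _ => True
  | BC _ => True
  | C _ => True
  | D _ => True
  | _ => False

/-- The value on the first simple coroot of the distinguished weight: this weight is the first
fundamental weight `ω₁`, except for `B₁` where it is `2ω₁`. For `BC₁` the convention is
`⟨ω₁, α₁^∨⟩ = 2`. -/
def firstValue : RootType → ℕ
  | B 1 => 2
  | BC 1 => 2
  | _ => 1

end RootType

namespace SymmetricDatum

variable (D : SymmetricDatum k L)

/-- The restricted root system is of type `X`, and `num` is a numbering of its simple roots as in
Bourbaki: the Cartan matrix is that of `X`, and the root system is non-reduced exactly in
type `BC`. -/
structure IsNumbering (X : RootType) (num : Fin X.rank ≃ D.simpleRestricted) : Prop where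
  admissible : X.Admissible
  cartan : ∀ i j, (num i).1 (D.check (num j).1) = (X.cartanMatrix i j : k)
  nonreduced : X.IsBC ↔ ∃ β ∈ D.restrictedRoots, (2 : k) • β ∈ D.restrictedRoots

/-- `ε` is the first fundamental weight of the restricted root system (twice that weight in type
`B₁`) with respect to the numbering. -/
def IsFirstWeight (X : RootType) (num : Fin X.rank ≃ D.simpleRestricted) (ε : Dual k D.H) :
    Prop :=
  ∀ i, ε (D.check (num i).1) = if (i : ℕ) = 0 then (X.firstValue : k) else 0

end SymmetricDatum

end Symmetric

end ExtKM

end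

/-! Everything is reduced to the sign of one real number. An indecomposable generalized Cartan
matrix `A` has a real eigenvalue `t` with positive right and left eigenvectors (Perron–Frobenius for
`2 - A`; see `Indecomposable.exists_isPerron`). It is of finite type exactly when `t > 0` and of
affine type exactly when `t = 0`. Pairing with the left eigenvector shows that one nonnegative
nonzero vector `v` for which `A v` has constant sign determines the sign of `t`; all later arguments
produce such test vectors.

On the Lie algebra side, the Kac–Moody algebra is finite dimensional if and only if `t > 0`
(`Realization.finite_iff_of_isPerron`). If `t > 0`, the diagram is a forest, so `A` is symmetrizable
and the resulting form is positive definite. A non-simple positive root can be shortened by a simple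
reflection without changing its norm, hence the norms of roots are bounded and only finitely many
roots exist. Conversely, in a finite dimensional algebra a longest nonzero bracket of positive
generators is a highest weight vector of the adjoint representation, and its weight is a test
vector. The inputs are the triangular decomposition, the embedding of `𝔥` (through a highest weight
representation) and the absence of ideals meeting `𝔥` trivially.

The extended matrix and its restriction are compared by a folding (`SymmetricDatum.isFolding`). A
simple restricted root is `α + α'` plus simple roots fixed by `σ`, and on anti-invariant weights the
coroot of a non-fixed simple root is a positive multiple of its restricted coroot. Therefore the
restricted roots, weighted by the left Perron vector of the restricted matrix, form a test vector
for the extended matrix, and the two eigenvalues have the same sign (`IsFolding.sign_eq`).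
Integrality of the restricted matrix requires that a root and its image under `σ` never have pairing
`-1`; this is where maximal splitness enters, by a Cayley transform
(`SymmetricDatum.σ_ne_neg_of_fixed`).

If `ε ≠ 0`, simplicity of `σ` makes the extended matrix indecomposable
(`SymmetricDatum.indecomposable_intExt`). If `ε = 0`, the new node is detached and finite type is
checked directly with the sum of the positive roots. For the first fundamental weight the restricted
matrix is explicit, and `RootType.sign_extended` gives a test vector for each type. -/

noncomputable section

set_option linter.unusedSectionVars false

namespace ExtKM

/-! ### Perron eigenvalue of a generalized Cartan matrix and the finite/affine types -/

section MatrixTheory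

variable {ι : Type*}

lemma IsGCM.transpose {A : Matrix ι ι ℤ} (hA : IsGCM A) : IsGCM A.transpose where
  diag := hA.diag
  nonpos i j hij := hA.nonpos j i hij.symm
  zero_symm i j h := hA.zero_symm j i h

lemma IsGCM.block {A : Matrix ι ι ℤ} (hA : IsGCM A) (S : Finset ι) : IsGCM (block A S) where
  diag i := hA.diag i
  nonpos i j hij := hA.nonpos i j (fun h ↦ hij (Subtype.ext h))
  zero_symm i j h := hA.zero_symm i j h

lemma IsGCM.nonpos_real {A : Matrix ι ι ℤ} (hA : IsGCM A) {i j : ι} (hij : i ≠ j) :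
    (A i j : ℝ) ≤ 0 := by exact_mod_cast hA.nonpos i j hij

lemma Indecomposable.transpose {A : Matrix ι ι ℤ} (hA : Indecomposable A) :
    Indecomposable A.transpose :=
  ⟨hA.1, fun S h1 h2 ↦ by
    obtain ⟨i, hi, j, hj, h⟩ := hA.2 S h1 h2
    exact ⟨i, hi, j, hj, h.symm⟩⟩

lemma Indecomposable.exists_ne_zero {A : Matrix ι ι ℤ} (hA : Indecomposable A) (hG : IsGCM A)
    {S : Set ι} (h1 : S.Nonempty) (h2 : Sᶜ.Nonempty) :
    ∃ i ∈ S, ∃ j ∈ Sᶜ, A i j ≠ 0 ∧ A j i ≠ 0 := by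
  obtain ⟨i, hi, j, hj, h⟩ := hA.2 S h1 h2
  refine ⟨i, hi, j, hj, ?_⟩
  rcases h with h | h
  · exact ⟨h, fun h' ↦ h (hG.zero_symm _ _ h')⟩
  · exact ⟨fun h' ↦ h (hG.zero_symm _ _ h'), h⟩

variable [Fintype ι]

lemma realMulVec_apply (A : Matrix ι ι ℤ) (v : ι → ℝ) (i : ι) :
    realMulVec A v i = ∑ j, (A i j : ℝ) * v j := rfl

lemma realMulVec_sub (A : Matrix ι ι ℤ) (v w : ι → ℝ) :
    realMulVec A (v - w) = realMulVec A v - realMulVec A w := by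
  simp [realMulVec, Matrix.mulVec_sub]

lemma realMulVec_add (A : Matrix ι ι ℤ) (v w : ι → ℝ) :
    realMulVec A (v + w) = realMulVec A v + realMulVec A w := by
  simp [realMulVec, Matrix.mulVec_add]

lemma realMulVec_smul (A : Matrix ι ι ℤ) (c : ℝ) (v : ι → ℝ) :
    realMulVec A (c • v) = c • realMulVec A v := by
  simp [realMulVec, Matrix.mulVec_smul]

lemma sum_mul_realMulVec (A : Matrix ι ι ℤ) (p v : ι → ℝ) :
    ∑ i, p i * realMulVec A v i = ∑ i, realMulVec A.transpose p i * v i := by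
  simp only [realMulVec_apply, Finset.mul_sum, Finset.sum_mul, Matrix.transpose_apply]
  rw [Finset.sum_comm]
  exact Finset.sum_congr rfl fun i _ ↦ Finset.sum_congr rfl fun j _ ↦ by ring

/-- Where `w` vanishes the diagonal entry contributes nothing, so the row is a sum of nonpositive
terms and is bounded by any one of them. This is the maximum principle behind the whole section. -/
lemma IsGCM.realMulVec_le_of_eq_zero {A : Matrix ι ι ℤ} (hA : IsGCM A) {w : ι → ℝ}
    (hw : ∀ i, 0 ≤ w i) {i : ι} (hi : w i = 0) :
    ∀ j, realMulVec A w i ≤ (A i j : ℝ) * w j := by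
  classical
  intro j
  rw [realMulVec_apply, ← Finset.add_sum_erase _ _ (Finset.mem_univ j)]
  have : ∑ x ∈ Finset.univ.erase j, (A i x : ℝ) * w x ≤ 0 := by
    refine Finset.sum_nonpos fun x _ ↦ ?_
    by_cases hx : i = x
    · subst hx; simp [hi]
    · exact mul_nonpos_of_nonpos_of_nonneg (hA.nonpos_real hx) (hw x)
  linarith

lemma IsGCM.realMulVec_nonpos_of_eq_zero {A : Matrix ι ι ℤ} (hA : IsGCM A) {w : ι → ℝ}
    (hw : ∀ i, 0 ≤ w i) {i : ι} (hi : w i = 0) : realMulVec A w i ≤ 0 := by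
  simpa [hi] using hA.realMulVec_le_of_eq_zero hw hi i

/-- A nonnegative vector on whose zero set `A w` is nonnegative is zero or positive. -/
lemma Indecomposable.eq_zero_or_pos {A : Matrix ι ι ℤ} (hI : Indecomposable A) (hA : IsGCM A)
    {w : ι → ℝ} (hw : ∀ i, 0 ≤ w i) (h : ∀ i, w i = 0 → 0 ≤ realMulVec A w i) :
    w = 0 ∨ ∀ i, 0 < w i := by
  by_contra! hcon
  obtain ⟨h0, i, hi⟩ := hcon
  obtain ⟨i, hi, j, hj, hij, -⟩ := hI.exists_ne_zero hA (S := {i | w i = 0})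
    ⟨i, le_antisymm hi (hw i)⟩ (by
      by_contra hne
      rw [Set.not_nonempty_iff_eq_empty, Set.compl_empty_iff] at hne
      exact h0 (funext fun x ↦ (hne ▸ Set.mem_univ x : x ∈ {i | w i = 0})))
  have h1 := hA.realMulVec_le_of_eq_zero hw hi j
  have h2 := h i hi
  have hne : i ≠ j := fun e ↦ hj (e ▸ hi)
  have h3 : (A i j : ℝ) < 0 := lt_of_le_of_ne (hA.nonpos_real hne) (by exact_mod_cast hij)
  have h4 : 0 < w j := lt_of_le_of_ne (hw j) (Ne.symm hj)
  nlinarith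

/-- The Collatz–Wielandt characterization: the eigenvalue sought is the least `t` for which some
nonzero `x ≥ 0` satisfies `A x ≤ t x`. The minimum exists by compactness after normalizing `x` to
the standard simplex. -/
lemma exists_minimal_eigenvalue_bound {A : Matrix ι ι ℤ} [Nonempty ι] (hA : IsGCM A) :
    ∃ (t : ℝ) (x : ι → ℝ), (∀ i, 0 ≤ x i) ∧ x ≠ 0 ∧ (∀ i, realMulVec A x i ≤ t * x i) ∧
      ∀ (s : ℝ) (y : ι → ℝ), (∀ i, 0 ≤ y i) → y ≠ 0 → (∀ i, realMulVec A y i ≤ s * y i) →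
        t ≤ s := by
  classical
  set N : ℝ := ∑ i, ∑ j, |(A i j : ℝ)| with hN
  -- Restricting the bound to a compact interval loses nothing: `2` always works because the
  -- off-diagonal entries are nonpositive, and summing all rows shows that no bound below `-N`
  -- works.
  let K : Set ((ι → ℝ) × ℝ) := {q | q ∈ stdSimplex ℝ ι ×ˢ Set.Icc (-N) 2 ∧
    ∀ i, realMulVec A q.1 i ≤ q.2 * q.1 i}
  have hcont : ∀ i, Continuous fun q : (ι → ℝ) × ℝ ↦ realMulVec A q.1 i := by
    intro i
    simp only [realMulVec_apply]
    fun_prop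
  have hK : IsCompact K := by
    refine ((isCompact_stdSimplex ℝ ι).prod isCompact_Icc).inter_right (t := {q |
      ∀ i, realMulVec A q.1 i ≤ q.2 * q.1 i}) ?_
    simp only [Set.ofPred_forall]
    exact isClosed_iInter fun i ↦ isClosed_le (hcont i) (by fun_prop)
  have hlow : ∀ (s : ℝ) (y : ι → ℝ), y ∈ stdSimplex ℝ ι →
      (∀ i, realMulVec A y i ≤ s * y i) → -N ≤ s := by
    intro s y hy h
    have h1 : ∑ i, realMulVec A y i ≤ s := by
      calc _ ≤ ∑ i, s * y i := Finset.sum_le_sum fun i _ ↦ h i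
        _ = s := by rw [← Finset.mul_sum, hy.2, mul_one]
    refine le_trans ?_ h1
    rw [hN, ← Finset.sum_neg_distrib]
    refine Finset.sum_le_sum fun i _ ↦ ?_
    rw [realMulVec_apply, ← Finset.sum_neg_distrib]
    refine Finset.sum_le_sum fun j _ ↦ ?_
    have h0 := hy.1 j
    have h1 : y j ≤ 1 := by
      rw [← hy.2]; exact Finset.single_le_sum (fun i _ ↦ hy.1 i) (Finset.mem_univ j)
    have := abs_nonneg (A i j : ℝ)
    have := neg_abs_le (A i j : ℝ)
    nlinarith
  have htwo : ∀ (y : ι → ℝ), (∀ i, 0 ≤ y i) → ∀ i, realMulVec A y i ≤ 2 * y i := by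
    intro y hy i
    rw [realMulVec_apply, ← Finset.add_sum_erase _ _ (Finset.mem_univ i), hA.diag]
    have : ∑ x ∈ Finset.univ.erase i, (A i x : ℝ) * y x ≤ 0 :=
      Finset.sum_nonpos fun x hx ↦ mul_nonpos_of_nonpos_of_nonneg
        (hA.nonpos_real (Finset.ne_of_mem_erase hx).symm) (hy x)
    push_cast
    linarith
  have hne : K.Nonempty := by
    obtain ⟨i⟩ := ‹Nonempty ι›
    have h1 := single_mem_stdSimplex ℝ i
    refine ⟨(Pi.single i 1, 2), ⟨⟨h1, hlow _ _ h1 (htwo _ h1.1), le_rfl⟩, htwo _ h1.1⟩⟩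
  obtain ⟨⟨x, t⟩, ⟨⟨hx, ht⟩, hxt⟩, hmin⟩ := hK.exists_isMinOn hne continuous_snd.continuousOn
  refine ⟨t, x, hx.1, ?_, hxt, fun s y hy0 hy h ↦ ?_⟩
  · rintro rfl
    simpa using hx.2
  · by_cases hs : s ≤ 2
    · have hpos : 0 < ∑ i, y i := by
        obtain ⟨i, hi⟩ := Function.ne_iff.1 hy
        exact Finset.sum_pos' (fun i _ ↦ hy0 i)
          ⟨i, Finset.mem_univ i, lt_of_le_of_ne (hy0 i) (Ne.symm hi)⟩
      set c : ℝ := (∑ i, y i)⁻¹ with hc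
      have hc0 : 0 < c := inv_pos.2 hpos
      have hmem : c • y ∈ stdSimplex ℝ ι := by
        refine ⟨fun i ↦ mul_nonneg hc0.le (hy0 i), ?_⟩
        simp only [Pi.smul_apply, smul_eq_mul, ← Finset.mul_sum]
        exact inv_mul_cancel₀ hpos.ne'
      have hle : ∀ i, realMulVec A (c • y) i ≤ s * (c • y) i := fun i ↦ by
        rw [realMulVec_smul]
        simp only [Pi.smul_apply, smul_eq_mul]
        have := mul_le_mul_of_nonneg_left (h i) hc0.le
        linarith
      exact hmin (a := (c • y, s)) ⟨⟨hmem, hlow _ _ hmem hle, hs⟩, hle⟩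
    · exact ht.2.trans (not_le.1 hs).le

/-- Among the vectors attaining the minimal bound `t`, one with the largest number of strict
inequalities has none at all: if all rows were strict, `t` could be decreased, and if only some
were, indecomposability would allow a perturbation making one more row strict. -/
lemma Indecomposable.exists_eigenvector {A : Matrix ι ι ℤ} (hI : Indecomposable A)
    (hA : IsGCM A) : ∃ (t : ℝ) (x : ι → ℝ), (∀ i, 0 < x i) ∧ realMulVec A x = t • x := by
  classical
  have := hI.1
  obtain ⟨t, x₀, hx₀, hx₀', hle₀, hmin⟩ := exists_minimal_eigenvalue_bound hA
  let slack (x : ι → ℝ) : Finset ι := Finset.univ.filter fun i ↦ realMulVec A x i < t * x i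
  let good (n : ℕ) : Prop := ∃ x : ι → ℝ, (∀ i, 0 ≤ x i) ∧ x ≠ 0 ∧
    (∀ i, realMulVec A x i ≤ t * x i) ∧ (slack x).card = n
  have hgood : ∃ n, good n ∧ ∀ m, good m → m ≤ n := by
    have hb : ∀ m, good m → m ≤ Fintype.card ι := by
      rintro m ⟨x, -, -, -, rfl⟩
      exact Finset.card_le_univ _
    refine ⟨Nat.findGreatest good (Fintype.card ι), ?_, fun m hm ↦
      Nat.le_findGreatest (hb m hm) hm⟩
    exact Nat.findGreatest_spec (hb _ ⟨x₀, hx₀, hx₀', hle₀, rfl⟩) ⟨x₀, hx₀, hx₀', hle₀, rfl⟩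
  obtain ⟨n, ⟨x, hx, hx', hle, rfl⟩, hmax⟩ := hgood
  have hslack : ∀ i, i ∈ slack x ↔ realMulVec A x i < t * x i := by simp [slack]
  have hempty : slack x = ∅ := by
    by_contra hne
    obtain ⟨i₀, hi₀⟩ := Finset.nonempty_iff_ne_empty.2 hne
    by_cases huniv : ∀ i, i ∈ slack x
    · -- all rows are slack: decrease the bound
      obtain ⟨i₁, -, hi₁⟩ := Finset.exists_max_image Finset.univ x ⟨i₀, Finset.mem_univ _⟩
      obtain ⟨i₂, -, hi₂⟩ := Finset.exists_min_image Finset.univ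
        (fun i ↦ t * x i - realMulVec A x i) ⟨i₀, Finset.mem_univ _⟩
      set δ := t * x i₂ - realMulVec A x i₂
      have hδ : 0 < δ := sub_pos.2 ((hslack i₂).1 (huniv i₂))
      have hX : 0 ≤ x i₁ := hx i₁
      have := hmin (t - δ / (x i₁ + 1)) x hx hx' fun i ↦ by
        have h1 := hi₁ i (Finset.mem_univ i)
        have h2 := hi₂ i (Finset.mem_univ i)
        have h3 : δ / (x i₁ + 1) * x i ≤ δ := by
          rw [div_mul_eq_mul_div, div_le_iff₀ (by linarith)]
          nlinarith
        linarith
      have : 0 < δ / (x i₁ + 1) := by positivity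
      linarith
    · push Not at huniv
      obtain ⟨j₀, hj₀⟩ := huniv
      obtain ⟨i, hi, j, hj, -, hji⟩ := hI.exists_ne_zero hA (S := (slack x : Set ι))
        ⟨i₀, hi₀⟩ ⟨j₀, hj₀⟩
      have hij : i ≠ j := fun e ↦ hj (e ▸ hi)
      have hji' : (A j i : ℝ) < 0 :=
        lt_of_le_of_ne (hA.nonpos_real hij.symm) (by exact_mod_cast hji)
      set s := t * x i - realMulVec A x i with hs
      have hs0 : 0 < s := sub_pos.2 ((hslack i).1 hi)
      -- Adding `δ` to the coordinate `i` costs row `i` the amount `δ (2 - t)`, so `δ` is chosen to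
      -- keep this below its slack `s`. All other rows only improve, and row `j` does so strictly
      -- since `A j i < 0`.
      set δ := s / (2 * (|2 - t| + 1)) with hδ
      have habs := abs_nonneg (2 - t)
      have hδ0 : 0 < δ := by positivity
      have hδs : δ * (2 - t) < s := by
        have h1 : δ * (|2 - t| + 1) = s / 2 := by rw [hδ]; field_simp
        have h2 := le_abs_self (2 - t)
        nlinarith
      set y := x + Pi.single i δ with hy
      have hyval : ∀ l, realMulVec A y l = realMulVec A x l + (A l i : ℝ) * δ := fun l ↦ by
        rw [hy, realMulVec_add]
        simp [realMulVec_apply, Pi.single_apply]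
      have hyi : y i = x i + δ := by simp [hy]
      have hyl : ∀ l, l ≠ i → y l = x l := fun l hl ↦ by simp [hy, hl]
      have hlt : ∀ l, l ∈ slack x ∨ l = j → realMulVec A y l < t * y l := by
        intro l hl
        rw [hyval]
        by_cases hli : l = i
        · subst hli
          rw [hyi, hA.diag]
          push_cast
          nlinarith
        · rw [hyl l hli]
          rcases hl with hl | rfl
          · have := (hslack l).1 hl
            have := hA.nonpos_real hli
            nlinarith
          · have := hle l
            nlinarith
      have hyle : ∀ l, realMulVec A y l ≤ t * y l := by
        intro l
        by_cases hli : l = i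
        · exact (hlt l (Or.inl (hli ▸ hi))).le
        · rw [hyval, hyl l hli]
          have := hle l
          have := hA.nonpos_real hli
          nlinarith
      have hynn : ∀ l, 0 ≤ y l := fun l ↦ by
        by_cases hli : l = i
        · subst hli; rw [hyi]; have := hx l; linarith
        · rw [hyl l hli]; exact hx l
      have hcard := hmax _ ⟨y, hynn, fun h0 ↦ by
        have := congrFun h0 i
        rw [hyi] at this
        have := hx i
        simp at *
        linarith, hyle, rfl⟩
      have hss : insert j (slack x) ⊆ slack y := by
        intro l hl
        rw [Finset.mem_insert] at hl
        simpa [slack] using hlt l hl.symm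
      have := Finset.card_le_card hss
      rw [Finset.card_insert_of_notMem (by simpa using hj)] at this
      omega
  have heq : realMulVec A x = t • x := by
    ext i
    have : i ∉ slack x := by simp [hempty]
    rw [hslack, not_lt] at this
    exact le_antisymm (hle i) this
  refine ⟨t, x, ?_, heq⟩
  refine (hI.eq_zero_or_pos hA hx fun i hi ↦ ?_).resolve_left hx'
  rw [heq]; simp [hi]

/-- `t` is the eigenvalue of `A` with positive eigenvectors `u` (right) and `p` (left). -/
structure IsPerron (A : Matrix ι ι ℤ) (t : ℝ) (u p : ι → ℝ) : Prop where
  u_pos : ∀ i, 0 < u i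
  p_pos : ∀ i, 0 < p i
  right : realMulVec A u = t • u
  left : realMulVec A.transpose p = t • p

/-- The transpose has a positive eigenvector too, and evaluating `p · A u` in two ways shows that
both eigenvalues agree, as `p · u > 0`. -/
lemma Indecomposable.exists_isPerron {A : Matrix ι ι ℤ} (hI : Indecomposable A)
    (hA : IsGCM A) : ∃ t u p, IsPerron A t u p := by
  obtain ⟨t, u, hu, htu⟩ := hI.exists_eigenvector hA
  obtain ⟨s, p, hp, hsp⟩ := hI.transpose.exists_eigenvector hA.transpose
  have := sum_mul_realMulVec A p u
  rw [htu, hsp] at this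
  simp only [Pi.smul_apply, smul_eq_mul] at this
  have h2 : t * ∑ i, p i * u i = s * ∑ i, p i * u i := by
    rw [Finset.mul_sum, Finset.mul_sum]
    calc _ = ∑ i, p i * (t * u i) := Finset.sum_congr rfl fun i _ ↦ by ring
      _ = _ := this.trans (Finset.sum_congr rfl fun i _ ↦ by ring)
  have hpos : 0 < ∑ i, p i * u i := by
    have := hI.1
    exact Finset.sum_pos (fun i _ ↦ mul_pos (hp i) (hu i)) Finset.univ_nonempty
  have hts : t = s := mul_right_cancel₀ hpos.ne' h2
  exact ⟨t, u, p, hu, hp, htu, hts ▸ hsp⟩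

namespace IsPerron

variable {A : Matrix ι ι ℤ} {t : ℝ} {u p : ι → ℝ}

lemma sum_mul (h : IsPerron A t u p) (v : ι → ℝ) :
    ∑ i, p i * realMulVec A v i = t * ∑ i, p i * v i := by
  rw [sum_mul_realMulVec, h.left, Finset.mul_sum]
  exact Finset.sum_congr rfl fun i _ ↦ by simp [mul_assoc]

lemma sum_pos (h : IsPerron A t u p) {v : ι → ℝ} (hv : ∀ i, 0 ≤ v i) (hv0 : v ≠ 0) :
    0 < ∑ i, p i * v i := by
  obtain ⟨i, hi⟩ := Function.ne_iff.1 hv0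
  exact Finset.sum_pos' (fun i _ ↦ mul_nonneg (h.p_pos i).le (hv i))
    ⟨i, Finset.mem_univ i, mul_pos (h.p_pos i) (lt_of_le_of_ne (hv i) (Ne.symm hi))⟩

/-- The sign of the Perron eigenvalue is read off from a nonnegative test vector. -/
lemma pos_of_realMulVec (h : IsPerron A t u p) {v : ι → ℝ} (hv : ∀ i, 0 ≤ v i)
    (hAv : ∀ i, 0 ≤ realMulVec A v i) (hAv0 : realMulVec A v ≠ 0) : 0 < t := by
  have h1 := h.sum_pos hAv hAv0
  rw [h.sum_mul] at h1
  exact pos_of_mul_pos_left h1 (Finset.sum_nonneg fun i _ ↦ mul_nonneg (h.p_pos i).le (hv i))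

lemma neg_of_realMulVec (h : IsPerron A t u p) {v : ι → ℝ} (hv : ∀ i, 0 ≤ v i)
    (hAv : ∀ i, realMulVec A v i ≤ 0) (hAv0 : realMulVec A v ≠ 0) : t < 0 := by
  have h1 := h.sum_pos (v := - realMulVec A v) (fun i ↦ by simpa using hAv i)
    (by simpa using hAv0)
  simp only [Pi.neg_apply, mul_neg, Finset.sum_neg_distrib] at h1
  rw [h.sum_mul] at h1
  have := Finset.sum_nonneg fun i (_ : i ∈ Finset.univ) ↦ mul_nonneg (h.p_pos i).le (hv i)
  by_contra! ht
  have := mul_nonneg ht this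
  linarith

lemma eq_zero_of_realMulVec (h : IsPerron A t u p) {v : ι → ℝ} (hv : ∀ i, 0 ≤ v i) (hv0 : v ≠ 0)
    (hAv : realMulVec A v = 0) : t = 0 := by
  have h1 := h.sum_mul v
  rw [hAv] at h1
  simpa [(h.sum_pos hv hv0).ne'] using h1.symm

/-- Subtracting the largest multiple of `u` that keeps `v` nonnegative produces a zero coordinate,
to which the maximum principle applies. -/
lemma exists_shift [Nonempty ι] (h : IsPerron A t u p) (v : ι → ℝ) :
    ∃ (c : ℝ) (i : ι), (∀ j, 0 ≤ v j - c * u j) ∧ v i - c * u i = 0 := by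
  obtain ⟨i, -, hi⟩ := Finset.exists_min_image Finset.univ (fun i ↦ v i / u i)
    Finset.univ_nonempty
  refine ⟨v i / u i, i, fun j ↦ ?_, ?_⟩
  · have := hi j (Finset.mem_univ j)
    rw [le_div_iff₀ (h.u_pos j)] at this
    linarith
  · rw [div_mul_cancel₀ _ (h.u_pos i).ne', sub_self]

lemma realMulVec_shift (h : IsPerron A t u p) (v : ι → ℝ) (c : ℝ) :
    realMulVec A (v - c • u) = realMulVec A v - (c * t) • u := by
  rw [realMulVec_sub, realMulVec_smul, h.right, smul_smul]

/-- Suppose `A v ≥ 0` and let `c` be the minimum of `v i / u i`. A negative `c` would make `A (v - c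
u)` positive at a zero of the nonnegative vector `v - c u`. So `c ≥ 0`; then `v > 0` if `c > 0`, and
otherwise indecomposability decides. A kernel vector and its negative both fall under this
dichotomy, whence the determinant is nonzero. -/
lemma satisfiesFin (h : IsPerron A t u p) (ht : 0 < t) (hI : Indecomposable A) (hA : IsGCM A) :
    SatisfiesFin A := by
  classical
  have := hI.1
  have key : ∀ v : ι → ℝ, (∀ i, 0 ≤ realMulVec A v i) → (∀ i, 0 < v i) ∨ v = 0 := by
    intro v hv
    obtain ⟨c, i, hc, hi⟩ := h.exists_shift v
    have hc0 : 0 ≤ c := by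
      by_contra! hneg
      have h1 := hA.realMulVec_nonpos_of_eq_zero (w := v - c • u) hc hi
      rw [h.realMulVec_shift] at h1
      have h2 := hv i
      have h3 := h.u_pos i
      have h4 : 0 < (-c) * t * u i := by have : 0 < -c := by linarith
                                         positivity
      simp at h1
      linarith
    rcases hc0.eq_or_lt with rfl | hc0
    · refine (hI.eq_zero_or_pos hA (by simpa using hc) fun i _ ↦ hv i).symm
    · left
      intro j
      have := hc j
      have := mul_pos hc0 (h.u_pos j)
      linarith
  refine ⟨fun hdet ↦ ?_, ⟨u, h.u_pos, fun i ↦ ?_⟩, key⟩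
  · obtain ⟨v, hv0, hv⟩ := Matrix.exists_mulVec_eq_zero_iff.2
      (show (A.map (Int.cast : ℤ → ℝ)).det = 0 by
        have := Int.cast_det (R := ℝ) A
        rw [hdet] at this
        simpa using this.symm)
    have hv' : realMulVec A v = 0 := hv
    rcases key v (by simp [hv']) with h1 | h1
    · rcases key (-v) (by
        intro i
        have : realMulVec A (-v) = 0 := by simp [realMulVec, Matrix.mulVec_neg, hv]
        simp [this]) with h2 | h2
      · obtain ⟨i⟩ := hI.1
        have := h1 i
        have := h2 i
        simp at this
        linarith
      · exact hv0 (neg_eq_zero.1 h2)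
    · exact hv0 h1
  · rw [h.right]
    exact mul_pos ht (h.u_pos i)

lemma satisfiesFin_iff (h : IsPerron A t u p) (hI : Indecomposable A) (hA : IsGCM A) :
    SatisfiesFin A ↔ 0 < t := by
  refine ⟨fun hf ↦ ?_, fun ht ↦ h.satisfiesFin ht hI hA⟩
  obtain ⟨v, hv, hAv⟩ := hf.exists_pos
  refine h.pos_of_realMulVec (fun i ↦ (hv i).le) (fun i ↦ (hAv i).le) fun h0 ↦ ?_
  obtain ⟨i⟩ := hI.1
  have := hAv i
  simp [h0] at this

/-- For `t = 0` a kernel vector shifted by a multiple of `u` is nonnegative with a zero coordinate,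
hence zero, so the kernel is the line through `u`. If `A v ≥ 0`, then `p · A v = 0` with `p > 0`
forces `A v = 0`. -/
lemma satisfiesAff_iff (h : IsPerron A t u p) (hI : Indecomposable A) (hA : IsGCM A) :
    SatisfiesAff A ↔ t = 0 := by
  classical
  have := hI.1
  constructor
  · intro hf
    obtain ⟨v, hv, hAv⟩ := hf.exists_pos
    refine h.eq_zero_of_realMulVec (fun i ↦ (hv i).le) (fun h0 ↦ ?_) hAv
    obtain ⟨i⟩ := hI.1
    have := hv i
    simp [h0] at this
  · rintro rfl
    refine ⟨?_, ⟨u, h.u_pos, by simp [h.right]⟩, fun v hv ↦ ?_⟩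
    · have hker : LinearMap.ker (A.map (Int.cast : ℤ → ℝ)).mulVecLin = Submodule.span ℝ {u} := by
        refine le_antisymm (fun v hv ↦ ?_) ?_
        · have hv : realMulVec A v = 0 := hv
          obtain ⟨c, i, hc, hi⟩ := h.exists_shift v
          have h1 : realMulVec A (v - c • u) = 0 := by rw [h.realMulVec_shift, hv]; simp
          rcases hI.eq_zero_or_pos hA (w := v - c • u) hc (by simp [h1]) with h2 | h2
          · exact Submodule.mem_span_singleton.2 ⟨c, (sub_eq_zero.1 h2).symm⟩
          · exact absurd hi (h2 i).ne'
        · rw [Submodule.span_singleton_le_iff_mem]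
          have : realMulVec A u = 0 := by simp [h.right]
          exact this
      have hrn := LinearMap.finrank_range_add_finrank_ker (A.map (Int.cast : ℤ → ℝ)).mulVecLin
      rw [hker, finrank_span_singleton (by
        intro h0
        obtain ⟨i⟩ := hI.1
        have := h.u_pos i
        simp [h0] at this), Module.finrank_pi] at hrn
      exact hrn
    · have h1 := h.sum_mul v
      rw [zero_mul] at h1
      ext i
      have := (Finset.sum_eq_zero_iff_of_nonneg fun i _ ↦
        mul_nonneg (h.p_pos i).le (hv i)).1 h1 i (Finset.mem_univ i)
      simpa [(h.p_pos i).ne'] using this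

end IsPerron

section Types

variable {k : Type*} [Field k] [CharZero k]

omit [Fintype ι] in
lemma map_intCast_injective {A B : Matrix ι ι ℤ}
    (h : A.map (Int.cast : ℤ → k) = B.map (Int.cast : ℤ → k)) : A = B := by
  ext i j
  have := congrFun (congrFun h i) j
  simpa using this

lemma IsComponent.eq_univ {A : Matrix ι ι ℤ} (hI : Indecomposable A) {S : Finset ι}
    (hS : IsComponent A S) : S = Finset.univ := by
  by_contra hne
  obtain ⟨⟨i, hi⟩⟩ := hS.1.1
  obtain ⟨j, hj⟩ : ∃ j, j ∉ S := by
    by_contra! h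
    exact hne (Finset.eq_univ_iff_forall.2 h)
  obtain ⟨i, hi, j, hj, h⟩ := hI.2 (S : Set ι) ⟨i, hi⟩ ⟨j, hj⟩
  have := hS.2 i hi j hj
  tauto

lemma Indecomposable.block_univ {A : Matrix ι ι ℤ} (hI : Indecomposable A) :
    Indecomposable (block A Finset.univ) := by
  refine ⟨hI.1.map fun i ↦ ⟨i, Finset.mem_univ i⟩, fun S ⟨i, hi⟩ ⟨j, hj⟩ ↦ ?_⟩
  obtain ⟨i, hi, j, hj, h⟩ := hI.2 (Subtype.val '' S) ⟨i.1, i, hi, rfl⟩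
    ⟨j.1, by rintro ⟨x, hx, hxj⟩; exact hj (Subtype.ext hxj ▸ hx)⟩
  obtain ⟨i, hi, rfl⟩ := hi
  exact ⟨i, hi, ⟨j, Finset.mem_univ j⟩, fun hj' ↦ hj ⟨_, hj', rfl⟩, h⟩

lemma realMulVec_block_univ (A : Matrix ι ι ℤ) (v : ι → ℝ) (i : ι) :
    realMulVec (block A Finset.univ) (fun j ↦ v j) ⟨i, Finset.mem_univ i⟩ = realMulVec A v i := by
  simp only [realMulVec_apply]
  exact Finset.sum_coe_sort Finset.univ fun j ↦ (A i j : ℝ) * v j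

/-- An indecomposable matrix has the full index set as its only component, so the componentwise
definition reduces to the condition on the matrix itself, up to reindexing by a subtype. -/
lemma IsPerron.isFiniteType_iff {A : Matrix ι ι ℤ} {t : ℝ} {u p : ι → ℝ} (h : IsPerron A t u p)
    (hI : Indecomposable A) (hA : IsGCM A) :
    IsFiniteType (A.map (Int.cast : ℤ → k)) ↔ 0 < t := by
  have hblock : IsPerron (ExtKM.block A Finset.univ) t (fun j ↦ u j) (fun j ↦ p j) := by
    refine ⟨fun i ↦ h.u_pos i, fun i ↦ h.p_pos i, ?_, ?_⟩
    · ext ⟨i, hi⟩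
      rw [realMulVec_block_univ, h.right]; rfl
    · ext ⟨i, hi⟩
      have := realMulVec_block_univ A.transpose p i
      rw [h.left] at this
      exact this
  have hiff := hblock.satisfiesFin_iff hI.block_univ (hA.block _)
  constructor
  · rintro ⟨B, hB, hB1, hB2⟩
    obtain rfl := map_intCast_injective hB
    exact hiff.1 (hB2 _ ⟨hI.block_univ, by simp⟩)
  · intro ht
    refine ⟨A, rfl, hA, fun S hS ↦ ?_⟩
    obtain rfl := hS.eq_univ hI
    exact hiff.2 ht

lemma IsPerron.isAffineType_iff {A : Matrix ι ι ℤ} {t : ℝ} {u p : ι → ℝ} (h : IsPerron A t u p)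
    (hI : Indecomposable A) (hA : IsGCM A) :
    IsAffineType (A.map (Int.cast : ℤ → k)) ↔ t = 0 := by
  rw [← h.satisfiesAff_iff hI hA]
  constructor
  · rintro ⟨B, hB, -, -, hB2⟩
    obtain rfl := map_intCast_injective hB
    exact hB2
  · intro ht
    exact ⟨A, rfl, hA, hI, ht⟩

end Types

end MatrixTheory

/-! ### Symmetrizability and positive definiteness -/

section Symmetrizable

variable {ι : Type*}

/-- Both entries are at most `-1` because they are negative integers, and `x + 1/x ≥ 2` for `x = u j
/ u i`. -/
lemma IsGCM.neighbour_sum_nonpos {A : Matrix ι ι ℤ} (hA : IsGCM A) {u : ι → ℝ}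
    (hu : ∀ i, 0 < u i) {i j : ι} (hij : i ≠ j) (h : A i j ≠ 0) :
    (A i j * u j / u i + 1 : ℝ) + (A j i * u i / u j + 1) ≤ 0 := by
  have h' : A j i ≠ 0 := fun h0 ↦ h (hA.zero_symm _ _ h0)
  have h1 : (A i j : ℝ) ≤ -1 := by
    have := hA.nonpos i j hij
    exact_mod_cast (show A i j ≤ -1 by omega)
  have h2 : (A j i : ℝ) ≤ -1 := by
    have := hA.nonpos j i hij.symm
    exact_mod_cast (show A j i ≤ -1 by omega)
  have hi := hu i
  have hj := hu j
  have h3 : (A i j : ℝ) * u j / u i ≤ - (u j / u i) := by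
    rw [mul_div_assoc]
    have : 0 < u j / u i := by positivity
    nlinarith
  have h4 : (A j i : ℝ) * u i / u j ≤ - (u i / u j) := by
    rw [mul_div_assoc]
    have : 0 < u i / u j := by positivity
    nlinarith
  have h5 : 2 ≤ u j / u i + u i / u j := by
    rw [div_add_div _ _ hi.ne' hj.ne', le_div_iff₀ (by positivity)]
    nlinarith [sq_nonneg (u i - u j)]
  linarith

/-- A finite part of a matrix with `A u > 0` has a node with at most one neighbour. -/
lemma IsGCM.exists_leaf [DecidableEq ι] {A : Matrix ι ι ℤ} (hA : IsGCM A) {u : ι → ℝ}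
    (hu : ∀ i, 0 < u i) {S : Finset ι} (hS : S.Nonempty)
    (h : ∀ i ∈ S, 0 < ∑ j ∈ S, (A i j : ℝ) * u j) :
    ∃ i ∈ S, ((S.erase i).filter fun j ↦ A i j ≠ 0).card ≤ 1 := by
  by_contra! hcon
  -- Summed over all pairs, `g` is nonpositive, since every edge contributes at most zero. Summed
  -- over row `i`, it is `(A u)_i / u i - 2` plus the number of neighbours, which is positive if
  -- every node has at least two neighbours.
  let g : ι → ι → ℝ := fun i j ↦
    if i ≠ j ∧ A i j ≠ 0 then (A i j : ℝ) * u j / u i + 1 else 0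
  have hg : ∀ i j, g i j + g j i ≤ 0 := by
    intro i j
    by_cases hc : i ≠ j ∧ A i j ≠ 0
    · have hc' : j ≠ i ∧ A j i ≠ 0 := ⟨hc.1.symm, fun h0 ↦ hc.2 (hA.zero_symm _ _ h0)⟩
      simp only [g, if_pos hc, if_pos hc']
      exact hA.neighbour_sum_nonpos hu hc.1 hc.2
    · have hc' : ¬ (j ≠ i ∧ A j i ≠ 0) := fun h ↦
        hc ⟨h.1.symm, fun h0 ↦ h.2 (hA.zero_symm _ _ h0)⟩
      simp only [g, if_neg hc, if_neg hc']
      simp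
  have hsum : ∑ i ∈ S, ∑ j ∈ S, g i j ≤ 0 := by
    have h1 : ∑ i ∈ S, ∑ j ∈ S, g i j = ∑ i ∈ S, ∑ j ∈ S, g j i := Finset.sum_comm
    have h2 : ∑ i ∈ S, ∑ j ∈ S, (g i j + g j i) ≤ 0 :=
      Finset.sum_nonpos fun i _ ↦ Finset.sum_nonpos fun j _ ↦ hg i j
    simp only [Finset.sum_add_distrib] at h2
    linarith
  have hpos : 0 < ∑ i ∈ S, ∑ j ∈ S, g i j := by
    refine Finset.sum_pos (fun i hi ↦ ?_) hS
    have hrow : ∑ j ∈ S, g i j = (∑ j ∈ S, (A i j : ℝ) * u j) / u i - 2 +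
        ((S.erase i).filter fun j ↦ A i j ≠ 0).card := by
      rw [← Finset.add_sum_erase _ _ hi, ← Finset.add_sum_erase S (fun j ↦ (A i j : ℝ) * u j) hi,
        hA.diag]
      have hself : g i i = 0 := by simp [g]
      have : ∑ j ∈ S.erase i, g i j = (∑ j ∈ S.erase i, (A i j : ℝ) * u j) / u i +
          ((S.erase i).filter fun j ↦ A i j ≠ 0).card := by
        rw [Finset.card_filter, Finset.sum_div]
        push_cast
        rw [← Finset.sum_add_distrib]
        refine Finset.sum_congr rfl fun j hj ↦ ?_
        have hij : i ≠ j := (Finset.ne_of_mem_erase hj).symm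
        by_cases h0 : A i j = 0
        · simp [g, h0]
        · simp [g, h0, hij]
      rw [this, hself]
      have := (hu i).ne'
      field_simp
      push_cast
      ring
    rw [hrow]
    have h1 : (2 : ℝ) ≤ ((S.erase i).filter fun j ↦ A i j ≠ 0).card := by
      exact_mod_cast hcon i hi
    have h2 := div_pos (h i hi) (hu i)
    linarith
  linarith

/-- Leaves are removed one at a time. Deleting a node keeps the rows positive, as it drops
nonpositive terms, and a leaf imposes a single condition on its own scaling factor. -/
lemma IsGCM.exists_symmetrizer_on [DecidableEq ι] {A : Matrix ι ι ℤ} (hA : IsGCM A) {u : ι → ℝ}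
    (hu : ∀ i, 0 < u i) (n : ℕ) : ∀ S : Finset ι, S.card = n →
    (∀ i ∈ S, 0 < ∑ j ∈ S, (A i j : ℝ) * u j) →
    ∃ d : ι → ℝ, (∀ i, 0 < d i) ∧ ∀ i ∈ S, ∀ j ∈ S, d i * A i j = d j * A j i := by
  induction n with
  | zero =>
    intro S hS _
    rw [Finset.card_eq_zero] at hS
    subst hS
    exact ⟨fun _ ↦ 1, fun _ ↦ one_pos, by simp⟩
  | succ n ih =>
    intro S hS h
    obtain ⟨i, hi, hleaf⟩ := hA.exists_leaf hu (Finset.card_pos.1 (by omega)) h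
    obtain ⟨d, hd, hsym⟩ := ih (S.erase i) (by rw [Finset.card_erase_of_mem hi]; omega)
      (fun j hj ↦ by
        have hj' := Finset.mem_erase.1 hj
        have h1 := h j hj'.2
        rw [← Finset.add_sum_erase _ _ hi] at h1
        have := mul_nonpos_of_nonpos_of_nonneg (hA.nonpos_real hj'.1) (hu i).le
        linarith)
    rcases Finset.eq_empty_or_nonempty ((S.erase i).filter fun j ↦ A i j ≠ 0) with he | ⟨j, hj⟩
    · refine ⟨d, hd, ?_⟩
      have h0 : ∀ x ∈ S, x ≠ i → A i x = 0 ∧ A x i = 0 := by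
        intro x hx hxi
        have h1 : A i x = 0 := by
          by_contra h1
          have : x ∈ (S.erase i).filter fun j ↦ A i j ≠ 0 := by simp [hx, hxi, h1]
          simp [he] at this
        exact ⟨h1, hA.zero_symm _ _ h1⟩
      intro x hx y hy
      by_cases hxi : x = i
      · by_cases hyi : y = i
        · rw [hxi, hyi]
        · rw [hxi, (h0 y hy hyi).1, (h0 y hy hyi).2]; simp
      · by_cases hyi : y = i
        · rw [hyi, (h0 x hx hxi).1, (h0 x hx hxi).2]; simp
        · exact hsym x (by simp [hx, hxi]) y (by simp [hy, hyi])
    · have hj' := Finset.mem_filter.1 hj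
      have hji : j ≠ i := Finset.ne_of_mem_erase hj'.1
      have hij0 : A i j ≠ 0 := hj'.2
      have hji0 : A j i ≠ 0 := fun h0 ↦ hij0 (hA.zero_symm _ _ h0)
      have h0 : ∀ x ∈ S, x ≠ i → x ≠ j → A i x = 0 ∧ A x i = 0 := by
        intro x hx hxi hxj
        have h1 : A i x = 0 := by
          by_contra h1
          exact hxj (Finset.card_le_one.1 hleaf x (by simp [hx, hxi, h1]) j hj)
        exact ⟨h1, hA.zero_symm _ _ h1⟩
      set c : ℝ := d j * A j i / A i j with hc
      have hij1 : (A i j : ℝ) < 0 :=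
        lt_of_le_of_ne (hA.nonpos_real hji.symm) (by exact_mod_cast hij0)
      have hji1 : (A j i : ℝ) < 0 :=
        lt_of_le_of_ne (hA.nonpos_real hji) (by exact_mod_cast hji0)
      have hcpos : 0 < c := div_pos_of_neg_of_neg (mul_neg_of_pos_of_neg (hd j) hji1) hij1
      have hcA : c * A i j = d j * A j i := div_mul_cancel₀ _ hij1.ne
      refine ⟨Function.update d i c, fun x ↦ ?_, ?_⟩
      · by_cases hxi : x = i
        · subst hxi; simpa using hcpos
        · simpa [hxi] using hd x
      have key : ∀ x ∈ S, x ≠ i → c * A i x = d x * A x i := by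
        intro x hx hxi
        by_cases hxj : x = j
        · rw [hxj, hcA]
        · rw [(h0 x hx hxi hxj).1, (h0 x hx hxi hxj).2]; simp
      intro x hx y hy
      by_cases hxi : x = i
      · by_cases hyi : y = i
        · rw [hxi, hyi]
        · simpa [hxi, hyi] using key y hy hyi
      · by_cases hyi : y = i
        · simpa [hxi, hyi] using (key x hx hxi).symm
        · simpa [hxi, hyi] using hsym x (by simp [hx, hxi]) y (by simp [hy, hyi])

variable [Fintype ι]

lemma IsGCM.exists_symmetrizer {A : Matrix ι ι ℤ} (hA : IsGCM A) {u : ι → ℝ}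
    (hu : ∀ i, 0 < u i) (h : ∀ i, 0 < realMulVec A u i) :
    ∃ d : ι → ℝ, (∀ i, 0 < d i) ∧ ∀ i j, d i * A i j = d j * A j i := by
  classical
  obtain ⟨d, hd, hs⟩ := hA.exists_symmetrizer_on hu _ Finset.univ rfl (fun i _ ↦ h i)
  exact ⟨d, hd, fun i j ↦ hs i (Finset.mem_univ i) j (Finset.mem_univ j)⟩

/-- The difference of the two sides is half the sum over pairs of `-(d i A i j) u i u j (x i / u i -
x j / u j) ^ 2`, which is nonnegative term by term. If `A u > 0`, the symmetrized form is therefore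
positive definite with an explicit diagonal lower bound. -/
lemma IsGCM.quadratic_lower_bound {A : Matrix ι ι ℤ} (hA : IsGCM A) {u d : ι → ℝ}
    (hu : ∀ i, 0 < u i) (hd : ∀ i, 0 < d i) (hs : ∀ i j, d i * A i j = d j * A j i)
    (x : ι → ℝ) :
    ∑ i, d i * realMulVec A u i / u i * x i ^ 2 ≤ ∑ i, d i * x i * realMulVec A x i := by
  let g : ι → ι → ℝ := fun i j ↦ d i * A i j * (x i * x j - u j * x i ^ 2 / u i)
  have hg : ∀ i j, 0 ≤ g i j + g j i := by
    intro i j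
    have h1 : g i j + g j i = -(d i * A i j) * (u i * u j * (x i / u i - x j / u j) ^ 2) := by
      simp only [g]
      rw [← hs i j]
      have := (hu i).ne'
      have := (hu j).ne'
      field_simp
      ring
    rw [h1]
    by_cases hij : i = j
    · subst hij; simp
    · have h2 := mul_nonpos_of_nonneg_of_nonpos (hd i).le (hA.nonpos_real hij)
      have := hu i
      have := hu j
      have h3 : 0 ≤ u i * u j * (x i / u i - x j / u j) ^ 2 := by positivity
      nlinarith
  have hsum : 0 ≤ ∑ i, ∑ j, g i j := by
    have h1 : ∑ i, ∑ j, g i j = ∑ i, ∑ j, g j i := Finset.sum_comm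
    have h2 : 0 ≤ ∑ i, ∑ j, (g i j + g j i) :=
      Finset.sum_nonneg fun i _ ↦ Finset.sum_nonneg fun j _ ↦ hg i j
    simp only [Finset.sum_add_distrib] at h2
    linarith
  rw [← sub_nonneg, ← Finset.sum_sub_distrib]
  refine hsum.trans_eq (Finset.sum_congr rfl fun i _ ↦ ?_)
  simp only [realMulVec_apply, g, Finset.mul_sum, Finset.sum_div, Finset.sum_mul]
  rw [← Finset.sum_sub_distrib]
  exact Finset.sum_congr rfl fun j _ ↦ by ring

end Symmetrizable

/-! ### Lie algebras with Chevalley generators: weights, words and the triangular decomposition -/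

section Chevalley

variable {k : Type*} [Field k] {ι 𝔥 : Type*} [AddCommGroup 𝔥] [Module k 𝔥]

/-- Generators of a Lie algebra `G` satisfying the relations of a Kac–Moody algebra other than the
Serre relations. -/
structure ChevalleySystem (root : ι → Dual k 𝔥) (coroot : ι → 𝔥) (G : Type*) [LieRing G]
    [LieAlgebra k G] where
  /-- the Cartan subalgebra -/
  h : 𝔥 →ₗ[k] G
  /-- the positive generators -/
  e : ι → G
  /-- the negative generators -/
  f : ι → G
  lie_h_h : ∀ x y, ⁅h x, h y⁆ = 0
  lie_h_e : ∀ x i, ⁅h x, e i⁆ = root i x • e i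
  lie_h_f : ∀ x i, ⁅h x, f i⁆ = -(root i x • f i)
  lie_e_f : ∀ i, ⁅e i, f i⁆ = h (coroot i)
  lie_e_f_ne : ∀ i j, i ≠ j → ⁅e i, f j⁆ = 0
  generates : LieSubalgebra.lieSpan k G (Set.range h ∪ Set.range e ∪ Set.range f) = ⊤

namespace ChevalleySystem

variable {root : ι → Dual k 𝔥} {coroot : ι → 𝔥} {G : Type*} [LieRing G] [LieAlgebra k G]
  (S : ChevalleySystem root coroot G)

/-- The Chevalley system with positive and negative generators exchanged. -/
@[simps] def swap : ChevalleySystem root coroot G where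
  h := -S.h
  e := S.f
  f := S.e
  lie_h_h x y := by simp [S.lie_h_h]
  lie_h_e x i := by simp [S.lie_h_f]
  lie_h_f x i := by simp [S.lie_h_e]
  lie_e_f i := by rw [← lie_skew, S.lie_e_f]; rfl
  lie_e_f_ne i j hij := by rw [← lie_skew, S.lie_e_f_ne j i hij.symm, neg_zero]
  generates := by
    rw [eq_top_iff, ← S.generates, LieSubalgebra.lieSpan_le]
    rintro x ((⟨y, rfl⟩ | ⟨i, rfl⟩) | ⟨i, rfl⟩)
    · exact LieSubalgebra.subset_lieSpan (Or.inl (Or.inl ⟨-y, by simp⟩))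
    · exact LieSubalgebra.subset_lieSpan (Or.inr ⟨i, rfl⟩)
    · exact LieSubalgebra.subset_lieSpan (Or.inl (Or.inr ⟨i, rfl⟩))

/-- A subspace stable under the generators is stable under the whole Lie algebra. -/
lemma lie_mem {M : Type*} [AddCommGroup M] [Module k M] [LieRingModule G M] [LieModule k G M]
    {N : Submodule k M} (hh : ∀ x, ∀ y ∈ N, ⁅S.h x, y⁆ ∈ N)
    (he : ∀ i, ∀ y ∈ N, ⁅S.e i, y⁆ ∈ N) (hf : ∀ i, ∀ y ∈ N, ⁅S.f i, y⁆ ∈ N) (x : G) :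
    ∀ y ∈ N, ⁅x, y⁆ ∈ N := by
  let K : LieSubalgebra k G :=
    { carrier := {x | ∀ y ∈ N, ⁅x, y⁆ ∈ N}
      add_mem' := fun {a b} ha hb y hy ↦ by rw [add_lie]; exact N.add_mem (ha y hy) (hb y hy)
      zero_mem' := fun y _ ↦ by simp
      smul_mem' := fun c a ha y hy ↦ by rw [smul_lie]; exact N.smul_mem c (ha y hy)
      lie_mem' := fun {a b} ha hb y hy ↦ by
        rw [lie_lie]
        exact N.sub_mem (ha _ (hb y hy)) (hb _ (ha y hy)) }
  have hK : K = ⊤ := by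
    rw [eq_top_iff, ← S.generates, LieSubalgebra.lieSpan_le]
    rintro x ((⟨y, rfl⟩ | ⟨i, rfl⟩) | ⟨i, rfl⟩)
    exacts [hh y, he i, hf i]
  have : x ∈ K := hK ▸ LieSubalgebra.mem_top x
  exact this

section Weights

variable (M : Type*) [AddCommGroup M] [Module k M] [LieRingModule G M] [LieModule k G M]

/-- Vectors of weight `φ`. -/
def wtSpace (φ : Dual k 𝔥) : Submodule k M where
  carrier := {m | ∀ x, ⁅S.h x, m⁆ = φ x • m}
  add_mem' ha hb x := by rw [lie_add, ha x, hb x, smul_add]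
  zero_mem' x := by simp
  smul_mem' c m hm x := by rw [lie_smul, hm x, smul_comm]

variable {M}

lemma mem_wtSpace {φ : Dual k 𝔥} {m : M} : m ∈ S.wtSpace M φ ↔ ∀ x, ⁅S.h x, m⁆ = φ x • m := Iff.rfl

lemma disjoint_wtSpace (s : Finset (Dual k 𝔥)) : ∀ φ ∉ s,
    Disjoint (S.wtSpace M φ) (s.sup (S.wtSpace M)) := by
  classical
  induction s using Finset.induction_on with
  | empty => simp
  | insert ψ s hψ ih =>
    intro φ hφ
    rw [Finset.mem_insert, not_or] at hφ
    rw [Finset.sup_insert, Submodule.disjoint_def]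
    intro m hm hm'
    obtain ⟨a, ha, b, hb, rfl⟩ := Submodule.mem_sup.1 hm'
    obtain ⟨x, hx⟩ : ∃ x, φ x ≠ ψ x := by
      by_contra! h
      exact hφ.1 (LinearMap.ext h)
    have hst : ∀ b ∈ s.sup (S.wtSpace M), ⁅S.h x, b⁆ ∈ s.sup (S.wtSpace M) := by
      intro b hb
      have hle : s.sup (S.wtSpace M) ≤
          (s.sup (S.wtSpace M)).comap (LieModule.toEnd k G M (S.h x)) := by
        refine Finset.sup_le fun χ hχ y hy ↦ ?_
        rw [Submodule.mem_comap, LieModule.toEnd_apply_apply, hy x]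
        exact Submodule.smul_mem _ _ (Finset.le_sup (f := S.wtSpace M) hχ hy)
      exact hle hb
    have h1 : (φ x - ψ x) • (a + b) = ⁅S.h x, b⁆ - ψ x • b := by
      have h2 := hm x
      rw [lie_add, ha x] at h2
      rw [sub_smul, ← h2, smul_add]
      abel
    have h3 : (φ x - ψ x) • (a + b) = 0 :=
      (Submodule.disjoint_def.1 (ih φ hφ.2)) _ (Submodule.smul_mem _ _ hm)
        (h1 ▸ Submodule.sub_mem _ (hst b hb) (Submodule.smul_mem _ _ hb))
    exact (smul_eq_zero.1 h3).resolve_left (sub_ne_zero.2 hx)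

lemma eq_zero_of_mem_iSup {φ : Dual k 𝔥} {m : M} (hm : m ∈ S.wtSpace M φ)
    (hm' : m ∈ ⨆ ψ : {ψ // ψ ≠ φ}, S.wtSpace M ψ.1) : m = 0 := by
  classical
  obtain ⟨s, hs⟩ := Submodule.exists_finset_of_mem_iSup _ hm'
  have hle : (⨆ ψ ∈ s, S.wtSpace M ψ.1) ≤ (s.image Subtype.val).sup (S.wtSpace M) :=
    iSup₂_le fun ψ hψ ↦ Finset.le_sup (f := S.wtSpace M) (Finset.mem_image_of_mem _ hψ)
  refine Submodule.disjoint_def.1 (S.disjoint_wtSpace (s.image Subtype.val) φ ?_) m hm (hle hs)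
  intro h
  obtain ⟨ψ, -, hψ⟩ := Finset.mem_image.1 h
  exact ψ.2 hψ

/-- A weight vector in the span of a family of weight vectors is in the span of those members
that have the same weight. -/
lemma mem_span_of_wt {J : Type*} (g : J → M) (w : J → Dual k 𝔥)
    (hg : ∀ j, g j ∈ S.wtSpace M (w j)) {φ : Dual k 𝔥} {m : M} (hm : m ∈ S.wtSpace M φ)
    (hspan : m ∈ Submodule.span k (Set.range g)) :
    m ∈ Submodule.span k (g '' {j | w j = φ}) := by
  have hsplit : Submodule.span k (Set.range g) ≤
      Submodule.span k (g '' {j | w j = φ}) ⊔ ⨆ ψ : {ψ // ψ ≠ φ}, S.wtSpace M ψ.1 := by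
    rw [Submodule.span_le]
    rintro _ ⟨j, rfl⟩
    by_cases hj : w j = φ
    · exact Submodule.mem_sup_left (Submodule.subset_span ⟨j, hj, rfl⟩)
    · exact Submodule.mem_sup_right (Submodule.mem_iSup_of_mem ⟨w j, hj⟩ (hg j))
  obtain ⟨a, ha, b, hb, rfl⟩ := Submodule.mem_sup.1 (hsplit hspan)
  have ha' : a ∈ S.wtSpace M φ := by
    refine (Submodule.span_le.2 ?_ : _ ≤ S.wtSpace M φ) ha
    rintro _ ⟨j, hj, rfl⟩
    have := hg j
    rwa [show w j = φ from hj] at this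
  have hb0 : b = 0 := by
    refine S.eq_zero_of_mem_iSup (φ := φ) ?_ hb
    have := Submodule.sub_mem _ hm ha'
    rwa [add_sub_cancel_left] at this
  rwa [hb0, add_zero]

/-- This is how weights are read off from a spanning family of weight vectors: a nonzero vector of
weight `φ` needs a nonzero member of the family with that same weight. -/
lemma exists_wt_eq {J : Type*} (g : J → M) (w : J → Dual k 𝔥)
    (hg : ∀ j, g j ∈ S.wtSpace M (w j)) {φ : Dual k 𝔥} {m : M} (hm : m ∈ S.wtSpace M φ)
    (hm0 : m ≠ 0) (hspan : m ∈ Submodule.span k (Set.range g)) : ∃ j, w j = φ ∧ g j ≠ 0 := by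
  by_contra! h
  have h1 := S.mem_span_of_wt g w hg hm hspan
  have h2 : Submodule.span k (g '' {j | w j = φ}) ≤ ⊥ := by
    rw [Submodule.span_le]
    rintro _ ⟨j, hj, rfl⟩
    simpa using h j hj
  exact hm0 (by simpa using h2 h1)

lemma lie_e_mem_wtSpace {φ : Dual k 𝔥} {m : M} (hm : m ∈ S.wtSpace M φ) (i : ι) :
    ⁅S.e i, m⁆ ∈ S.wtSpace M (root i + φ) := by
  intro x
  rw [leibniz_lie, S.lie_h_e, hm x, smul_lie, lie_smul, LinearMap.add_apply, add_smul]

lemma lie_f_mem_wtSpace {φ : Dual k 𝔥} {m : M} (hm : m ∈ S.wtSpace M φ) (i : ι) :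
    ⁅S.f i, m⁆ ∈ S.wtSpace M (-root i + φ) := by
  intro x
  rw [leibniz_lie, S.lie_h_f, hm x, neg_lie, smul_lie, lie_smul, LinearMap.add_apply, add_smul,
    LinearMap.neg_apply, neg_smul]

lemma mem_wtSpace_swap {φ : Dual k 𝔥} {m : M} :
    m ∈ S.swap.wtSpace M φ ↔ m ∈ S.wtSpace M (-φ) := by
  simp only [mem_wtSpace, swap_h, LinearMap.neg_apply, neg_lie, neg_smul]
  exact forall_congr' fun x ↦ by rw [neg_eq_iff_eq_neg]

end Weights

section Words

/-- Iterated brackets of positive generators with a vector. -/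
def act (v : G) : List ι → G
  | [] => v
  | i :: l => ⁅S.e i, act v l⁆

/-- The number of occurrences of each index in a list. -/
def cnt [DecidableEq ι] : List ι → ι → ℤ
  | [] => 0
  | i :: l => Pi.single i 1 + cnt l

/-- Iterated brackets of positive generators. -/
def word (j : ι) (l : List ι) : G := S.act (S.e j) l

variable [Fintype ι]

variable (root) in
/-- The functional `∑ c_i α_i`. -/
def wt (c : ι → ℤ) : Dual k 𝔥 := ∑ i, (c i : k) • root i

lemma wt_add (c d : ι → ℤ) : wt root (c + d) = wt root c + wt root d := by
  simp [wt, add_smul, Finset.sum_add_distrib]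

lemma wt_neg (c : ι → ℤ) : wt root (-c) = -wt root c := by
  ext x
  simp [wt, LinearMap.sum_apply]

lemma wt_zero : wt root (0 : ι → ℤ) = 0 := by simp [wt]

variable [DecidableEq ι]

lemma cnt_nonneg (l : List ι) (i : ι) : 0 ≤ cnt l i := by
  induction l with
  | nil => simp [cnt]
  | cons j l ih =>
    simp only [cnt, Pi.add_apply, Pi.single_apply]
    split_ifs <;> omega

lemma sum_cnt (l : List ι) : ∑ i, cnt l i = l.length := by
  induction l with
  | nil => simp [cnt]
  | cons j l ih => simp [cnt, Finset.sum_add_distrib, ih]; ring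

lemma eq_of_cnt_eq_zero {i : ι} {l : List ι} (h : ∀ j, j ≠ i → cnt l j = 0) :
    ∀ j ∈ l, j = i := by
  induction l with
  | nil => simp
  | cons m l ih =>
    have hm : m = i := by
      by_contra hm
      have h1 := h m hm
      have h2 := cnt_nonneg l m
      simp [cnt] at h1
      omega
    intro j hj
    rcases List.mem_cons.1 hj with rfl | hj
    · exact hm
    · refine ih (fun j hji ↦ ?_) j hj
      have h1 := h j hji
      simpa [cnt, Pi.single_apply, hm, hji] using h1

lemma wt_single (root : ι → Dual k 𝔥) (i : ι) : wt root (Pi.single i 1) = root i := by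
  rw [wt, Finset.sum_eq_single i]
  · rw [Pi.single_eq_same, Int.cast_one, one_smul]
  · intro j _ hj; rw [Pi.single_eq_of_ne hj, Int.cast_zero, zero_smul]
  · intro h; exact absurd (Finset.mem_univ i) h

/-- It allows weights to be handled as integral coefficient vectors, for which signs and heights
make sense, although they live in the dual over `k`. -/
lemma wt_injective [CharZero k] (hroot : LinearIndependent k root) :
    Function.Injective (wt root : (ι → ℤ) → Dual k 𝔥) := by
  intro c d h
  have h1 : ∑ i, ((c i : k) - d i) • root i = 0 := by
    ext x
    have h2 := LinearMap.congr_fun h x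
    simp only [wt, LinearMap.sum_apply, LinearMap.smul_apply, smul_eq_mul] at h2
    simp [LinearMap.sum_apply, sub_mul, Finset.sum_sub_distrib, h2]
  ext i
  have := Fintype.linearIndependent_iff.1 hroot _ h1 i
  exact_mod_cast sub_eq_zero.1 this

lemma act_mem_wtSpace {v : G} {c : ι → ℤ} (hv : v ∈ S.wtSpace G (wt root c)) (l : List ι) :
    S.act v l ∈ S.wtSpace G (wt root (cnt l + c)) := by
  induction l with
  | nil => simpa [act, cnt] using hv
  | cons i l ih =>
    have := S.lie_e_mem_wtSpace ih i
    rwa [← wt_single root, ← wt_add, ← add_assoc] at this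

lemma e_mem_wtSpace (j : ι) : S.e j ∈ S.wtSpace G (wt root (Pi.single j 1)) := fun x ↦ by
  rw [wt_single, S.lie_h_e]

lemma word_mem_wtSpace (j : ι) (l : List ι) :
    S.word j l ∈ S.wtSpace G (wt root (cnt (j :: l))) := by
  have := S.act_mem_wtSpace (S.e_mem_wtSpace j) l
  rwa [add_comm] at this

lemma h_mem_wtSpace (x : 𝔥) : S.h x ∈ S.wtSpace G 0 := fun y ↦ by
  simp [S.lie_h_h]

lemma word_eq_zero {i : ι} {l : List ι} (hl : ∀ j ∈ l, j = i) (h0 : l ≠ []) :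
    S.word i l = 0 := by
  induction l with
  | nil => exact absurd rfl h0
  | cons j l ih =>
    obtain rfl : j = i := hl j (by simp)
    rcases eq_or_ne l [] with rfl | hl0
    · simp [word, act]
    · have := ih (fun m hm ↦ hl m (by simp [hm])) hl0
      simp only [word] at this
      simp [word, act, this]

/-- The span of all iterated brackets of positive generators. -/
def posPart : Submodule k G := Submodule.span k (Set.range fun p : ι × List ι ↦ S.word p.1 p.2)

lemma word_mem (j : ι) (l : List ι) : S.word j l ∈ S.posPart := Submodule.subset_span ⟨(j, l), rfl⟩

lemma lie_e_posPart (i : ι) {y : G} (hy : y ∈ S.posPart) : ⁅S.e i, y⁆ ∈ S.posPart := by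
  refine (Submodule.span_le.2 ?_ : S.posPart ≤ S.posPart.comap (LieModule.toEnd k G G (S.e i))) hy
  rintro _ ⟨⟨j, l⟩, rfl⟩
  exact S.word_mem j (i :: l)

lemma lie_h_posPart (x : 𝔥) {y : G} (hy : y ∈ S.posPart) : ⁅S.h x, y⁆ ∈ S.posPart := by
  refine (Submodule.span_le.2 ?_ : S.posPart ≤ S.posPart.comap (LieModule.toEnd k G G (S.h x))) hy
  rintro _ ⟨⟨j, l⟩, rfl⟩
  simp only [SetLike.mem_coe, Submodule.mem_comap, LieModule.toEnd_apply_apply]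
  rw [S.word_mem_wtSpace j l x]
  exact Submodule.smul_mem _ _ (S.word_mem j l)

lemma lie_f_posPart (i : ι) {y : G} (hy : y ∈ S.posPart) :
    ⁅S.f i, y⁆ ∈ LinearMap.range S.h ⊔ S.posPart := by
  refine (Submodule.span_le.2 ?_ : S.posPart ≤
    (LinearMap.range S.h ⊔ S.posPart).comap (LieModule.toEnd k G G (S.f i))) hy
  rintro _ ⟨⟨j, l⟩, rfl⟩
  simp only [SetLike.mem_coe, Submodule.mem_comap, LieModule.toEnd_apply_apply]
  induction l with
  | nil =>
    refine Submodule.mem_sup_left ?_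
    simp only [word, act]
    rw [← lie_skew]
    by_cases hij : j = i
    · subst hij
      rw [S.lie_e_f]
      exact ⟨-coroot j, by simp⟩
    · rw [S.lie_e_f_ne j i hij]; simp
  | cons m l ih =>
    have h1 : S.word j (m :: l) = ⁅S.e m, S.word j l⁆ := rfl
    rw [h1, leibniz_lie]
    refine Submodule.mem_sup_right (Submodule.add_mem _ ?_ ?_)
    · rw [← lie_skew (S.f i) (S.e m)]
      by_cases hij : m = i
      · subst hij
        rw [S.lie_e_f, neg_lie]
        exact Submodule.neg_mem _ (S.lie_h_posPart _ (S.word_mem j l))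
      · rw [S.lie_e_f_ne m i hij]; simp
    · obtain ⟨_, ⟨x, rfl⟩, b, hb, hab⟩ := Submodule.mem_sup.1 ih
      rw [← hab, lie_add]
      refine Submodule.add_mem _ ?_ (S.lie_e_posPart m hb)
      rw [← lie_skew, S.lie_h_e]
      exact Submodule.neg_mem _ (Submodule.smul_mem _ _ (S.word_mem m []))

lemma range_swap_h : LinearMap.range S.swap.h = LinearMap.range S.h := by
  rw [swap_h, LinearMap.range_neg]

/-- The sum is stable under all the generators, since a negative generator takes the positive part
into `𝔥` plus the positive part, and symmetrically. It is thus a subalgebra containing the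
generators. -/
lemma triangular_eq_top :
    LinearMap.range S.h ⊔ S.posPart ⊔ S.swap.posPart = ⊤ := by
  set N := LinearMap.range S.h ⊔ S.posPart ⊔ S.swap.posPart with hN
  have hr : LinearMap.range S.h ≤ N := le_sup_left.trans le_sup_left
  have hp : S.posPart ≤ N := le_sup_right.trans le_sup_left
  have hm : S.swap.posPart ≤ N := le_sup_right
  have hgen : Set.range S.h ∪ Set.range S.e ∪ Set.range S.f ⊆ N := by
    rintro x ((⟨y, rfl⟩ | ⟨i, rfl⟩) | ⟨i, rfl⟩)
    · exact hr ⟨y, rfl⟩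
    · exact hp (S.word_mem i [])
    · exact hm (S.swap.word_mem i [])
  have split : ∀ (z : G), (∀ x, ⁅z, S.h x⁆ ∈ N) → (∀ y ∈ S.posPart, ⁅z, y⁆ ∈ N) →
      (∀ y ∈ S.swap.posPart, ⁅z, y⁆ ∈ N) → ∀ y ∈ N, ⁅z, y⁆ ∈ N := by
    intro z h1 h2 h3 y hy
    obtain ⟨a, ha, c, hc, rfl⟩ := Submodule.mem_sup.1 hy
    obtain ⟨_, ⟨x, rfl⟩, b, hb, rfl⟩ := Submodule.mem_sup.1 ha
    rw [lie_add, lie_add]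
    exact N.add_mem (N.add_mem (h1 x) (h2 b hb)) (h3 c hc)
  have hstab := S.lie_mem (M := G) (N := N)
    (fun x ↦ split _ (fun y ↦ by rw [S.lie_h_h]; exact N.zero_mem)
      (fun y hy ↦ hp (S.lie_h_posPart x hy))
      (fun y hy ↦ by
        have := S.swap.lie_h_posPart (-x) hy
        simp only [swap_h, LinearMap.neg_apply, map_neg, neg_neg] at this
        exact hm this))
    (fun i ↦ split _ (fun x ↦ by
        rw [← lie_skew, S.lie_h_e]
        exact N.neg_mem (N.smul_mem _ (hp (S.word_mem i []))))
      (fun y hy ↦ hp (S.lie_e_posPart i hy))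
      (fun y hy ↦ by
        have := S.swap.lie_f_posPart i hy
        rw [range_swap_h] at this
        exact (sup_le hr hm) this))
    (fun i ↦ split _ (fun x ↦ by
        rw [← lie_skew, S.lie_h_f]
        exact N.neg_mem (N.neg_mem (N.smul_mem _ (hm (S.swap.word_mem i [])))))
      (fun y hy ↦ (sup_le hr hp) (S.lie_f_posPart i hy))
      (fun y hy ↦ hm (S.swap.lie_e_posPart i hy)))
  let K : LieSubalgebra k G := { N with lie_mem' := fun {a b} _ hb ↦ hstab a b hb }
  have hK : K = ⊤ := by
    rw [eq_top_iff, ← S.generates, LieSubalgebra.lieSpan_le]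
    exact hgen
  rw [eq_top_iff]
  intro x _
  have : x ∈ K := hK ▸ LieSubalgebra.mem_top x
  exact this

/-- The spanning family: `𝔥` and the iterated brackets of positive or negative generators. -/
def spanFamily : 𝔥 ⊕ (ι × List ι) ⊕ (ι × List ι) → G
  | .inl x => S.h x
  | .inr (.inl p) => S.word p.1 p.2
  | .inr (.inr p) => S.swap.word p.1 p.2

/-- The weights of the spanning family. -/
def spanWt : 𝔥 ⊕ (ι × List ι) ⊕ (ι × List ι) → (ι → ℤ)
  | .inl _ => 0
  | .inr (.inl p) => cnt (p.1 :: p.2)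
  | .inr (.inr p) => -cnt (p.1 :: p.2)

lemma spanFamily_mem_wtSpace (s : 𝔥 ⊕ (ι × List ι) ⊕ (ι × List ι)) :
    S.spanFamily s ∈ S.wtSpace G (wt root (spanWt s)) := by
  rcases s with x | p | p
  · rw [spanWt, wt_zero]; exact S.h_mem_wtSpace x
  · exact S.word_mem_wtSpace p.1 p.2
  · rw [spanWt, wt_neg, ← mem_wtSpace_swap]
    exact S.swap.word_mem_wtSpace p.1 p.2

lemma span_spanFamily : Submodule.span k (Set.range S.spanFamily) = ⊤ := by
  rw [eq_top_iff, ← S.triangular_eq_top]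
  refine sup_le (sup_le ?_ ?_) ?_
  · rintro _ ⟨x, rfl⟩
    exact Submodule.subset_span ⟨.inl x, rfl⟩
  · refine Submodule.span_mono ?_
    rintro _ ⟨p, rfl⟩
    exact ⟨.inr (.inl p), rfl⟩
  · refine Submodule.span_mono ?_
    rintro _ ⟨p, rfl⟩
    exact ⟨.inr (.inr p), rfl⟩

lemma cnt_cons_ne_zero (j : ι) (l : List ι) : cnt (j :: l) ≠ 0 := by
  intro h
  have h1 := sum_cnt (j :: l)
  rw [h] at h1
  simp at h1
  omega

variable [CharZero k]

/-- A weight of the Lie algebra is a nonnegative or a nonpositive combination of simple roots. -/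
lemma exists_spanWt_eq (hroot : LinearIndependent k root) {c : ι → ℤ} {v : G} (hv0 : v ≠ 0)
    (hv : v ∈ S.wtSpace G (wt root c)) : ∃ s, spanWt s = c ∧ S.spanFamily s ≠ 0 := by
  obtain ⟨s, hs, h0⟩ := S.exists_wt_eq S.spanFamily (fun s ↦ wt root (spanWt s))
      S.spanFamily_mem_wtSpace hv hv0 (by rw [S.span_spanFamily]; trivial)
  exact ⟨s, wt_injective hroot hs, h0⟩

end Words

/-- No nonzero ideal meets the Cartan subalgebra trivially. -/
def NoIdeal : Prop := ∀ I : LieIdeal k G, (∀ x, S.h x ∈ I → S.h x = 0) → I = ⊥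

variable {S} in
lemma NoIdeal.swap (hS : S.NoIdeal) : S.swap.NoIdeal := fun I hI ↦ hS I fun x hx ↦ by
  have := hI x (by simpa using hx)
  simpa using this

variable [Fintype ι] [DecidableEq ι] [CharZero k]

variable {S} in
/-- A vector of positive weight killed by all negative generators is zero. -/
lemma NoIdeal.eq_zero_of_lie_f (hS : S.NoIdeal) (hroot : LinearIndependent k root)
    {c : ι → ℤ} (hc : ∀ i, 0 ≤ c i) (hc0 : c ≠ 0) {v : G} (hv : v ∈ S.wtSpace G (wt root c))
    (hf : ∀ i, ⁅S.f i, v⁆ = 0) : v = 0 := by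
  -- As `v` is killed by every `f i`, applying only the `e i` to `v` already gives an ideal. All its
  -- weights have the form `cnt l + c`, never zero, so it meets `𝔥` trivially.
  set N : Submodule k G := Submodule.span k (Set.range (S.act v)) with hN
  have hact : ∀ l, S.act v l ∈ N := fun l ↦ Submodule.subset_span ⟨l, rfl⟩
  have lift : ∀ z : G, (∀ l, ⁅z, S.act v l⁆ ∈ N) → ∀ y ∈ N, ⁅z, y⁆ ∈ N := by
    intro z hz y hy
    refine (Submodule.span_le.2 ?_ : N ≤ N.comap (LieModule.toEnd k G G z)) hy
    rintro _ ⟨l, rfl⟩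
    exact hz l
  have hh : ∀ x, ∀ y ∈ N, ⁅S.h x, y⁆ ∈ N := fun x ↦ lift _ fun l ↦ by
    rw [S.act_mem_wtSpace hv l x]
    exact N.smul_mem _ (hact l)
  have he : ∀ i, ∀ y ∈ N, ⁅S.e i, y⁆ ∈ N := fun i ↦ lift _ fun l ↦ hact (i :: l)
  have hff : ∀ i, ∀ y ∈ N, ⁅S.f i, y⁆ ∈ N := fun i ↦ lift _ fun l ↦ by
    induction l with
    | nil => simp [act, hf]
    | cons m l ih =>
      have h1 : S.act v (m :: l) = ⁅S.e m, S.act v l⁆ := rfl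
      rw [h1, leibniz_lie]
      refine N.add_mem ?_ (he m _ ih)
      rw [← lie_skew (S.f i) (S.e m), neg_lie]
      refine N.neg_mem ?_
      by_cases hij : m = i
      · subst hij
        rw [S.lie_e_f]
        exact hh _ _ (hact l)
      · rw [S.lie_e_f_ne m i hij]; simp
  let I : LieIdeal k G := { N with lie_mem := fun {x y} hy ↦ S.lie_mem hh he hff x y hy }
  have hI : I = ⊥ := hS I fun x hx ↦ by
    by_contra h0
    obtain ⟨l, hl, -⟩ := S.exists_wt_eq (S.act v) (fun l ↦ wt root (cnt l + c))
      (fun l ↦ S.act_mem_wtSpace hv l) (S.h_mem_wtSpace x) h0 hx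
    have hl := wt_injective hroot (hl.trans wt_zero.symm)
    refine hc0 (funext fun i ↦ ?_)
    have h1 := congrFun hl i
    have h2 := cnt_nonneg l i
    have h3 := hc i
    simp at h1 ⊢
    omega
  have hvI : v ∈ I := hact []
  rw [hI] at hvI
  simpa using hvI

end ChevalleySystem

end Chevalley

/-! ### The Cartan subalgebra embeds, and no nonzero ideal avoids it -/

section KacMoodySystem

variable {k : Type*} [Field k] {ι 𝔥 : Type*} [AddCommGroup 𝔥] [Module k 𝔥]

namespace ChevalleySystem

variable {root : ι → Dual k 𝔥} {coroot : ι → 𝔥} {G : Type*} [LieRing G] [LieAlgebra k G]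
  (S : ChevalleySystem root coroot G)

/-- The image of a Chevalley system under a surjective homomorphism. -/
@[simps] def map {G' : Type*} [LieRing G'] [LieAlgebra k G'] (φ : G →ₗ⁅k⁆ G')
    (hφ : Function.Surjective φ) : ChevalleySystem root coroot G' where
  h := φ.toLinearMap ∘ₗ S.h
  e i := φ (S.e i)
  f i := φ (S.f i)
  lie_h_h x y := by
    change ⁅φ (S.h x), φ (S.h y)⁆ = 0
    rw [← LieHom.map_lie, S.lie_h_h, map_zero]
  lie_h_e x i := by
    change ⁅φ (S.h x), φ (S.e i)⁆ = _
    rw [← LieHom.map_lie, S.lie_h_e, map_smul]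
  lie_h_f x i := by
    change ⁅φ (S.h x), φ (S.f i)⁆ = _
    rw [← LieHom.map_lie, S.lie_h_f, map_neg, map_smul]
  lie_e_f i := by rw [← LieHom.map_lie, S.lie_e_f]; rfl
  lie_e_f_ne i j hij := by rw [← LieHom.map_lie, S.lie_e_f_ne i j hij, map_zero]
  generates := by
    set K := LieSubalgebra.lieSpan k G' _
    have h1 : LieSubalgebra.lieSpan k G (Set.range S.h ∪ Set.range S.e ∪ Set.range S.f) ≤
        K.comap φ := by
      rw [LieSubalgebra.lieSpan_le]
      rintro x ((⟨y, rfl⟩ | ⟨i, rfl⟩) | ⟨i, rfl⟩)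
      · exact LieSubalgebra.subset_lieSpan (Or.inl (Or.inl ⟨y, rfl⟩))
      · exact LieSubalgebra.subset_lieSpan (Or.inl (Or.inr ⟨i, rfl⟩))
      · exact LieSubalgebra.subset_lieSpan (Or.inr ⟨i, rfl⟩)
    rw [S.generates] at h1
    rw [eq_top_iff]
    intro y _
    obtain ⟨x, rfl⟩ := hφ y
    exact h1 (LieSubalgebra.mem_top x)

variable [Fintype ι] [DecidableEq ι] [CharZero k]

/-- An ideal meeting the Cartan subalgebra trivially is contained in the sum of the positive and
the negative part. -/
lemma le_of_inf_eq_zero (hroot : LinearIndependent k root) {I : LieIdeal k G}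
    (hI : ∀ x, S.h x ∈ I → S.h x = 0) : I.toSubmodule ≤ S.posPart ⊔ S.swap.posPart := by
  intro v hv
  have hv' : v ∈ LinearMap.range S.h ⊔ S.posPart ⊔ S.swap.posPart := by
    rw [S.triangular_eq_top]; trivial
  rw [sup_assoc] at hv'
  obtain ⟨_, ⟨x, rfl⟩, w, hw, rfl⟩ := Submodule.mem_sup.1 hv'
  let π : G →ₗ⁅k,G⁆ G ⧸ I := LieSubmodule.Quotient.mk' I
  have hπ : ∀ {φ : Dual k 𝔥} {y : G}, y ∈ S.wtSpace G φ → π y ∈ S.wtSpace (G ⧸ I) φ := by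
    intro φ y hy z
    rw [← LieModuleHom.map_lie, hy z, map_smul]
  have hle : S.posPart ⊔ S.swap.posPart ≤
      (⨆ ψ : {ψ : Dual k 𝔥 // ψ ≠ 0}, S.wtSpace (G ⧸ I) ψ.1).comap (π : G →ₗ[k] G ⧸ I) := by
    have hne : ∀ (j : ι) (l : List ι), wt root (cnt (j :: l)) ≠ 0 := fun j l h0 ↦
      cnt_cons_ne_zero j l (wt_injective hroot (h0.trans wt_zero.symm))
    refine sup_le ?_ ?_ <;> refine Submodule.span_le.2 ?_ <;> rintro _ ⟨⟨j, l⟩, rfl⟩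
    · exact Submodule.mem_iSup_of_mem ⟨_, hne j l⟩ (hπ (S.word_mem_wtSpace j l))
    · exact Submodule.mem_iSup_of_mem ⟨_, neg_ne_zero.2 (hne j l)⟩
        (hπ (S.mem_wtSpace_swap.1 (S.swap.word_mem_wtSpace j l)))
  -- In the quotient by `I` the weight zero vector `π (S.h x)` equals a sum of vectors of nonzero
  -- weights, so it vanishes. This avoids decomposing the ideal itself into weight spaces.
  have h0 : π (S.h x) = -π w := by
    rw [eq_neg_iff_add_eq_zero, ← map_add]
    exact (LieSubmodule.Quotient.mk_eq_zero I).2 hv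
  have h1 : π (S.h x) = 0 := S.eq_zero_of_mem_iSup (hπ (S.h_mem_wtSpace x))
    (h0 ▸ Submodule.neg_mem _ (hle hw))
  rw [hI x ((LieSubmodule.Quotient.mk_eq_zero I).1 h1), zero_add]
  exact hw

lemma h_eq_zero_of_mem (hroot : LinearIndependent k root) {x : 𝔥}
    (hx : S.h x ∈ S.posPart ⊔ S.swap.posPart) : S.h x = 0 := by
  refine S.eq_zero_of_mem_iSup (S.h_mem_wtSpace x) ?_
  have hne : ∀ (j : ι) (l : List ι), wt root (cnt (j :: l)) ≠ 0 := fun j l h0 ↦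
    cnt_cons_ne_zero j l (wt_injective hroot (h0.trans wt_zero.symm))
  refine (sup_le ?_ ?_ : S.posPart ⊔ S.swap.posPart ≤ _) hx <;> refine Submodule.span_le.2 ?_ <;>
    rintro _ ⟨⟨j, l⟩, rfl⟩
  · exact Submodule.mem_iSup_of_mem ⟨_, hne j l⟩ (S.word_mem_wtSpace j l)
  · exact Submodule.mem_iSup_of_mem ⟨_, neg_ne_zero.2 (hne j l)⟩
      (S.mem_wtSpace_swap.1 (S.swap.word_mem_wtSpace j l))

end ChevalleySystem

/-! ### A highest weight representation of the auxiliary Lie algebra -/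

section Verma

attribute [local instance] LieRing.ofAssociativeRing

variable (root : ι → Dual k 𝔥) (coroot : ι → 𝔥) (lam : Dual k 𝔥)

/-- The weight of the monomial with the given factors in the module with highest weight `lam`. -/
def vermaWt : List ι → Dual k 𝔥
  | [] => lam
  | i :: l => vermaWt l - root i

/-- The action of the Cartan subalgebra on the free module on words. -/
def vermaH (x : 𝔥) : Module.End k (List ι →₀ k) :=
  Finsupp.linearCombination k fun l ↦ Finsupp.single l (vermaWt root lam l x)

/-- The action of the negative generators on the free module on words. -/
def vermaF (i : ι) : Module.End k (List ι →₀ k) :=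
  Finsupp.linearCombination k fun l ↦ Finsupp.single (i :: l) 1

open Classical in
/-- The action of a positive generator on a word. -/
def vermaEWord (i : ι) : List ι → (List ι →₀ k)
  | [] => 0
  | j :: l => Finsupp.single l (if i = j then vermaWt root lam l (coroot i) else 0) +
      vermaF j (vermaEWord i l)

/-- The action of the positive generators on the free module on words. -/
def vermaE (i : ι) : Module.End k (List ι →₀ k) :=
  Finsupp.linearCombination k (vermaEWord root coroot lam i)

lemma vermaH_single (x : 𝔥) (l : List ι) :
    vermaH root lam x (Finsupp.single l 1) = vermaWt root lam l x • Finsupp.single l 1 := by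
  simp [vermaH]

lemma vermaF_single (i : ι) (l : List ι) :
    vermaF (k := k) i (Finsupp.single l 1) = Finsupp.single (i :: l) 1 := by
  simp [vermaF]

lemma vermaE_single (i : ι) (l : List ι) :
    vermaE root coroot lam i (Finsupp.single l 1) = vermaEWord root coroot lam i l := by
  simp [vermaE]

lemma end_ext_single {φ ψ : Module.End k (List ι →₀ k)}
    (h : ∀ l, φ (Finsupp.single l 1) = ψ (Finsupp.single l 1)) : φ = ψ :=
  Finsupp.lhom_ext' fun l ↦ LinearMap.ext_ring (h l)

lemma vermaH_vermaF (x : 𝔥) (i : ι) (v : List ι →₀ k) :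
    vermaH root lam x (vermaF i v) =
      vermaF i (vermaH root lam x v) - root i x • vermaF i v := by
  have : vermaH root lam x * vermaF i =
      vermaF i * vermaH root lam x - root i x • vermaF i := by
    refine end_ext_single fun l ↦ ?_
    simp only [Module.End.mul_apply, LinearMap.sub_apply, LinearMap.smul_apply, vermaH_single,
      vermaF_single, map_smul, vermaWt, sub_smul]
  exact LinearMap.congr_fun this v

lemma vermaH_vermaEWord (x : 𝔥) (i : ι) (l : List ι) :
    vermaH root lam x (vermaEWord root coroot lam i l) =
      (vermaWt root lam l x + root i x) • vermaEWord root coroot lam i l := by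
  induction l with
  | nil => simp [vermaEWord]
  | cons j l ih =>
    simp only [vermaEWord, map_add, smul_add]
    congr 1
    · split_ifs with hij
      · subst hij
        rw [← mul_one (vermaWt root lam l (coroot i)), ← smul_eq_mul, ← Finsupp.smul_single,
          map_smul, vermaH_single]
        simp only [vermaWt, LinearMap.sub_apply, sub_add_cancel]
        rw [smul_comm]
      · simp
    · rw [vermaH_vermaF, ih, map_smul, ← sub_smul]
      congr 1
      simp only [vermaWt, LinearMap.sub_apply]
      ring

lemma vermaE_vermaF (i j : ι) (l : List ι) :
    vermaE root coroot lam i (vermaF j (Finsupp.single l 1)) =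
      (open Classical in if i = j then vermaWt root lam l (coroot i) else 0) •
        Finsupp.single l 1 + vermaF j (vermaE root coroot lam i (Finsupp.single l 1)) := by
  rw [vermaF_single, vermaE_single, vermaE_single, vermaEWord, Finsupp.smul_single, smul_eq_mul,
    mul_one]

/-- The highest weight representation of the free Lie algebra. -/
def vermaRep : FreeLieAlgebra k (Gen ι 𝔥) →ₗ⁅k⁆ Module.End k (List ι →₀ k) :=
  FreeLieAlgebra.lift k fun
    | .e i => vermaE root coroot lam i
    | .f i => vermaF i
    | .h x => vermaH root lam x

end Verma

namespace Realization

variable [Fintype ι] {A : Matrix ι ι k} (R : Realization A 𝔥)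

section Verma

attribute [local instance] LieRing.ofAssociativeRing

/-- The negative generators act freely on words, and `vermaEWord` is defined by commuting `e i` past
the first letter, so the relations between `e` and `f` hold by construction. The remaining ones only
express the weights of words. -/
lemma vermaRep_eq_zero (lam : Dual k 𝔥) {x : FreeLieAlgebra k (Gen ι 𝔥)} (hx : x ∈ R.relIdeal) :
    vermaRep R.root R.coroot lam x = 0 := by
  have hle : R.relIdeal ≤ (vermaRep R.root R.coroot lam).ker := by
    refine LieSubmodule.lieSpan_le.2 ?_
    intro y hy
    rw [SetLike.mem_coe, LieHom.mem_ker]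
    have hE : ∀ i, vermaRep R.root R.coroot lam (genE k ι 𝔥 i) = vermaE R.root R.coroot lam i :=
      fun i ↦ FreeLieAlgebra.lift_of_apply _ _
    have hF : ∀ i, vermaRep R.root R.coroot lam (genF k ι 𝔥 i) = vermaF i :=
      fun i ↦ FreeLieAlgebra.lift_of_apply _ _
    have hH : ∀ i, vermaRep R.root R.coroot lam (genH k ι 𝔥 i) = vermaH R.root lam i :=
      fun i ↦ FreeLieAlgebra.lift_of_apply _ _
    cases hy with
    | add x y =>
      rw [map_sub, map_sub, hH, hH, hH]
      refine end_ext_single fun l ↦ ?_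
      simp only [LinearMap.sub_apply, vermaH_single, map_add, add_smul, LinearMap.zero_apply]
      abel
    | smul c x =>
      rw [map_sub, map_smul, hH, hH]
      refine end_ext_single fun l ↦ ?_
      simp only [LinearMap.sub_apply, LinearMap.smul_apply, vermaH_single, map_smul, smul_assoc,
        LinearMap.zero_apply, sub_self]
    | ef_eq i =>
      rw [map_sub, LieHom.map_lie, hE, hF, hH]
      refine end_ext_single fun l ↦ ?_
      simp only [LieRing.of_associative_ring_bracket, LinearMap.sub_apply, Module.End.mul_apply,
        LinearMap.zero_apply, vermaE_vermaF, if_true, vermaH_single]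
      abel
    | ef_ne i j hij =>
      rw [LieHom.map_lie, hE, hF]
      refine end_ext_single fun l ↦ ?_
      simp only [LieRing.of_associative_ring_bracket, LinearMap.sub_apply, Module.End.mul_apply,
        LinearMap.zero_apply, vermaE_vermaF, if_neg hij]
      simp
    | hh x y =>
      rw [LieHom.map_lie, hH, hH]
      refine end_ext_single fun l ↦ ?_
      simp only [LieRing.of_associative_ring_bracket, LinearMap.sub_apply, Module.End.mul_apply,
        LinearMap.zero_apply, vermaH_single, map_smul]
      rw [smul_comm, sub_self]
    | he x i =>
      rw [map_sub, map_smul, LieHom.map_lie, hE, hH]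
      refine end_ext_single fun l ↦ ?_
      simp only [LieRing.of_associative_ring_bracket, LinearMap.sub_apply, Module.End.mul_apply,
        LinearMap.zero_apply, LinearMap.smul_apply, vermaH_single, map_smul, vermaE_single,
        vermaH_vermaEWord, add_smul]
      abel
    | hf x i =>
      rw [map_add, map_smul, LieHom.map_lie, hF, hH]
      refine end_ext_single fun l ↦ ?_
      simp only [LieRing.of_associative_ring_bracket, LinearMap.sub_apply, Module.End.mul_apply,
        LinearMap.zero_apply, LinearMap.smul_apply, LinearMap.add_apply, vermaH_vermaF]
      abel
  exact LieHom.mem_ker.1 (hle hx)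

/-- The element `x` acts on the empty word by `lam x`, and the highest weight `lam` is arbitrary, so
it can be chosen not to vanish on `x`. -/
lemma eq_zero_of_torus_eq_zero {x : 𝔥} (hx : R.torus x = 0) : x = 0 := by
  have hx : genH k ι 𝔥 x ∈ R.relIdeal := LieSubmodule.Quotient.mk_eq_zero'.1 hx
  by_contra h0
  obtain ⟨lam, hlam⟩ : ∃ lam : Dual k 𝔥, lam x ≠ 0 := by
    by_contra! h
    exact h0 ((Module.forall_dual_apply_eq_zero_iff k x).1 h)
  have h1 := R.vermaRep_eq_zero lam hx
  have h2 : vermaRep R.root R.coroot lam (genH k ι 𝔥 x) = vermaH R.root lam x :=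
    FreeLieAlgebra.lift_of_apply _ _
  rw [h2] at h1
  have h3 := vermaH_single R.root lam x []
  rw [h1] at h3
  have h4 := DFunLike.congr_fun h3 []
  simp only [LinearMap.zero_apply, Finsupp.zero_apply, Finsupp.smul_apply, Finsupp.single_eq_same,
    smul_eq_mul, mul_one, vermaWt] at h4
  exact hlam h4.symm

end Verma

/-- The projection of a Lie algebra onto the quotient by an ideal. -/
def _root_.LieIdeal.mkHom {G : Type*} [LieRing G] [LieAlgebra k G] (I : LieIdeal k G) :
    G →ₗ⁅k⁆ G ⧸ I :=
  { (LieSubmodule.Quotient.mk' I : G →ₗ[k] G ⧸ I) with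
    map_lie' := fun {x y} ↦ LieSubmodule.Quotient.mk_bracket I x y }

lemma _root_.LieIdeal.mkHom_surjective {G : Type*} [LieRing G] [LieAlgebra k G]
    (I : LieIdeal k G) : Function.Surjective I.mkHom := LieSubmodule.Quotient.surjective_mk' I

lemma _root_.LieIdeal.mkHom_eq_zero {G : Type*} [LieRing G] [LieAlgebra k G]
    {I : LieIdeal k G} {x : G} : I.mkHom x = 0 ↔ x ∈ I :=
  LieSubmodule.Quotient.mk_eq_zero I

lemma _root_.FreeLieAlgebra.lieSpan_range_of (X : Type*) :
    LieSubalgebra.lieSpan k (FreeLieAlgebra k X) (Set.range (FreeLieAlgebra.of k)) = ⊤ := by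
  set K := LieSubalgebra.lieSpan k (FreeLieAlgebra k X) (Set.range (FreeLieAlgebra.of k))
  let φ : FreeLieAlgebra k X →ₗ⁅k⁆ K := FreeLieAlgebra.lift k fun x ↦
    ⟨FreeLieAlgebra.of k x, LieSubalgebra.subset_lieSpan ⟨x, rfl⟩⟩
  have h1 : K.incl.comp φ = LieHom.id := by
    refine FreeLieAlgebra.hom_ext fun x ↦ ?_
    simp [φ]
  rw [eq_top_iff]
  intro x _
  have := LieHom.congr_fun h1 x
  rw [LieHom.comp_apply, LieHom.id_apply] at this
  rw [← this]
  exact (φ x).2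

lemma mkHom_eq {x y : FreeLieAlgebra k (Gen ι 𝔥)} (h : x - y ∈ R.relIdeal) :
    R.relIdeal.mkHom x = R.relIdeal.mkHom y := by
  rw [← sub_eq_zero, ← map_sub]
  exact LieIdeal.mkHom_eq_zero.2 h

/-- The generators of the auxiliary Lie algebra. -/
def auxSystem : ChevalleySystem R.root R.coroot R.Aux where
  h :=
    { toFun := R.torus
      map_add' := fun x y ↦ by
        have := R.mkHom_eq (x := genH k ι 𝔥 (x + y)) (y := genH k ι 𝔥 x + genH k ι 𝔥 y)
          (by rw [← sub_sub]; exact LieSubmodule.subset_lieSpan (IsRelator.add x y))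
        rwa [map_add] at this
      map_smul' := fun c x ↦ by
        have := R.mkHom_eq (x := genH k ι 𝔥 (c • x)) (y := c • genH k ι 𝔥 x)
          (LieSubmodule.subset_lieSpan (IsRelator.smul c x))
        rwa [map_smul] at this }
  e i := R.relIdeal.mkHom (genE k ι 𝔥 i)
  f i := R.relIdeal.mkHom (genF k ι 𝔥 i)
  lie_h_h x y := by
    change ⁅R.relIdeal.mkHom _, R.relIdeal.mkHom _⁆ = 0
    rw [← LieHom.map_lie, LieIdeal.mkHom_eq_zero]
    exact LieSubmodule.subset_lieSpan (IsRelator.hh x y)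
  lie_h_e x i := by
    change ⁅R.relIdeal.mkHom _, R.relIdeal.mkHom _⁆ = _
    rw [← LieHom.map_lie, ← map_smul]
    exact R.mkHom_eq (LieSubmodule.subset_lieSpan (IsRelator.he x i))
  lie_h_f x i := by
    change ⁅R.relIdeal.mkHom _, R.relIdeal.mkHom _⁆ = _
    rw [← LieHom.map_lie, ← map_smul, ← map_neg]
    exact R.mkHom_eq (by
      rw [sub_neg_eq_add]; exact LieSubmodule.subset_lieSpan (IsRelator.hf x i))
  lie_e_f i := by
    rw [← LieHom.map_lie]
    exact R.mkHom_eq (LieSubmodule.subset_lieSpan (IsRelator.ef_eq i))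
  lie_e_f_ne i j hij := by
    rw [← LieHom.map_lie, LieIdeal.mkHom_eq_zero]
    exact LieSubmodule.subset_lieSpan (IsRelator.ef_ne i j hij)
  generates := by
    set K := LieSubalgebra.lieSpan k R.Aux _
    have h1 : LieSubalgebra.lieSpan k (FreeLieAlgebra k (Gen ι 𝔥))
        (Set.range (FreeLieAlgebra.of k)) ≤ K.comap R.relIdeal.mkHom := by
      rw [LieSubalgebra.lieSpan_le]
      rintro _ ⟨(i | i | x), rfl⟩
      · exact LieSubalgebra.subset_lieSpan (Or.inl (Or.inr ⟨i, rfl⟩))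
      · exact LieSubalgebra.subset_lieSpan (Or.inr ⟨i, rfl⟩)
      · exact LieSubalgebra.subset_lieSpan (Or.inl (Or.inl ⟨x, rfl⟩))
    rw [FreeLieAlgebra.lieSpan_range_of] at h1
    rw [eq_top_iff]
    intro y _
    obtain ⟨x, rfl⟩ := R.relIdeal.mkHom_surjective y
    exact h1 (LieSubalgebra.mem_top x)

/-- The generators of the Kac–Moody algebra. -/
def system : ChevalleySystem R.root R.coroot R.KacMoodyAlgebra :=
  R.auxSystem.map R.maxIdeal.mkHom R.maxIdeal.mkHom_surjective

variable [CharZero k]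

/-- That the supremum of the ideals avoiding `𝔥` again avoids `𝔥` is not formal: it holds because
each of them lies in the sum of the positive and negative parts. -/
lemma torus_eq_zero_of_mem_maxIdeal {x : 𝔥} (hx : R.torus x ∈ R.maxIdeal) : R.torus x = 0 := by
  classical
  refine R.auxSystem.h_eq_zero_of_mem R.root_linearIndependent (x := x) ?_
  have hle : R.maxIdeal.toSubmodule ≤ R.auxSystem.posPart ⊔ R.auxSystem.swap.posPart := by
    rw [maxIdeal, LieSubmodule.sSup_toSubmodule_eq_iSup]
    exact iSup₂_le fun I hI ↦ R.auxSystem.le_of_inf_eq_zero R.root_linearIndependent hI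
  exact hle hx

lemma system_noIdeal : R.system.NoIdeal := by
  intro I hI
  have hJ : LieIdeal.comap R.maxIdeal.mkHom I ≤ R.maxIdeal := by
    refine le_sSup fun x hx ↦ ?_
    refine R.torus_eq_zero_of_mem_maxIdeal ?_
    exact LieIdeal.mkHom_eq_zero.1 (hI x (LieIdeal.mem_comap.1 hx))
  rw [eq_bot_iff]
  intro y hy
  obtain ⟨x, rfl⟩ := R.maxIdeal.mkHom_surjective y
  rw [LieSubmodule.mem_bot, LieIdeal.mkHom_eq_zero]
  exact hJ (LieIdeal.mem_comap.2 hy)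

lemma system_h_injective : Function.Injective R.system.h := by
  rw [← LinearMap.ker_eq_bot, LinearMap.ker_eq_bot']
  intro x hx
  exact R.eq_zero_of_torus_eq_zero
    (R.torus_eq_zero_of_mem_maxIdeal (LieIdeal.mkHom_eq_zero.1 hx))

end Realization

end KacMoodySystem

/-! ### Finite dimensionality of Kac–Moody algebras -/

section KacMoodyFinite

variable {k : Type*} [Field k] [CharZero k] {ι 𝔥 : Type*} [AddCommGroup 𝔥] [Module k 𝔥]
  [Fintype ι] [DecidableEq ι]

namespace ChevalleySystem

variable {root : ι → Dual k 𝔥} {coroot : ι → 𝔥} {G : Type*} [LieRing G] [LieAlgebra k G]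
  {S : ChevalleySystem root coroot G}

lemma wt_coroot {A : Matrix ι ι ℤ} (hA : ∀ i j, root j (coroot i) = A i j) (c : ι → ℤ) (i : ι) :
    wt root c (coroot i) = (A.mulVec c i : k) := by
  simp [wt, LinearMap.sum_apply, Matrix.mulVec, dotProduct, hA, mul_comm]

lemma isSl2Triple {A : Matrix ι ι ℤ} (hA : ∀ i j, root j (coroot i) = A i j) (hG : IsGCM A)
    {i : ι} (hi : S.h (coroot i) ≠ 0) : IsSl2Triple (S.h (coroot i)) (S.e i) (S.f i) where
  h_ne_zero := hi
  lie_e_f := S.lie_e_f i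
  lie_h_e_nsmul := by
    rw [S.lie_h_e, hA, hG.diag, two_nsmul, Int.cast_ofNat, two_smul]
  lie_h_f_nsmul := by
    rw [S.lie_h_f, hA, hG.diag, two_nsmul, Int.cast_ofNat, two_smul]

lemma pow_e_mem_wtSpace {c : ι → ℤ} {v : G} (hv : v ∈ S.wtSpace G (wt root c)) (i : ι) (n : ℕ) :
    (ad k G (S.e i) ^ n) v ∈ S.wtSpace G (wt root (c + (n : ℤ) • Pi.single i 1)) := by
  induction n with
  | zero => simpa using hv
  | succ n ih =>
    rw [pow_succ', Module.End.mul_apply, ad_apply]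
    have := S.lie_e_mem_wtSpace ih i
    rw [← wt_single root, ← wt_add] at this
    convert this using 2
    push_cast
    rw [add_smul, one_smul]
    congr 1
    abel

lemma pow_f_mem_wtSpace {c : ι → ℤ} {v : G} (hv : v ∈ S.wtSpace G (wt root c)) (i : ι) (n : ℕ) :
    (ad k G (S.f i) ^ n) v ∈ S.wtSpace G (wt root (c - (n : ℤ) • Pi.single i 1)) := by
  induction n with
  | zero => simpa using hv
  | succ n ih =>
    rw [pow_succ', Module.End.mul_apply, ad_apply]
    have := S.lie_f_mem_wtSpace ih i
    rw [← wt_single root, ← wt_neg, ← wt_add] at this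
    convert this using 2
    push_cast
    rw [add_smul, one_smul]
    congr 1
    abel

lemma lie_f_pow_e_of_ne {i j : ι} (hij : i ≠ j) (v : G) (n : ℕ) :
    ⁅S.f j, (ad k G (S.e i) ^ n) v⁆ = (ad k G (S.e i) ^ n) ⁅S.f j, v⁆ := by
  induction n with
  | zero => simp
  | succ n ih =>
    rw [pow_succ', Module.End.mul_apply, Module.End.mul_apply, ad_apply, ad_apply, leibniz_lie,
      ← lie_skew (S.f j), S.lie_e_f_ne i j hij, neg_zero, zero_lie, zero_add, ih]

/-- The Serre relations. -/
lemma NoIdeal.serre (hS : S.NoIdeal) (hroot : LinearIndependent k root) {A : Matrix ι ι ℤ}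
    (hA : ∀ i j, root j (coroot i) = A i j) (hG : IsGCM A) (hcor : ∀ i, S.h (coroot i) ≠ 0)
    {i j : ι} (hij : i ≠ j) : (ad k G (S.e i) ^ ((-A i j).toNat + 1)) (S.e j) = 0 := by
  set m := (-A i j).toNat with hm
  have hmA : (m : ℤ) = -A i j := Int.toNat_of_nonneg (by have := hG.nonpos i j hij; omega)
  refine hS.eq_zero_of_lie_f hroot
    (c := Pi.single j 1 + ((m + 1 : ℕ) : ℤ) • Pi.single i 1) (fun l ↦ ?_) (fun h0 ↦ ?_)
    (pow_e_mem_wtSpace (S.e_mem_wtSpace j) i (m + 1)) fun l ↦ ?_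
  · simp only [Pi.add_apply, Pi.smul_apply, Pi.single_apply, smul_eq_mul]
    split_ifs <;> simp <;> positivity
  · have := congrFun h0 j
    simp [hij.symm] at this
  · by_cases hil : i = l
    · subst hil
      -- In the reversed triple `f i` is the raising operator, `e j` is primitive of weight `m = -A
      -- i j`, and its `(m + 1)`-st lowering is killed by raising.
      have ht := (isSl2Triple (S := S) hA hG (hcor i)).symm
      have hp : ht.HasPrimitiveVectorWith (S.e j) (m : k) :=
        { ne_zero := fun h0 ↦ hcor j (by rw [← S.lie_e_f, h0, zero_lie])
          lie_h := by
            rw [neg_lie, S.lie_h_e, hA]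
            have : (A i j : k) = -(m : k) := by
              have h1 : A i j = -(m : ℤ) := by omega
              rw [h1]; simp
            rw [this, neg_smul, neg_neg]
          lie_e := by rw [← lie_skew, S.lie_e_f_ne j i hij.symm, neg_zero] }
      have := hp.lie_e_pow_succ_toEnd_f m
      rw [sub_self, mul_zero, zero_smul] at this
      exact this
    · rw [lie_f_pow_e_of_ne hil]
      by_cases hjl : j = l
      · subst hjl
        rw [← lie_skew, S.lie_e_f, pow_succ, Module.End.mul_apply, map_neg, ad_apply,
          ← lie_skew, S.lie_h_e, hA, neg_neg, map_smul]
        -- The bracket with `f j` leaves `A j i` times `(ad e i) ^ m` applied to `e i`. For `m > 0`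
        -- this contains `⁅e i, e i⁆`; for `m = 0` the coefficient vanishes because zeros of the
        -- matrix are symmetric.
        rcases Nat.eq_zero_or_pos m with h0 | h0
        · have h1 : A i j = 0 := by omega
          rw [hG.zero_symm _ _ h1]; simp
        · obtain ⟨n, hn⟩ := Nat.exists_eq_succ_of_ne_zero h0.ne'
          rw [hn, pow_succ, Module.End.mul_apply]
          simp
      · rw [← lie_skew, S.lie_e_f_ne j l hjl, neg_zero, map_zero]

/-- The elements killed by a power of `ad (e i)` form the Engel subalgebra, so it is enough to treat
generators, where the Serre relations are the only nontrivial case. -/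
lemma NoIdeal.locally_nilpotent (hS : S.NoIdeal) (hroot : LinearIndependent k root)
    {A : Matrix ι ι ℤ} (hA : ∀ i j, root j (coroot i) = A i j) (hG : IsGCM A)
    (hcor : ∀ i, S.h (coroot i) ≠ 0) (i : ι) (y : G) :
    ∃ n : ℕ, (ad k G (S.e i) ^ n) y = 0 := by
  rw [← LieSubalgebra.mem_engel_iff]
  have htop : LieSubalgebra.engel k (S.e i) = ⊤ := by
    have hh : ∀ x, S.h x ∈ LieSubalgebra.engel k (S.e i) := fun x ↦ by
      rw [LieSubalgebra.mem_engel_iff]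
      refine ⟨2, ?_⟩
      rw [pow_two, Module.End.mul_apply, ad_apply, ad_apply, ← lie_skew (S.e i) (S.h x),
        S.lie_h_e]
      simp
    rw [eq_top_iff, ← S.generates, LieSubalgebra.lieSpan_le]
    rintro x ((⟨y, rfl⟩ | ⟨j, rfl⟩) | ⟨j, rfl⟩)
    · exact hh y
    · by_cases hij : i = j
      · subst hij; exact LieSubalgebra.self_mem_engel _ _
      · exact (LieSubalgebra.mem_engel_iff _ _ _).2 ⟨_, hS.serre hroot hA hG hcor hij⟩
    · by_cases hij : i = j
      · subst hij
        obtain ⟨n, hn⟩ := (LieSubalgebra.mem_engel_iff _ _ _).1 (hh (coroot i))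
        refine (LieSubalgebra.mem_engel_iff _ _ _).2 ⟨n + 1, ?_⟩
        rw [pow_succ, Module.End.mul_apply, ad_apply, S.lie_e_f, hn]
      · refine (LieSubalgebra.mem_engel_iff _ _ _).2 ⟨1, ?_⟩
        rw [pow_one, ad_apply, S.lie_e_f_ne i j hij]
  rw [htop]
  trivial

/-- The reflection of a weight along a simple root on which it is positive is a weight. -/
lemma NoIdeal.exists_reflect (hS : S.NoIdeal) (hroot : LinearIndependent k root)
    {A : Matrix ι ι ℤ} (hA : ∀ i j, root j (coroot i) = A i j) (hG : IsGCM A)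
    (hcor : ∀ i, S.h (coroot i) ≠ 0) {c : ι → ℤ} {v : G} (hv : v ∈ S.wtSpace G (wt root c))
    (hv0 : v ≠ 0) {i : ι} (hi : 0 < A.mulVec c i) :
    ∃ w ∈ S.wtSpace G (wt root (c - A.mulVec c i • Pi.single i 1)), w ≠ 0 := by
  classical
  have hnil := hS.locally_nilpotent hroot hA hG hcor i v
  obtain ⟨p, hp, hp'⟩ : ∃ p : ℕ, (ad k G (S.e i) ^ p) v ≠ 0 ∧
      (ad k G (S.e i) ^ (p + 1)) v = 0 := by
    have h0 : Nat.find hnil ≠ 0 := fun h ↦ hv0 (by simpa [h] using Nat.find_spec hnil)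
    obtain ⟨p, hp⟩ := Nat.exists_eq_succ_of_ne_zero h0
    exact ⟨p, Nat.find_min hnil (by omega), by simpa [hp] using Nat.find_spec hnil⟩
  set w := (ad k G (S.e i) ^ p) v
  have hw : w ∈ S.wtSpace G (wt root (c + (p : ℤ) • Pi.single i 1)) := pow_e_mem_wtSpace hv i p
  obtain ⟨b, hb⟩ := Int.eq_ofNat_of_zero_le hi.le
  have hmul : A.mulVec (c + (p : ℤ) • Pi.single i 1) i = ((b + 2 * p : ℕ) : ℤ) := by
    rw [Matrix.mulVec_add, Matrix.mulVec_smul]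
    simp [hb, hG.diag]
    ring
  have hprim : (isSl2Triple (S := S) hA hG (hcor i)).HasPrimitiveVectorWith w
      ((b + 2 * p : ℕ) : k) :=
    { ne_zero := hp
      lie_h := by
        rw [hw, wt_coroot hA, hmul, Int.cast_natCast]
      lie_e := by
        rw [pow_succ', Module.End.mul_apply, ad_apply] at hp'
        exact hp' }
  -- The vector `w` tops a string of highest weight `b + 2 p` and sits `p` steps above `v`; going
  -- down `b + p` steps lands `b` steps below `v` and stays within the string.
  refine ⟨(ad k G (S.f i) ^ (b + p)) w, ?_,
    hprim.pow_toEnd_f_ne_zero_of_eq_nat rfl (by omega)⟩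
  have := pow_f_mem_wtSpace hw i (b + p)
  convert this using 2
  rw [hb]
  push_cast
  rw [add_smul]
  congr 1
  abel

/-- The quadratic form of the symmetrized matrix. -/
def quad (A : Matrix ι ι ℤ) (d x : ι → ℝ) : ℝ := ∑ i, d i * x i * realMulVec A x i

lemma realMulVec_intCast (A : Matrix ι ι ℤ) (c : ι → ℤ) (i : ι) :
    realMulVec A (fun j ↦ (c j : ℝ)) i = (A.mulVec c i : ℝ) := by
  simp [realMulVec_apply, Matrix.mulVec, dotProduct]

/-- With `b = (A x)_i`, symmetry makes the two cross terms equal to `-d i b ^ 2` each, and they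
cancel the square term `2 d i b ^ 2`. -/
lemma quad_reflect {A : Matrix ι ι ℤ} (hG : IsGCM A) {d : ι → ℝ}
    (hs : ∀ i j, d i * A i j = d j * A j i) (x : ι → ℝ) (i : ι) :
    quad A d (x - realMulVec A x i • Pi.single i 1) = quad A d x := by
  set b := realMulVec A x i with hb
  have h1 : ∀ l, realMulVec A (Pi.single i (1 : ℝ)) l = A l i := fun l ↦ by
    simp [realMulVec_apply, Pi.single_apply]
  have h2 : ∑ l, d l * x l * (A l i : ℝ) = d i * b := by
    rw [hb, realMulVec_apply, Finset.mul_sum]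
    refine Finset.sum_congr rfl fun l _ ↦ ?_
    have := hs l i
    calc _ = (d l * A l i) * x l := by ring
      _ = _ := by rw [this]; ring
  simp only [quad, realMulVec_sub, realMulVec_smul]
  have h3 : ∀ l, d l * (x - b • (Pi.single i 1 : ι → ℝ)) l *
      (realMulVec A x - b • realMulVec A (Pi.single i 1)) l =
      d l * x l * realMulVec A x l - b * (d l * x l * (A l i : ℝ)) -
        (if l = i then b * (d l * (realMulVec A x l - b * A l i)) else 0) := by
    intro l
    simp only [Pi.sub_apply, Pi.smul_apply, smul_eq_mul, h1, Pi.single_apply]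
    split_ifs <;> ring
  rw [Finset.sum_congr rfl fun l _ ↦ h3 l]
  rw [Finset.sum_sub_distrib, Finset.sum_sub_distrib, ← Finset.mul_sum, h2,
    Finset.sum_ite_eq' Finset.univ i]
  simp only [Finset.mem_univ, if_true, hG.diag, ← hb]
  push_cast
  ring

/-- Positive definiteness gives an index `i` with `(A c)_i > 0` for the weight `c` of a nonzero
word. Reflecting in `i` preserves the form and shortens the word, and the process ends at a
generator, on which the form is `2 d j`. -/
lemma NoIdeal.quad_le (hS : S.NoIdeal) (hroot : LinearIndependent k root)
    {A : Matrix ι ι ℤ} (hA : ∀ i j, root j (coroot i) = A i j) (hG : IsGCM A)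
    (hcor : ∀ i, S.h (coroot i) ≠ 0) {d : ι → ℝ} (hd : ∀ i, 0 < d i)
    (hs : ∀ i j, d i * A i j = d j * A j i) (hq : ∀ x : ι → ℝ, x ≠ 0 → 0 < quad A d x)
    (n : ℕ) : ∀ (j : ι) (l : List ι), l.length = n → S.word j l ≠ 0 →
      quad A d (fun i ↦ (cnt (j :: l) i : ℝ)) ≤ ∑ i, 2 * d i := by
  induction n using Nat.strong_induction_on with
  | _ n ih =>
    intro j l hl hw
    rcases eq_or_ne l [] with rfl | hl0
    · have h1 : (fun i ↦ ((cnt [j] i : ℤ) : ℝ)) = Pi.single j 1 := by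
        ext i; simp [cnt, Pi.single_apply]
      rw [h1]
      have h2 : quad A d (Pi.single j 1) = 2 * d j := by
        rw [quad, Finset.sum_eq_single j]
        · simp [realMulVec_apply, Pi.single_apply, hG.diag]; ring
        · intro i _ hij; simp [hij]
        · simp
      rw [h2]
      exact Finset.single_le_sum (f := fun i ↦ 2 * d i) (fun i _ ↦ by have := hd i; positivity)
        (Finset.mem_univ j)
    · set c := cnt (j :: l) with hc
      have hc0 : c ≠ 0 := cnt_cons_ne_zero j l
      have hpos := hq (fun i ↦ (c i : ℝ)) fun h0 ↦ hc0 (by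
        ext i
        have h1 : (c i : ℝ) = 0 := congrFun h0 i
        exact_mod_cast h1)
      obtain ⟨i, hi⟩ : ∃ i, 0 < A.mulVec c i := by
        by_contra! h
        refine absurd hpos (not_lt.2 (Finset.sum_nonpos fun i _ ↦ ?_))
        rw [realMulVec_intCast]
        refine mul_nonpos_of_nonneg_of_nonpos (mul_nonneg (hd i).le ?_) (by exact_mod_cast h i)
        have h1 : (0 : ℝ) ≤ (c i : ℝ) := by exact_mod_cast cnt_nonneg (j :: l) i
        exact h1
      obtain ⟨w, hw', hw0⟩ := hS.exists_reflect hroot hA hG hcor (S.word_mem_wtSpace j l) hw hi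
      obtain ⟨s, hs1, hs2⟩ := S.exists_spanWt_eq hroot hw0 hw'
      rw [← hc] at hs1
      -- A weight supported at `i` alone would come from a word in `e i` only, which is zero. So
      -- some other coordinate of `c` is positive, is unchanged by the reflection, and forces the
      -- reflected weight to be positive.
      have hsingle : (∀ m, m ≠ i → c m = 0) → False := by
        intro h
        have h1 := eq_of_cnt_eq_zero h
        obtain rfl : j = i := h1 j (by simp)
        exact hw (S.word_eq_zero (fun m hm ↦ h1 m (by simp [hm])) hl0)
      have hcm : ∀ m, m ≠ i → spanWt s m = c m := fun m hm ↦ by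
        rw [hs1]; simp [hm]
      rcases s with x | ⟨j', l'⟩ | ⟨j', l'⟩
      · exact (hsingle fun m hm ↦ (hcm m hm).symm).elim
      · have hlen : l'.length < n := by
          have h1 : ∑ m, cnt (j' :: l') m = ∑ m, (c - A.mulVec c i • (Pi.single i 1 : ι → ℤ)) m := by
            rw [← hs1]; rfl
          simp only [Pi.sub_apply, Pi.smul_apply, smul_eq_mul, Finset.sum_sub_distrib,
            ← Finset.mul_sum, Finset.sum_pi_single', sum_cnt (j' :: l'), List.length_cons,
            Finset.mem_univ, if_true, mul_one] at h1
          have h2 : ∑ m, c m = ((j :: l).length : ℤ) := sum_cnt (j :: l)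
          rw [h2, List.length_cons] at h1
          push_cast at h1
          omega
        have h1 := ih _ hlen j' l' rfl hs2
        have h2 : (fun m ↦ ((cnt (j' :: l') m : ℤ) : ℝ)) = (fun m ↦ (c m : ℝ)) -
            realMulVec A (fun m ↦ (c m : ℝ)) i • Pi.single i 1 := by
          ext m
          have h3 := congrFun hs1 m
          simp only [spanWt] at h3
          rw [h3, realMulVec_intCast]
          simp [Pi.single_apply]
        rwa [h2, quad_reflect hG hs] at h1
      · refine (hsingle fun m hm ↦ ?_).elim
        have h1 := hcm m hm
        simp only [spanWt, Pi.neg_apply] at h1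
        have h2 := cnt_nonneg (j' :: l') m
        have h3 : 0 ≤ c m := cnt_nonneg (j :: l) m
        omega

/-- The form is bounded on weights of nonzero words and dominates `∑ m i * c i ^ 2`. Since each `c
i` is an integer, `c i ≤ c i ^ 2`, so every coordinate and hence the length is bounded. -/
lemma NoIdeal.exists_length_bound (hS : S.NoIdeal) (hroot : LinearIndependent k root)
    {A : Matrix ι ι ℤ} (hA : ∀ i j, root j (coroot i) = A i j) (hG : IsGCM A)
    (hcor : ∀ i, S.h (coroot i) ≠ 0) {u : ι → ℝ} (hu : ∀ i, 0 < u i)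
    (hAu : ∀ i, 0 < realMulVec A u i) :
    ∃ N : ℕ, ∀ (j : ι) (l : List ι), S.word j l ≠ 0 → l.length ≤ N := by
  obtain ⟨d, hd, hs⟩ := hG.exists_symmetrizer hu hAu
  set m : ι → ℝ := fun i ↦ d i * realMulVec A u i / u i with hm
  have hm0 : ∀ i, 0 < m i := fun i ↦ div_pos (mul_pos (hd i) (hAu i)) (hu i)
  have hlow : ∀ x : ι → ℝ, ∑ i, m i * x i ^ 2 ≤ quad A d x :=
    fun x ↦ hG.quadratic_lower_bound hu hd hs x
  have hq : ∀ x : ι → ℝ, x ≠ 0 → 0 < quad A d x := by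
    intro x hx
    obtain ⟨i, hi⟩ := Function.ne_iff.1 hx
    refine lt_of_lt_of_le ?_ (hlow x)
    refine Finset.sum_pos' (fun i _ ↦ mul_nonneg (hm0 i).le (sq_nonneg _))
      ⟨i, Finset.mem_univ i, mul_pos (hm0 i) ?_⟩
    have : x i ≠ 0 := hi
    positivity
  set C := ∑ i, 2 * d i
  refine ⟨⌈∑ i, C / m i⌉₊, fun j l hw ↦ ?_⟩
  have h1 := hS.quad_le hroot hA hG hcor hd hs hq _ j l rfl hw
  have h2 := (hlow _).trans h1
  have h3 : ∀ i, ((cnt (j :: l) i : ℤ) : ℝ) ≤ C / m i := by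
    intro i
    rw [le_div_iff₀ (hm0 i)]
    have h4 : m i * ((cnt (j :: l) i : ℤ) : ℝ) ^ 2 ≤ C :=
      le_trans (Finset.single_le_sum (f := fun i ↦ m i * ((cnt (j :: l) i : ℤ) : ℝ) ^ 2)
        (fun i _ ↦ mul_nonneg (hm0 i).le (sq_nonneg _)) (Finset.mem_univ i)) h2
    refine le_trans ?_ h4
    rw [mul_comm]
    refine mul_le_mul_of_nonneg_left ?_ (hm0 i).le
    exact_mod_cast Int.le_self_sq _
  have h5 : ((l.length + 1 : ℕ) : ℝ) ≤ ∑ i, C / m i := by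
    have h6 := sum_cnt (j :: l)
    have h7 : ∑ i, ((cnt (j :: l) i : ℤ) : ℝ) = ((l.length + 1 : ℕ) : ℝ) := by
      rw [← Int.cast_sum, h6]; simp
    rw [← h7]
    exact Finset.sum_le_sum fun i _ ↦ h3 i
  have h8 := h5.trans (Nat.le_ceil _)
  have : l.length + 1 ≤ ⌈∑ i, C / m i⌉₊ := by exact_mod_cast h8
  omega

lemma posPart_fg {N : ℕ} (h : ∀ (j : ι) (l : List ι), S.word j l ≠ 0 → l.length ≤ N) :
    S.posPart.FG := by
  have hfin : {p : ι × List ι | p.2.length ≤ N}.Finite :=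
    (Set.finite_univ.prod (List.finite_length_le ι N)).subset fun p hp ↦ ⟨trivial, hp⟩
  have heq : S.posPart =
      Submodule.span k ((fun p : ι × List ι ↦ S.word p.1 p.2) '' {p | p.2.length ≤ N}) := by
    refine le_antisymm (Submodule.span_le.2 ?_) (Submodule.span_mono (Set.image_subset_range _ _))
    rintro _ ⟨p, rfl⟩
    by_cases h0 : S.word p.1 p.2 = 0
    · simp [h0]
    · exact Submodule.subset_span ⟨p, h _ _ h0, rfl⟩
  rw [heq]
  exact Submodule.fg_span (hfin.image _)

/-- A Kac–Moody algebra whose matrix has `A u > 0` for some `u > 0` is finite dimensional. -/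
lemma NoIdeal.finite (hS : S.NoIdeal) [Module.Finite k 𝔥] (hroot : LinearIndependent k root)
    {A : Matrix ι ι ℤ} (hA : ∀ i j, root j (coroot i) = A i j) (hG : IsGCM A)
    (hcor : ∀ i, S.h (coroot i) ≠ 0) {u : ι → ℝ} (hu : ∀ i, 0 < u i)
    (hAu : ∀ i, 0 < realMulVec A u i) : Module.Finite k G := by
  obtain ⟨N, hN⟩ := hS.exists_length_bound hroot hA hG hcor hu hAu
  obtain ⟨N', hN'⟩ := hS.swap.exists_length_bound hroot hA hG
    (fun i h ↦ hcor i (by simpa using h)) hu hAu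
  refine ⟨?_⟩
  rw [← S.triangular_eq_top]
  refine Submodule.FG.sup (Submodule.FG.sup ?_ (posPart_fg hN)) (posPart_fg hN')
  rw [LinearMap.range_eq_map]
  exact Submodule.FG.map _ Module.Finite.fg_top

/-- Removing outer letters from a nonzero word leaves nonzero words, so unbounded lengths would give
a nonzero word of every length. These have distinct weights and are linearly independent. -/
lemma exists_length_bound_of_finite [Module.Finite k G] (S : ChevalleySystem root coroot G)
    (hroot : LinearIndependent k root) :
    ∃ N : ℕ, ∀ (j : ι) (l : List ι), S.word j l ≠ 0 → l.length ≤ N := by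
  by_contra! h
  have hex : ∀ n : ℕ, ∃ (j : ι) (l : List ι), S.word j l ≠ 0 ∧ l.length = n := by
    intro n
    obtain ⟨j, l, hl, hn⟩ := h n
    induction l with
    | nil => simp at hn
    | cons i l ih =>
      rcases Nat.lt_or_ge n l.length with h1 | h1
      · refine ih (fun h0 ↦ hl ?_) h1
        simp only [word] at h0
        simp [word, act, h0]
      · refine ⟨j, l, fun h0 ↦ hl ?_, ?_⟩
        · simp only [word] at h0
          simp [word, act, h0]
        · simp at hn; omega
  choose j l hw hn using hex
  have hind : iSupIndep (S.wtSpace G) := by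
    intro φ
    rw [Submodule.disjoint_def]
    intro m hm hm'
    refine S.eq_zero_of_mem_iSup hm ?_
    rwa [iSup_subtype]
  have hinj : Function.Injective fun n ↦ wt root (cnt (j n :: l n)) := by
    intro n n' h
    have h1 := wt_injective hroot h
    have h2 := sum_cnt (j n :: l n)
    rw [h1, sum_cnt] at h2
    simp [hn] at h2
    exact h2.symm
  have hli := (hind.comp hinj).linearIndependent _
    (v := fun n ↦ S.word (j n) (l n)) (fun n ↦ S.word_mem_wtSpace _ _) hw
  exact not_finite_iff_infinite.2 inferInstance (hli.finite : Finite ℕ)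

/-- A finite dimensional Kac–Moody algebra has a weight `c ≥ 0` with `A c ≥ 0` and `A c ≠ 0`. -/
lemma NoIdeal.exists_of_finite (hS : S.NoIdeal) [Nonempty ι] [Module.Finite k G]
    (hroot : LinearIndependent k root)
    {A : Matrix ι ι ℤ} (hA : ∀ i j, root j (coroot i) = A i j) (hG : IsGCM A)
    (hcor : ∀ i, S.h (coroot i) ≠ 0) :
    ∃ c : ι → ℤ, (∀ i, 0 ≤ c i) ∧ (∀ i, 0 ≤ A.mulVec c i) ∧ A.mulVec c ≠ 0 := by
  classical
  obtain ⟨N, hN⟩ := S.exists_length_bound_of_finite hroot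
  let P : ℕ → Prop := fun n ↦ ∃ (j : ι) (l : List ι), S.word j l ≠ 0 ∧ l.length = n
  have hP0 : P 0 := ⟨Classical.arbitrary ι, [], fun h0 ↦ hcor (Classical.arbitrary ι) (by
    rw [← S.lie_e_f]
    have h1 : S.e (Classical.arbitrary ι) = 0 := h0
    rw [h1, zero_lie]), rfl⟩
  obtain ⟨j, l, hw, hl⟩ := Nat.findGreatest_spec (P := P) (Nat.zero_le N) hP0
  have he : ∀ i, ⁅S.e i, S.word j l⁆ = 0 := by
    intro i
    by_contra h0
    have h1 : S.word j (i :: l) ≠ 0 := h0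
    have h2 := Nat.le_findGreatest (P := P) (hN _ _ h1) ⟨j, i :: l, h1, rfl⟩
    simp only [List.length_cons] at h2
    omega
  set c := cnt (j :: l) with hc
  -- A longest nonzero word is killed by every `e i`, so all the `(A c)_i` are natural numbers. If
  -- all were zero, every `f i` would kill the word as well, which the absence of ideals forbids.
  have hprim : ∀ i, (isSl2Triple (S := S) hA hG (hcor i)).HasPrimitiveVectorWith (S.word j l)
      (A.mulVec c i : k) := fun i ↦
    { ne_zero := hw
      lie_h := by rw [S.word_mem_wtSpace j l, wt_coroot hA]
      lie_e := he i }
  refine ⟨c, cnt_nonneg _, fun i ↦ ?_, fun h0 ↦ hw ?_⟩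
  · obtain ⟨n, hn⟩ := (hprim i).exists_nat
    have : A.mulVec c i = n := by exact_mod_cast hn
    omega
  · refine hS.eq_zero_of_lie_f hroot (cnt_nonneg _) (cnt_cons_ne_zero j l)
      (S.word_mem_wtSpace j l) fun i ↦ ?_
    have := (hprim i).pow_toEnd_f_eq_zero_of_eq_nat (n := 0) (by simp [h0])
    simpa using this

end ChevalleySystem

namespace Realization

variable {A : Matrix ι ι ℤ} (R : Realization (A.map (Int.cast : ℤ → k)) 𝔥)

lemma system_h_coroot_ne_zero (i : ι) : R.system.h (R.coroot i) ≠ 0 := fun h ↦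
  R.coroot_linearIndependent.ne_zero i (R.system_h_injective (h.trans (map_zero _).symm))

lemma finite_of_pos (hG : IsGCM A) {u : ι → ℝ} (hu : ∀ i, 0 < u i)
    (hAu : ∀ i, 0 < realMulVec A u i) : Module.Finite k R.KacMoodyAlgebra := by
  have := R.finiteDimensional
  exact R.system_noIdeal.finite R.root_linearIndependent (fun i j ↦ R.root_coroot i j) hG
    R.system_h_coroot_ne_zero hu hAu

/-- One direction uses the weight of a longest word as a test vector, the other the Perron vector
`u` itself as a positive vector with `A u > 0`. -/
lemma finite_iff_of_isPerron (hG : IsGCM A) (hI : Indecomposable A) {t : ℝ} {u p : ι → ℝ}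
    (h : IsPerron A t u p) : Module.Finite k R.KacMoodyAlgebra ↔ 0 < t := by
  constructor
  · intro hfin
    have := hI.1
    obtain ⟨c, hc, hAc, hAc0⟩ := R.system_noIdeal.exists_of_finite R.root_linearIndependent
      (fun i j ↦ R.root_coroot i j) hG R.system_h_coroot_ne_zero
    refine h.pos_of_realMulVec (v := fun i ↦ (c i : ℝ)) (fun i ↦ by exact_mod_cast hc i)
      (fun i ↦ ?_) fun h0 ↦ hAc0 ?_
    · rw [ChevalleySystem.realMulVec_intCast]
      exact_mod_cast hAc i
    · ext i
      have h1 := congrFun h0 i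
      rw [ChevalleySystem.realMulVec_intCast] at h1
      have h2 : (A.mulVec c i : ℝ) = 0 := h1
      exact_mod_cast h2
  · intro ht
    refine R.finite_of_pos hG h.u_pos fun i ↦ ?_
    rw [h.right]
    exact mul_pos ht (h.u_pos i)

end Realization

end KacMoodyFinite

/-! ### Foldings of generalized Cartan matrices -/

section Folding

variable {ι κ : Type*} [Fintype ι] [Fintype κ]

/-- The relation between a generalized Cartan matrix `M` and a folding `B` of it: `P i` are the
coefficients of the `i`-th folded root, `s a` is the folded root to which the simple root `a`
restricts (if it does not restrict to zero). -/
structure IsFolding (M : Matrix ι ι ℤ) (B : Matrix κ κ ℤ) (P : κ → ι → ℝ) (s : ι → Option κ)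
    (c : ι → ℝ) : Prop where
  c_pos : ∀ a, 0 < c a
  P_nonneg : ∀ i a, 0 ≤ P i a
  P_pos : ∀ a i, s a = some i → 0 < P i a
  P_zero : ∀ a i j, s a = some j → i ≠ j → P i a = 0
  surj : ∀ i, ∃ a, s a = some i
  mul_some : ∀ i a j, s a = some j → realMulVec M (P i) a = c a * B i j
  mul_none : ∀ i a, s a = none → realMulVec M (P i) a = 0

namespace IsFolding

variable {M : Matrix ι ι ℤ} {B : Matrix κ κ ℤ} {P : κ → ι → ℝ} {s : ι → Option κ} {c : ι → ℝ}

lemma realMulVec_sum (M : Matrix ι ι ℤ) (P : κ → ι → ℝ) (v : κ → ℝ) (a : ι) :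
    realMulVec M (∑ i, v i • P i) a = ∑ i, v i * realMulVec M (P i) a := by
  simp only [realMulVec_apply, Finset.sum_apply, Pi.smul_apply, smul_eq_mul, Finset.mul_sum]
  rw [Finset.sum_comm]
  exact Finset.sum_congr rfl fun i _ ↦ Finset.sum_congr rfl fun j _ ↦ by ring

/-- The transpose reflects two conventions: rows of `M` are indexed by coroots, rows of `B` by
roots. Hence left eigenvectors of `B` lift to test vectors for `M`. -/
lemma realMulVec_some (h : IsFolding M B P s c) (v : κ → ℝ) {a : ι} {j : κ} (ha : s a = some j) :
    realMulVec M (∑ i, v i • P i) a = c a * realMulVec B.transpose v j := by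
  rw [realMulVec_sum, realMulVec_apply, Finset.mul_sum]
  exact Finset.sum_congr rfl fun i _ ↦ by
    rw [h.mul_some i a j ha, Matrix.transpose_apply]; ring

lemma realMulVec_none (h : IsFolding M B P s c) (v : κ → ℝ) {a : ι} (ha : s a = none) :
    realMulVec M (∑ i, v i • P i) a = 0 := by
  rw [realMulVec_sum]
  exact Finset.sum_eq_zero fun i _ ↦ by rw [h.mul_none i a ha, mul_zero]

lemma sum_apply_some (h : IsFolding M B P s c) (v : κ → ℝ) {a : ι} {j : κ} (ha : s a = some j) :
    (∑ i, v i • P i) a = v j * P j a := by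
  classical
  rw [Finset.sum_apply, Finset.sum_eq_single j]
  · rfl
  · intro i _ hij
    simp [h.P_zero a i j ha hij]
  · simp

lemma sum_nonneg (h : IsFolding M B P s c) {v : κ → ℝ} (hv : ∀ i, 0 ≤ v i) (a : ι) :
    0 ≤ (∑ i, v i • P i) a := by
  rw [Finset.sum_apply]
  exact Finset.sum_nonneg fun i _ ↦ mul_nonneg (hv i) (h.P_nonneg i a)

/-- If `B` split along `S`, the lift of the indicator of `S` would be nonnegative, with a
nonnegative row at each of its zeros, yet neither zero nor positive. Indecomposability of `M`
excludes this. -/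
lemma indecomposable (h : IsFolding M B P s c) [Nonempty κ] (hM : IsGCM M)
    (hI : Indecomposable M) : Indecomposable B := by
  classical
  refine ⟨inferInstance, fun S ⟨i₀, hi₀⟩ ⟨j₀, hj₀⟩ ↦ ?_⟩
  by_contra! hcon
  set v : κ → ℝ := S.indicator 1 with hv
  have hv0 : ∀ i, 0 ≤ v i := fun i ↦ Set.indicator_nonneg (fun _ _ ↦ zero_le_one) i
  have hx := hI.eq_zero_or_pos hM (w := ∑ i, v i • P i) (h.sum_nonneg hv0) fun a ha ↦ by
    rcases hs : s a with _ | j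
    · rw [h.realMulVec_none v hs]
    · rw [h.realMulVec_some v hs]
      rw [h.sum_apply_some v hs] at ha
      have hj : j ∉ S := fun hj ↦ by
        have := h.P_pos a j hs
        simp [hv, Set.indicator_of_mem hj] at ha
        linarith
      refine mul_nonneg (h.c_pos a).le (le_of_eq (Eq.symm ?_))
      rw [realMulVec_apply]
      refine Finset.sum_eq_zero fun i _ ↦ ?_
      by_cases hi : i ∈ S
      · rw [Matrix.transpose_apply, (hcon i hi j hj).1]; simp
      · simp [hv, hi]
  obtain ⟨a, ha⟩ := h.surj i₀
  obtain ⟨b, hb⟩ := h.surj j₀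
  rcases hx with hx | hx
  · have h1 := congrFun hx a
    rw [h.sum_apply_some v ha] at h1
    have := h.P_pos a i₀ ha
    simp [hv, Set.indicator_of_mem hi₀] at h1
    linarith
  · have h1 := hx b
    rw [h.sum_apply_some v hb] at h1
    simp [hv, Set.indicator_of_notMem hj₀] at h1

lemma sum_ne_zero (h : IsFolding M B P s c) {v : κ → ℝ} {i : κ} (hi : 0 < v i) :
    (∑ i, v i • P i) ≠ 0 := by
  obtain ⟨a, ha⟩ := h.surj i
  intro h0
  have h1 := congrFun h0 a
  rw [h.sum_apply_some v ha] at h1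
  exact (mul_pos hi (h.P_pos a i ha)).ne' h1

/-- The Perron eigenvalues of a matrix and of its folding have the same sign. -/
lemma sign_eq (h : IsFolding M B P s c) [Nonempty κ] {t t' : ℝ} {u p : ι → ℝ}
    {u' p' : κ → ℝ} (hM : IsPerron M t u p) (hB : IsPerron B t' u' p') :
    (0 < t ↔ 0 < t') ∧ (t = 0 ↔ t' = 0) := by
  set x := ∑ i, p' i • P i with hx
  have hx0 : ∀ a, 0 ≤ x a := h.sum_nonneg fun i ↦ (hB.p_pos i).le
  have hxne : x ≠ 0 := h.sum_ne_zero (hB.p_pos (Classical.arbitrary κ))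
  have hsome : ∀ a j, s a = some j → realMulVec M x a = t' * (c a * p' j) := fun a j ha ↦ by
    rw [hx, h.realMulVec_some _ ha, hB.left, Pi.smul_apply, smul_eq_mul]; ring
  have hpos : ∀ a j, s a = some j → 0 < c a * p' j := fun a j _ ↦
    mul_pos (h.c_pos a) (hB.p_pos j)
  have hne : t' ≠ 0 → realMulVec M x ≠ 0 := fun ht h0 ↦ by
    obtain ⟨a, ha⟩ := h.surj (Classical.arbitrary κ)
    have h1 := hsome a _ ha
    rw [h0] at h1
    exact (mul_ne_zero ht (hpos a _ ha).ne') h1.symm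
  rcases lt_trichotomy t' 0 with ht | ht | ht
  · have := hM.neg_of_realMulVec hx0 (fun a ↦ by
      rcases ha : s a with _ | j
      · rw [hx, h.realMulVec_none _ ha]
      · rw [hsome a j ha]
        exact mul_nonpos_of_nonpos_of_nonneg ht.le (hpos a j ha).le) (hne ht.ne)
    exact ⟨⟨fun h ↦ by linarith, fun h ↦ by linarith⟩,
      ⟨fun h ↦ by linarith, fun h ↦ by linarith⟩⟩
  · have := hM.eq_zero_of_realMulVec hx0 hxne (by
      ext a
      rcases ha : s a with _ | j
      · rw [hx, h.realMulVec_none _ ha]; rfl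
      · rw [hsome a j ha, ht, zero_mul]; rfl)
    simp [this, ht]
  · have := hM.pos_of_realMulVec hx0 (fun a ↦ by
      rcases ha : s a with _ | j
      · rw [hx, h.realMulVec_none _ ha]
      · rw [hsome a j ha]
        exact (mul_pos ht (hpos a j ha)).le) (hne ht.ne')
    simp [this, ht, this.ne', ht.ne']

/-- A folding of a matrix with `M u > 0` for some `u > 0` is of finite type. -/
lemma isFiniteType (h : IsFolding M B P s c) (hM : IsGCM M) (hB : IsGCM B) {u : ι → ℝ}
    (hu : ∀ i, 0 < u i) (hMu : ∀ i, 0 < realMulVec M u i) (k : Type*) [Field k] :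
    IsFiniteType (B.map (Int.cast : ℤ → k)) := by
  classical
  refine ⟨B, rfl, hB, fun S hS ↦ ?_⟩
  obtain ⟨t, w, p, hp⟩ := hS.1.exists_isPerron (hB.block S)
  refine (hp.satisfiesFin_iff hS.1 (hB.block S)).2 ?_
  obtain ⟨d, hd, hs⟩ := hM.exists_symmetrizer hu hMu
  -- By symmetrizability, `q` is a positive vector with `Mᵀ q > 0`. It replaces the left Perron
  -- vector, which is not available since `M` need not be indecomposable.
  set q : ι → ℝ := fun a ↦ d a * u a
  have hq : ∀ a, 0 < realMulVec M.transpose q a := fun a ↦ by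
    have h1 : realMulVec M.transpose q a = d a * realMulVec M u a := by
      rw [realMulVec_apply, realMulVec_apply, Finset.mul_sum]
      refine Finset.sum_congr rfl fun b _ ↦ ?_
      rw [Matrix.transpose_apply]
      have := hs a b
      calc _ = (d b * M b a) * u b := by simp only [q]; ring
        _ = _ := by rw [← this]; ring
    rw [h1]
    exact mul_pos (hd a) (hMu a)
  -- Extending by zero keeps an eigenvector because a component does not interact with its
  -- complement.
  set v : κ → ℝ := fun i ↦ if hi : i ∈ S then p ⟨i, hi⟩ else 0 with hv
  have hv0 : ∀ i, 0 ≤ v i := fun i ↦ by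
    simp only [hv]; split_ifs
    · exact (hp.p_pos _).le
    · exact le_rfl
  obtain ⟨⟨i₀, hi₀⟩⟩ := hS.1.1
  set x := ∑ i, v i • P i with hx
  have hx0 : ∀ a, 0 ≤ x a := h.sum_nonneg hv0
  have hxne : x ≠ 0 := h.sum_ne_zero (i := i₀) (by simp only [hv, dif_pos hi₀]; exact hp.p_pos _)
  have hBv : ∀ j, realMulVec B.transpose v j = t * v j := by
    intro j
    by_cases hj : j ∈ S
    · have h1 := congrFun hp.left ⟨j, hj⟩
      simp only [Pi.smul_apply, smul_eq_mul] at h1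
      have h2 : v j = p ⟨j, hj⟩ := by simp [hv, hj]
      rw [h2, ← h1, realMulVec_apply, realMulVec_apply]
      rw [← Finset.sum_subset (Finset.subset_univ S), ← Finset.sum_coe_sort S]
      · refine Finset.sum_congr rfl fun i _ ↦ ?_
        have h3 : v i = p i := by simp [hv]
        rw [h3]; rfl
      · intro i _ hi
        simp [hv, hi]
    · have h2 : v j = 0 := by simp [hv, hj]
      rw [h2, mul_zero, realMulVec_apply]
      refine Finset.sum_eq_zero fun i _ ↦ ?_
      by_cases hi : i ∈ S
      · rw [Matrix.transpose_apply, (hS.2 i hi j hj).1]; simp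
      · simp [hv, hi]
  have hpos : 0 < ∑ a, q a * realMulVec M x a := by
    rw [sum_mul_realMulVec]
    obtain ⟨a, ha⟩ := Function.ne_iff.1 hxne
    exact Finset.sum_pos' (fun a _ ↦ mul_nonneg (hq a).le (hx0 a))
      ⟨a, Finset.mem_univ a, mul_pos (hq a) (lt_of_le_of_ne (hx0 a) (Ne.symm ha))⟩
  by_contra! ht
  refine absurd hpos (not_lt.2 (Finset.sum_nonpos fun a _ ↦ ?_))
  refine mul_nonpos_of_nonneg_of_nonpos (mul_pos (hd a) (hu a)).le ?_
  rcases ha : s a with _ | j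
  · rw [hx, h.realMulVec_none _ ha]
  · rw [hx, h.realMulVec_some _ ha, hBv]
    exact mul_nonpos_of_nonneg_of_nonpos (h.c_pos a).le
      (mul_nonpos_of_nonpos_of_nonneg ht (hv0 j))

end IsFolding

end Folding

/-! ### Involutions that act on a basis by negation up to fixed vectors -/

section Involution

variable {k V ι : Type*} [Field k] [CharZero k] [AddCommGroup V] [Module k V] [Fintype ι]

/-- An involution which sends each basis vector outside `F` to a non-positive combination, and
fixes the basis vectors in `F`, permutes the basis up to sign modulo the span of `F`. -/
lemma exists_neg_eq_add_of_involution (b : Basis ι k V) (τ : V →ₗ[k] V) (hτ : ∀ x, τ (τ x) = x)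
    (F : Set ι) (hF : ∀ i ∈ F, τ (b i) = b i)
    (hN : ∀ i ∉ F, ∃ n : ι → ℕ, -τ (b i) = ∑ j, n j • b j) {i : ι} (hi : i ∉ F) :
    ∃ j ∉ F, ∃ m : ι → ℕ, (∀ l ∉ F, m l = 0) ∧ -τ (b i) = b j + ∑ l, m l • b l := by
  classical
  choose! n hn using hN
  -- Modulo the span of `F`, the square of `-τ` is the identity, so its matrix `n` composed with
  -- itself is the identity. Natural number entries then leave no room for cancellation, and `n` is
  -- a permutation matrix.
  have hcomp : ∀ c ∉ F, (∑ j ∈ Finset.univ.filter (· ∉ F), n i j * n j c) = if i = c then 1 else 0 := by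
    intro c hc
    have h1 : b i = ∑ j, n i j • (-τ (b j)) := by
      conv_lhs => rw [← hτ (b i), ← neg_neg (τ (b i)), hn i hi]
      simp [map_sum]
    have h2 := congrArg (fun x ↦ b.repr x c) h1
    have h3 : ∀ j, b.repr (n i j • (-τ (b j))) c = if j ∉ F then ((n i j * n j c : ℕ) : k) else 0 := by
      intro j
      by_cases hj : j ∈ F
      · have hjc : j ≠ c := fun h ↦ hc (h ▸ hj)
        simp [hj, hF j hj, hjc]
      · rw [hn j hj]
        simp [hj, Finsupp.single_apply]
    simp only [Basis.repr_self, Finsupp.single_apply, map_sum, Finsupp.coe_finsetSum,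
      Finset.sum_apply, h3] at h2
    rw [← Finset.sum_filter] at h2
    exact_mod_cast h2.symm
  have hii := hcomp i hi
  rw [if_pos rfl] at hii
  obtain ⟨j, hj, hij⟩ : ∃ j ∈ Finset.univ.filter (· ∉ F), n i j * n j i ≠ 0 := by
    by_contra! h
    rw [Finset.sum_eq_zero h] at hii
    omega
  have hjF : j ∉ F := by simpa using hj
  have h1 : n i j * n j i ≤ 1 := by
    rw [← hii]
    exact Finset.single_le_sum (f := fun j ↦ n i j * n j i) (fun _ _ ↦ Nat.zero_le _) hj
  have h11 : n i j * n j i = 1 := le_antisymm h1 (Nat.one_le_iff_ne_zero.mpr hij)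
  obtain ⟨hnij, hnji⟩ := mul_eq_one.mp h11
  have hjc : ∀ c ∉ F, c ≠ i → n j c = 0 := by
    intro c hc hci
    have := hcomp c hc
    rw [if_neg (Ne.symm hci)] at this
    have h := (Finset.sum_eq_zero_iff.mp this) j hj
    simpa [hnij] using h
  -- It is row `j`, not row `i`, that is now known outside `F`; applying `τ`, which fixes the
  -- remainder, exchanges the two.
  have key : -τ (b j) = b i + ∑ l, (if l ∈ F then n j l else 0) • b l := by
    rw [hn j hjF, ← Finset.sum_filter_add_sum_filter_not Finset.univ (· ∈ F), add_comm]
    congr 1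
    · rw [Finset.sum_eq_single_of_mem i (by simp [hi])]
      · simp [hnji]
      · intro c hc hci
        rw [hjc c (by simpa using hc) hci, zero_smul]
    · rw [Finset.sum_filter]
      refine Finset.sum_congr rfl fun l _ ↦ ?_
      split_ifs <;> simp
  refine ⟨j, hjF, fun l ↦ if l ∈ F then n j l else 0, fun l hl ↦ by simp [hl], ?_⟩
  have h4 : τ (∑ l, (if l ∈ F then n j l else 0) • b l) =
      ∑ l, (if l ∈ F then n j l else 0) • b l := by
    rw [map_sum]
    refine Finset.sum_congr rfl fun l _ ↦ ?_
    split_ifs with h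
    · rw [map_nsmul, hF l h]
    · simp
  have h5 := congrArg τ key
  rw [map_neg, hτ, map_add, h4] at h5
  rw [← neg_neg (b j), h5]
  abel

end Involution

/-! ### The action of the involution on roots, coroots and simple roots -/

namespace SymmetricDatum

variable {k L : Type*} [Field k] [IsAlgClosed k] [CharZero k]
  [LieRing L] [LieAlgebra k L] [FiniteDimensional k L] [LieAlgebra.IsSemisimple k L]
  (D : SymmetricDatum k L)

lemma coe_σH (x : D.H) : (D.σH x : L) = D.σ x := rfl

@[simp] lemma σH_σH (x : D.H) : D.σH (D.σH x) = x := Subtype.ext (D.σ_σ x)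

lemma σDual_apply (lam : Dual k D.H) (x : D.H) : D.σDual lam x = lam (D.σH x) := rfl

@[simp] lemma σDual_σDual (lam : Dual k D.H) : D.σDual (D.σDual lam) = lam := by
  ext x; simp [σDual_apply]

lemma cartanEquivDual_σH (x y : D.H) :
    cartanEquivDual D.H (D.σH x) (D.σH y) = cartanEquivDual D.H x y := by
  have h : ∀ x y : D.H, cartanEquivDual D.H x y = killingForm k L x y := fun x y ↦ by
    rw [cartanEquivDual_apply_apply]; rfl
  rw [h, h, coe_σH, coe_σH, killingForm_of_equiv_apply]

lemma cartanEquivDual_symm_σDual (lam : Dual k D.H) :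
    (cartanEquivDual D.H).symm (D.σDual lam) = D.σH ((cartanEquivDual D.H).symm lam) := by
  rw [LinearEquiv.symm_apply_eq]
  ext y
  rw [σDual_apply]
  conv_rhs => rw [← D.σH_σH y, cartanEquivDual_σH, LinearEquiv.apply_symm_apply]

lemma κ_comm (lam mu : Dual k D.H) : D.κ lam mu = D.κ mu lam := by
  have h : ∀ x y : D.H, cartanEquivDual D.H x y = cartanEquivDual D.H y x := fun x y ↦ by
    rw [cartanEquivDual_apply_apply, cartanEquivDual_apply_apply]
    exact LieModule.traceForm_comm k D.H L x y
  rw [κ, κ]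
  conv_lhs => rw [← (cartanEquivDual D.H).apply_symm_apply lam, h, LinearEquiv.apply_symm_apply]

lemma κ_σDual (lam mu : Dual k D.H) : D.κ (D.σDual lam) (D.σDual mu) = D.κ lam mu := by
  rw [κ, cartanEquivDual_symm_σDual, σDual_apply, σH_σH, κ]

lemma κ_sub_left (a b c : Dual k D.H) : D.κ (a - b) c = D.κ a c - D.κ b c := rfl
lemma κ_neg_left (a b : Dual k D.H) : D.κ (-a) b = -D.κ a b := rfl
lemma κ_sub_right (a b c : Dual k D.H) : D.κ a (b - c) = D.κ a b - D.κ a c := by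
  simp [κ]

lemma apply_check (lam mu : Dual k D.H) : lam (D.check mu) = 2 * D.κ lam mu / D.κ mu mu := by
  simp [check, κ]; ring

lemma κ_root_self_ne_zero (α : D.H.root) : D.κ (D.root α) (D.root α) ≠ 0 := by
  have : (α : LieModule.Weight k D.H L).IsNonZero := LieSubalgebra.isNonZero_coe_root α
  exact root_apply_cartanEquivDual_symm_ne_zero this

lemma check_root (α : D.H.root) : D.check (D.root α) = (rootSystem D.H).coroot α := by
  rw [rootSystem_coroot_apply, coroot, check, κ, div_eq_mul_inv, mul_smul, ofNat_smul_eq_nsmul]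
  rfl

lemma apply_coroot (lam : Dual k D.H) (α : D.H.root) :
    lam ((rootSystem D.H).coroot α) = 2 * D.κ lam (D.root α) / D.κ (D.root α) (D.root α) := by
  rw [← check_root, apply_check]

lemma root_coroot_two (α : D.H.root) : D.root α ((rootSystem D.H).coroot α) = 2 := by
  rw [apply_coroot, mul_div_assoc, div_self (D.κ_root_self_ne_zero α), mul_one]

/-- The Cartan integers. -/
abbrev cartanInt (α β : D.H.root) : ℤ := (rootSystem D.H).pairingIn ℤ α β

lemma root_coroot (α β : D.H.root) :
    D.root α ((rootSystem D.H).coroot β) = (D.cartanInt α β : k) := by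
  have := (rootSystem D.H).algebraMap_pairingIn ℤ α β
  rw [← RootPairing.root_coroot_eq_pairing] at this
  exact (eq_intCast (algebraMap ℤ k) _ ▸ this).symm

lemma exists_root_eq_neg (α : D.H.root) : ∃ β : D.H.root, D.root β = -D.root α :=
  ⟨(rootSystem D.H).reflectionPerm α α, by simp only [root, RootPairing.root_reflectionPerm, RootPairing.reflection_apply_self]⟩

lemma isPos_or_exists_neg (α : D.H.root) :
    D.base.IsPos α ∨ ∃ β, D.base.IsPos β ∧ D.root β = -D.root α := by
  rcases RootPairing.Base.IsPos.or_neg D.base α with h | h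
  · exact Or.inl h
  · exact Or.inr ⟨_, h, by
      rw [root, RootPairing.indexNeg_neg, RootPairing.root_reflectionPerm,
        RootPairing.reflection_apply_self]; rfl⟩

lemma pos_cases {α : D.H.root} (hα : D.base.IsPos α) :
    D.σDual (D.root α) = D.root α ∨
      ∃ β, D.base.IsPos β ∧ D.σDual (D.root α) = -D.root β := by
  rcases D.pos α hα with h | ⟨β, hβ, h⟩
  · exact Or.inl (LinearMap.ext h)
  · exact Or.inr ⟨β, hβ, LinearMap.ext h⟩

/-- The compatibility of `σ` with positivity already contains this for positive roots; negation
gives the rest, without any argument on root spaces. -/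
lemma exists_root_eq_σDual (α : D.H.root) : ∃ β : D.H.root, D.root β = D.σDual (D.root α) := by
  have key : ∀ α, D.base.IsPos α → ∃ β : D.H.root, D.root β = D.σDual (D.root α) := by
    intro α hα
    rcases D.pos_cases hα with h | ⟨β, -, h⟩
    · exact ⟨α, h.symm⟩
    · rw [h]; exact D.exists_root_eq_neg β
  rcases D.isPos_or_exists_neg α with h | ⟨β, hβ, h⟩
  · exact key α h
  · obtain ⟨γ, hγ⟩ := key β hβ
    obtain ⟨δ, hδ⟩ := D.exists_root_eq_neg γ
    exact ⟨δ, by rw [hδ, hγ, h, map_neg, neg_neg]⟩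

lemma toWeightBasis_eq (a : D.base.support) : D.base.toWeightBasis a = D.root a :=
  D.base.toWeightBasis_apply a

lemma exists_nat_of_isPos {α : D.H.root} (hα : D.base.IsPos α) :
    ∃ n : D.base.support → ℕ, D.root α = ∑ a, n a • D.root a := by
  obtain ⟨f, -, h | h⟩ := D.base.exists_root_eq_sum_nat_or_neg α
  · refine ⟨fun a ↦ f a, ?_⟩
    rw [Finset.sum_coe_sort D.base.support (fun a ↦ f a • D.root a)]
    exact h
  · exfalso
    have h' : (rootSystem D.H).root α =
        ∑ j ∈ D.base.support, (fun j ↦ -(f j : ℤ)) j • (rootSystem D.H).root j := by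
      rw [h]; simp
    have h2 := D.base.height_eq_sum h'
    rw [RootPairing.Base.isPos_iff, h2] at hα
    exact absurd hα (not_lt.mpr (Finset.sum_nonpos fun i _ ↦ by simp))

/-- For a non-fixed simple root `α`, `-σ(α)` is a positive root, so its coefficients are natural
numbers and the lemma on involutions applies. The resulting assignment of `b` to `a` is the
involution of the Satake diagram. -/
lemma exists_fold {a : D.base.support} (ha : D.σDual (D.root a) ≠ D.root a) :
    ∃ b : D.base.support, D.σDual (D.root b) ≠ D.root b ∧ ∃ m : D.base.support → ℕ,
      (∀ c : D.base.support, D.σDual (D.root c) ≠ D.root c → m c = 0) ∧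
      -D.σDual (D.root a) = D.root b + ∑ c, m c • D.root c := by
  have := exists_neg_eq_add_of_involution D.base.toWeightBasis D.σDual D.σDual_σDual
    {c | D.σDual (D.root c) = D.root c}
    (fun i hi ↦ by rw [toWeightBasis_eq]; exact hi)
    (fun i hi ↦ by
      simp only [toWeightBasis_eq]
      rcases D.pos_cases (RootPairing.Base.isPos_of_mem_support i.2) with h | ⟨β, hβ, h⟩
      · exact absurd h hi
      · rw [h, neg_neg]; exact D.exists_nat_of_isPos hβ)
    (i := a) ha
  simp only [toWeightBasis_eq] at this
  exact this

/-- `α - σ(α)`. -/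
def tilde (α : D.H.root) : Dual k D.H := D.root α - D.σDual (D.root α)

lemma σDual_tilde (α : D.H.root) : D.σDual (D.tilde α) = -D.tilde α := by
  simp [tilde]

lemma mem_simpleRestricted {lam : Dual k D.H} : lam ∈ D.simpleRestricted ↔
    ∃ a : D.base.support, D.σDual (D.root a) ≠ D.root a ∧ D.tilde a = lam := by
  classical
  simp only [simpleRestricted, Finset.mem_image, Finset.mem_filter]
  constructor
  · rintro ⟨a, ⟨h1, h2⟩, h3⟩
    exact ⟨⟨a, h1⟩, h2, h3⟩
  · rintro ⟨a, h2, h3⟩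
    exact ⟨a, ⟨a.2, h2⟩, h3⟩

lemma sum_smul_root_injective {n m : D.base.support → ℕ}
    (h : ∑ c, n c • D.root c = ∑ c, m c • D.root c) : n = m := by
  classical
  ext c
  have := congrArg (fun x ↦ D.base.toWeightBasis.repr x c) h
  simp only [← toWeightBasis_eq, map_sum, map_nsmul, Basis.repr_self, Finsupp.coe_finsetSum,
    Finset.sum_apply, Finsupp.coe_smul, Pi.smul_apply, Finsupp.single_apply] at this
  simpa using this

/-- The restricted root is `α_a + α_b` plus fixed simple roots, where `b` is the partner of `a` and
has the same restriction. The factor `2` in the last clause counts `a` and `b`, also when they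
coincide. -/
lemma exists_tilde_eq_sum_aux {a : D.base.support} (ha : D.σDual (D.root a) ≠ D.root a) :
    ∃ n : D.base.support → ℕ, D.tilde a = ∑ c, n c • D.root c ∧ 0 < n a ∧
      (∀ c : D.base.support, D.σDual (D.root c) ≠ D.root c → D.tilde c ≠ D.tilde a → n c = 0) ∧
      ∀ f : D.base.support → k, (∀ c : D.base.support, D.σDual (D.root c) = D.root c → f c = 0) →
        (∀ c : D.base.support, D.tilde c = D.tilde a → f c = f a) → ∑ c, n c * f c = 2 * f a := by
  classical
  obtain ⟨b, hb, m, hm, h⟩ := D.exists_fold ha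
  have hfix : D.σDual (∑ c, m c • D.root c) = ∑ c, m c • D.root c := by
    rw [map_sum]
    refine Finset.sum_congr rfl fun c _ ↦ ?_
    by_cases hc : D.σDual (D.root c) = D.root c
    · rw [map_nsmul, hc]
    · rw [hm c hc, zero_smul, map_zero]
  have hab : D.tilde b = D.tilde a := by
    have h2 := congrArg D.σDual h
    rw [map_neg, σDual_σDual, map_add, hfix] at h2
    rw [tilde, tilde, sub_eq_add_neg (D.root a), h, ← neg_neg (D.root a), h2]
    abel
  refine ⟨fun c ↦ (if c = a then 1 else 0) + (if c = b then 1 else 0) + m c, ?_, ?_, ?_, ?_⟩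
  · rw [tilde, sub_eq_add_neg, h]
    simp [add_smul, Finset.sum_add_distrib, add_assoc]
  · simp
  · intro c hc hca
    have h1 : c ≠ a := by rintro rfl; exact hca rfl
    have h2 : c ≠ b := by rintro rfl; exact hca hab
    simp [h1, h2, hm c hc]
  · intro f hf hfa
    have hmf : ∀ c, (m c : k) * f c = 0 := by
      intro c
      by_cases hc : D.σDual (D.root c) = D.root c
      · rw [hf c hc, mul_zero]
      · rw [hm c hc, Nat.cast_zero, zero_mul]
    simp [add_mul, Finset.sum_add_distrib, hmf, hfa b hab, two_mul]

/-- A simple restricted root is a nonnegative combination of the simple roots. -/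
lemma exists_tilde_eq_sum (s : D.simpleRestricted) :
    ∃ n : D.base.support → ℕ, s.1 = ∑ c, n c • D.root c ∧
      (∀ c : D.base.support, D.σDual (D.root c) ≠ D.root c →
        (D.tilde c = s.1 → 0 < n c) ∧ (D.tilde c ≠ s.1 → n c = 0)) ∧
      ∀ f : D.base.support → k, (∀ c : D.base.support, D.σDual (D.root c) = D.root c → f c = 0) →
        ∀ v, (∀ c : D.base.support, D.tilde c = s.1 → f c = v) → ∑ c, n c * f c = 2 * v := by
  obtain ⟨a, ha, has⟩ := D.mem_simpleRestricted.mp s.2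
  obtain ⟨n, hn, -, hn0, hf⟩ := D.exists_tilde_eq_sum_aux ha
  refine ⟨n, has ▸ hn, fun c hc ↦ ⟨fun h ↦ ?_, fun h ↦ hn0 c hc (has ▸ h)⟩, fun f hf0 v hv ↦ ?_⟩
  swap
  · rw [hf f hf0 fun c hc ↦ by rw [hv c (hc.trans has), hv a has], hv a has]
  -- Any simple root with the same restriction may be used to write it, and the coefficients are
  -- unique; so each of them occurs with a positive coefficient.
  obtain ⟨n', hn', hpos, -, -⟩ := D.exists_tilde_eq_sum_aux hc
  rw [D.sum_smul_root_injective (hn.symm.trans ((has.trans h.symm).trans hn'))]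
  exact hpos

/-! ### Anti-invariant weights -/

lemma κ_eq_zero_of_fixed {lam mu : Dual k D.H} (h : D.σDual lam = -lam) (h' : D.σDual mu = mu) :
    D.κ lam mu = 0 := by
  have := D.κ_σDual lam mu
  rw [h, h', κ_neg_left] at this
  exact self_eq_neg.mp this.symm

lemma apply_coroot_eq_zero_of_fixed {lam : Dual k D.H} (h : D.σDual lam = -lam) {α : D.H.root}
    (h' : D.σDual (D.root α) = D.root α) : lam ((rootSystem D.H).coroot α) = 0 := by
  rw [apply_coroot, D.κ_eq_zero_of_fixed h h', mul_zero, zero_div]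

lemma κ_tilde_right {lam : Dual k D.H} (h : D.σDual lam = -lam) (α : D.H.root) :
    D.κ lam (D.tilde α) = 2 * D.κ lam (D.root α) := by
  have h1 := D.κ_σDual lam (D.σDual (D.root α))
  rw [h, σDual_σDual, κ_neg_left] at h1
  rw [tilde, κ_sub_right, ← h1]
  ring

lemma two_mul_κ_σDual (α : D.H.root) : 2 * D.κ (D.σDual (D.root α)) (D.root α) =
    D.σDual (D.root α) ((rootSystem D.H).coroot α) * D.κ (D.root α) (D.root α) := by
  rw [apply_coroot]
  field_simp [D.κ_root_self_ne_zero α]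

lemma κ_tilde_self (α : D.H.root) : D.κ (D.tilde α) (D.tilde α) =
    (2 - D.σDual (D.root α) ((rootSystem D.H).coroot α)) * D.κ (D.root α) (D.root α) := by
  rw [D.κ_tilde_right (D.σDual_tilde α), tilde, κ_sub_left, mul_sub, two_mul_κ_σDual]
  ring

/-- On anti-invariant weights, the coroot of `α` is proportional to that of `α - σ(α)`. -/
lemma apply_coroot_eq {lam : Dual k D.H} (h : D.σDual lam = -lam) {α : D.H.root}
    (hα : D.σDual (D.root α) ((rootSystem D.H).coroot α) ≠ 2) :
    lam ((rootSystem D.H).coroot α) =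
      (2 - D.σDual (D.root α) ((rootSystem D.H).coroot α)) / 2 * lam (D.check (D.tilde α)) := by
  rw [apply_check, D.κ_tilde_right h, κ_tilde_self, apply_coroot D lam]
  have h1 := D.κ_root_self_ne_zero α
  have h2 := sub_ne_zero.mpr hα.symm
  field_simp

/-- The possible values of `⟨σ(α), α^∨⟩`. -/
lemma σDual_coroot_cases {α : D.H.root} (hα : D.σDual (D.root α) ≠ D.root α) :
    D.σDual (D.root α) ((rootSystem D.H).coroot α) = 0 ∨
    D.σDual (D.root α) ((rootSystem D.H).coroot α) = 1 ∨
    D.σDual (D.root α) ((rootSystem D.H).coroot α) = -1 ∨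
    D.σDual (D.root α) = -D.root α := by
  obtain ⟨β, hβ⟩ := D.exists_root_eq_σDual α
  -- `σ` preserves lengths, so the two Cartan integers of `α` and `σ(α)` agree. This leaves `-2, …,
  -- 2`, with `2` only for equal and `-2` only for opposite roots.
  have hsymm : D.cartanInt β α = D.cartanInt α β := by
    have h : D.root β ((rootSystem D.H).coroot α) = D.root α ((rootSystem D.H).coroot β) := by
      have h1 : D.κ (D.root β) (D.root β) = D.κ (D.root α) (D.root α) := by
        rw [hβ, κ_σDual]
      rw [apply_coroot, apply_coroot, h1, κ_comm]
    rw [root_coroot, root_coroot] at h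
    exact_mod_cast h
  have hmem := (rootSystem D.H).pairingIn_pairingIn_mem_set_of_isCrystal_of_isRed β α
  have hsymm' : (rootSystem D.H).pairingIn ℤ α β = (rootSystem D.H).pairingIn ℤ β α := hsymm.symm
  rw [hsymm'] at hmem
  rw [← hβ, root_coroot, cartanInt]
  simp only [Set.mem_insert_iff, Set.mem_singleton_iff, Prod.mk.injEq] at hmem
  have h2 : (rootSystem D.H).pairingIn ℤ β α ≠ 2 := by
    intro h
    have := (RootPairing.pairingIn_two_two_iff (rootSystem D.H) ℤ β α).mp ⟨h, hsymm' ▸ h⟩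
    exact hα (by rw [← hβ, this])
  have h3 : (rootSystem D.H).pairingIn ℤ β α = -2 → D.root β = -D.root α := by
    intro h
    exact (RootPairing.pairingIn_neg_two_neg_two_iff (rootSystem D.H) ℤ β α).mp ⟨h, hsymm' ▸ h⟩
  have h4 : (rootSystem D.H).pairingIn ℤ β α = 0 ∨ (rootSystem D.H).pairingIn ℤ β α = 1 ∨
      (rootSystem D.H).pairingIn ℤ β α = -1 ∨ (rootSystem D.H).pairingIn ℤ β α = -2 := by
    omega
  rcases h4 with h | h | h | h
  · simp [h]
  · simp [h]
  · simp [h]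
  · exact Or.inr (Or.inr (Or.inr (h3 h)))

end SymmetricDatum

/-! ### Cayley transforms and maximal splitness -/

section Cayley

variable {k L : Type*} [Field k] [CharZero k] [LieRing L] [LieAlgebra k L]

lemma isCartanSubalgebra_map (τ : L ≃ₗ⁅k⁆ L) (H : LieSubalgebra k L) [H.IsCartanSubalgebra] :
    (H.map (τ : L →ₗ⁅k⁆ L)).IsCartanSubalgebra where
  nilpotent := (τ.lieSubalgebraMap H).nilpotent_iff_equiv_nilpotent.mp inferInstance
  self_normalizing := by
    refine le_antisymm (fun x hx ↦ ?_) (LieSubalgebra.le_normalizer _)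
    rw [LieSubalgebra.mem_normalizer_iff] at hx
    refine ⟨τ.symm x, ?_, τ.apply_symm_apply x⟩
    have : τ.symm x ∈ H.normalizer := by
      rw [LieSubalgebra.mem_normalizer_iff]
      intro y hy
      obtain ⟨z, hz, hzy⟩ := hx (τ y) ⟨y, hy, rfl⟩
      have : z = ⁅τ.symm x, y⁆ := by
        refine τ.injective ((show τ z = ⁅x, τ y⁆ from hzy).trans ?_)
        change _ = τ ⁅τ.symm x, y⁆
        rw [LieEquiv.map_lie, LieEquiv.apply_symm_apply]
      exact this ▸ hz
    rw [LieSubalgebra.IsCartanSubalgebra.self_normalizing] at this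
    exact this

/-- The exponential of a nilpotent inner derivation. -/
lemma exists_exp_ad {x : L} (hx : IsNilpotent (ad k L x)) :
    ∃ τ : L ≃ₗ⁅k⁆ L, (∀ y, ⁅x, y⁆ = 0 → τ y = y) ∧
      (∀ y, ⁅x, ⁅x, y⁆⁆ = 0 → τ y = y + ⁅x, y⁆) ∧
      ∀ y, ⁅x, ⁅x, ⁅x, y⁆⁆⁆ = 0 → τ y = y + ⁅x, y⁆ + (2⁻¹ : k) • ⁅x, ⁅x, y⁆⁆ := by
  -- The exponential of a derivation is formed over the rationals, so the scalars of `L` are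
  -- restricted along `ℚ → k`; the coefficient `1/2` is transported back at the end.
  let : Module ℚ L := Module.compHom L (algebraMap ℚ k)
  let : LieAlgebra ℚ L := { lie_smul := fun q x y ↦ lie_smul (algebraMap ℚ k q) x y }
  have hD : IsNilpotent (LieDerivation.ad k L x).toLinearMap := by
    have : (LieDerivation.ad k L x).toLinearMap = ad k L x := by ext; simp
    rwa [this]
  have h3 : ∀ y, ⁅x, ⁅x, ⁅x, y⁆⁆⁆ = 0 →
      LieDerivation.exp (LieDerivation.ad k L x) hD y =
        y + ⁅x, y⁆ + (2⁻¹ : k) • ⁅x, ⁅x, y⁆⁆ := by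
    intro y hy
    rw [LieDerivation.exp_map_apply]
    have := IsNilpotent.exp_smul_eq_sum (A := Module.End k L) (M := L)
      (a := (LieDerivation.ad k L x).toLinearMap) (m := y) (k := 3)
      (by simpa [pow_succ] using hy) hD
    rw [Module.End.smul_def] at this
    rw [this]
    simp [Finset.sum_range_succ, pow_succ, Nat.factorial]
    change algebraMap ℚ k 2⁻¹ • ⁅x, ⁅x, y⁆⁆ = _
    rw [map_inv₀, map_ofNat]
  refine ⟨LieDerivation.exp (LieDerivation.ad k L x) hD, fun y hy ↦ ?_, fun y hy ↦ ?_, h3⟩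
  · rw [h3 y (by simp [hy])]; simp [hy]
  · rw [h3 y (by simp [hy])]; simp [hy]

/-- The Cayley transform attached to an `sl₂`-triple. -/
lemma exists_cayley {h e f : L} (t : IsSl2Triple h e f) (he : IsNilpotent (ad k L e))
    (hf : IsNilpotent (ad k L f)) :
    ∃ τ : L ≃ₗ⁅k⁆ L, τ h = e + f ∧ ∀ y, ⁅e, y⁆ = 0 → ⁅f, y⁆ = 0 → τ y = y := by
  have he' : IsNilpotent (ad k L ((-2⁻¹ : k) • e)) := by
    rw [map_smul]; exact he.smul _
  obtain ⟨τ₁, h10, h11, h12⟩ := exists_exp_ad he'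
  obtain ⟨τ₂, h20, h21, h22⟩ := exists_exp_ad hf
  -- The first factor `exp(ad(-e/2))` sends `h` to `h + e`. The second, `exp(ad f)`, sends `h` to `h
  -- + 2f` and `e` to `e - h - f`, so the sum becomes `e + f`.
  refine ⟨τ₁.trans τ₂, ?_, fun y hy hy' ↦ ?_⟩
  · have heh : ⁅e, h⁆ = -((2 : k) • e) := by rw [← lie_skew, t.lie_h_e_smul k]
    have hfh : ⁅f, h⁆ = (2 : k) • f := by rw [← lie_skew, t.lie_lie_smul_f k, neg_neg]
    have hfe : ⁅f, e⁆ = -h := by rw [← lie_skew, t.lie_e_f]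
    rw [LieEquiv.trans_apply, h11 h (by simp [heh]), map_add, h21 h (by simp [hfh])]
    have : ⁅(-2⁻¹ : k) • e, h⁆ = e := by
      rw [smul_lie, heh, smul_neg, neg_smul, neg_neg, smul_smul, inv_mul_cancel₀ two_ne_zero,
        one_smul]
    rw [this, h22 e (by simp [hfe, hfh])]
    rw [hfe, lie_neg, hfh, smul_neg, smul_smul, inv_mul_cancel₀ two_ne_zero, two_smul, one_smul]
    abel
  · rw [LieEquiv.trans_apply, h10 y (by simp [hy]), h20 y hy']

end Cayley

namespace SymmetricDatum

variable {k L : Type*} [Field k] [IsAlgClosed k] [CharZero k]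
  [LieRing L] [LieAlgebra k L] [FiniteDimensional k L] [LieAlgebra.IsSemisimple k L]
  (D : SymmetricDatum k L)

lemma lie_eq_smul {α : D.H.root} {x : L} (hx : x ∈ rootSpace D.H (α.1 : D.H → k)) (h : D.H) :
    ⁅(h : L), x⁆ = D.root α h • x :=
  lie_eq_smul_of_mem_rootSpace hx h

lemma mem_rootSpace_of_lie {χ : D.H → k} {x : L} (hx : ∀ h : D.H, ⁅(h : L), x⁆ = χ h • x) :
    x ∈ rootSpace D.H χ :=
  LieModule.weightSpace_le_genWeightSpace L χ ((LieModule.mem_weightSpace χ x).mpr hx)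

lemma lie_σ_eq_smul {α : D.H.root} {x : L} (hx : x ∈ rootSpace D.H (α.1 : D.H → k)) (h : D.H) :
    ⁅(h : L), D.σ x⁆ = D.σDual (D.root α) h • D.σ x := by
  rw [σDual_apply, ← map_smul, ← D.lie_eq_smul hx, coe_σH, LieEquiv.map_lie, D.σ_σ]

lemma σ_coroot {γ : D.H.root} (hγ : D.σDual (D.root γ) = D.root γ) :
    D.σH ((rootSystem D.H).coroot γ) = (rootSystem D.H).coroot γ := by
  rw [← check_root, check, map_smul, ← cartanEquivDual_symm_σDual, hγ]

lemma lie_H (x y : D.H) : ⁅(x : L), (y : L)⁆ = 0 := by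
  have := trivial_lie_zero D.H D.H x y
  simpa [Subtype.ext_iff] using this

/-- If a root is fixed by `σ`, then its root vectors are so: otherwise a Cayley transform would
increase the split part of the Cartan subalgebra. -/
lemma σ_ne_neg_of_fixed {γ : D.H.root} (hγ : D.σDual (D.root γ) = D.root γ) {e : L}
    (he : e ∈ rootSpace D.H (γ.1 : D.H → k)) (he0 : e ≠ 0) : D.σ e ≠ -e := by
  intro hσ
  have hγ0 : γ.1.IsNonZero := LieSubalgebra.isNonZero_coe_root γ
  obtain ⟨h, e₀, f₀, t₀, he₀, hf₀⟩ := exists_isSl2Triple_of_weight_isNonZero hγ0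
  have hh : h = (rootSystem D.H).coroot γ := t₀.h_eq_coroot hγ0 he₀ hf₀
  have hσe : D.σ e₀ = -e₀ := by
    obtain ⟨c, hc⟩ := (finrank_eq_one_iff_of_nonzero' (⟨e, he⟩ : rootSpace D.H (γ.1 : D.H → k))
      (by simpa [Subtype.ext_iff] using he0)).mp (finrank_rootSpace_eq_one γ.1 hγ0) ⟨e₀, he₀⟩
    have hc' : c • e = e₀ := congrArg Subtype.val hc
    rw [← hc', map_smul, hσ, smul_neg]
  have hσh : D.σ h = h := by rw [hh, ← coe_σH, D.σ_coroot hγ]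
  -- Projecting `f₀` to the `(-1)`-eigenspace keeps the triple, as `σ` negates `e₀` and fixes `h`.
  -- The new Cartan subalgebra, spanned by the kernel of `γ` and `e₀ + f`, is then `σ`-stable.
  set f : L := (2⁻¹ : k) • (f₀ - D.σ f₀) with hf
  have hσf : D.σ f = -f := by
    rw [hf, map_smul, map_sub, D.σ_σ, ← smul_neg, neg_sub]
  have h2 : (2⁻¹ : k) • (2 : k) • h = h := by
    rw [smul_smul, inv_mul_cancel₀ two_ne_zero, one_smul]
  have hef' : ⁅e₀, D.σ f₀⁆ = -h := by
    have : D.σ ⁅e₀, f₀⁆ = -⁅e₀, D.σ f₀⁆ := by rw [LieEquiv.map_lie, hσe, neg_lie]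
    rw [t₀.lie_e_f, hσh] at this
    rw [this, neg_neg]
  have hfx : ∀ x : D.H, ⁅(x : L), f⁆ = (-D.root γ x) • f := by
    intro x
    have h1 : ∀ y : D.H, ⁅(y : L), f₀⁆ = (-D.root γ y) • f₀ := fun y ↦
      lie_eq_smul_of_mem_rootSpace hf₀ y
    have h3 : ⁅(x : L), D.σ f₀⁆ = (-D.root γ x) • D.σ f₀ := by
      have := congrArg D.σ (h1 (D.σH x))
      rw [LieEquiv.map_lie, coe_σH, D.σ_σ, map_smul, ← σDual_apply, hγ] at this
      exact this
    rw [hf, lie_smul, lie_sub, h1, h3, ← smul_sub, smul_comm]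
  have t : IsSl2Triple h e₀ f :=
    { h_ne_zero := t₀.h_ne_zero
      lie_e_f := by
        rw [hf, lie_smul, lie_sub, t₀.lie_e_f, hef', sub_neg_eq_add, ← two_smul k h, h2]
      lie_h_e_nsmul := t₀.lie_h_e_nsmul
      lie_h_f_nsmul := by
        have := hfx ((rootSystem D.H).coroot γ)
        rw [← hh, root_coroot_two] at this
        rw [this, neg_smul, ofNat_smul_eq_nsmul] }
  have hfmem : f ∈ rootSpace D.H (-(γ.1 : D.H → k)) := D.mem_rootSpace_of_lie hfx
  have hγne : (γ.1 : D.H → k) ≠ 0 := hγ0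
  obtain ⟨τ, hτh, hτ⟩ := exists_cayley t (isNilpotent_ad_of_mem_rootSpace D.H hγne he₀)
    (isNilpotent_ad_of_mem_rootSpace D.H (neg_ne_zero.mpr hγne) hfmem)
  have hτ' : ∀ x : D.H, D.root γ x = 0 → τ x = x := by
    intro x hx
    refine hτ x ?_ ?_
    · rw [← lie_skew, D.lie_eq_smul he₀, hx, zero_smul, neg_zero]
    · rw [← lie_skew, hfx, hx, neg_zero, zero_smul, neg_zero]
  have hτx : ∀ x : D.H, ∃ x₀ : D.H, ∃ c : k, D.root γ x₀ = 0 ∧ (x : L) = x₀ + c • h := by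
    intro x
    refine ⟨x - (D.root γ x / 2) • (rootSystem D.H).coroot γ, D.root γ x / 2, ?_, ?_⟩
    · rw [map_sub, map_smul, root_coroot_two, smul_eq_mul, div_mul_cancel₀ _ two_ne_zero, sub_self]
    · rw [hh]; simp
  have := isCartanSubalgebra_map τ D.H
  have hmem : ∀ y, y ∈ D.H.map (τ : L →ₗ⁅k⁆ L) ↔ ∃ x ∈ D.H, τ x = y := fun y ↦ Iff.rfl
  have hhH : h ∈ D.H := by rw [hh]; exact Subtype.coe_prop _
  have hle := D.maxSplit (D.H.map (τ : L →ₗ⁅k⁆ L)) this (by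
    intro y hy
    obtain ⟨x, hx, rfl⟩ := (hmem y).mp hy
    obtain ⟨x₀, c, hx₀, hxe⟩ := hτx ⟨x, hx⟩
    replace hxe : x = x₀ + c • h := hxe
    refine (hmem _).mpr ⟨D.σH x₀ - c • h, D.H.sub_mem (Subtype.coe_prop _) (D.H.smul_mem _ hhH), ?_⟩
    have h1 : D.root γ (D.σH x₀) = 0 := by rw [← σDual_apply, hγ, hx₀]
    rw [hxe, map_sub, map_add, map_smul, hτh, hτ' _ h1, hτ' _ hx₀, map_add, map_smul, map_add, hσe,
      hσf, coe_σH, ← neg_add, smul_neg, sub_eq_add_neg])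
  -- The old split part lies in the kernel of `γ`, so it survives the transform. The new one
  -- contains `e₀ + f` besides, which does not commute with `h` and hence was not in the old Cartan
  -- subalgebra.
  refine absurd hle (not_le.mpr (Submodule.finrank_lt_finrank_of_lt ?_))
  have hanti : ∀ (H : LieSubalgebra k L) (x : L), x ∈ antiFixed D.σ H ↔ x ∈ H ∧ D.σ x = -x := by
    intro H x
    simp only [antiFixed, Submodule.mem_inf, LinearMap.mem_ker, LinearMap.add_apply,
      LinearMap.id_apply, add_eq_zero_iff_eq_neg]
    rfl
  refine lt_of_le_of_ne (fun x hx ↦ ?_) (fun heq ↦ ?_)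
  · rw [hanti] at hx ⊢
    refine ⟨(hmem x).mpr ⟨x, hx.1, hτ' ⟨x, hx.1⟩ ?_⟩, hx.2⟩
    have h1 : D.root γ (D.σH ⟨x, hx.1⟩) = D.root γ ⟨x, hx.1⟩ := by rw [← σDual_apply, hγ]
    have h3 : D.σH ⟨x, hx.1⟩ = -⟨x, hx.1⟩ := Subtype.ext hx.2
    rw [h3, map_neg] at h1
    exact self_eq_neg.mp h1.symm
  · have hefm : e₀ + f ∈ antiFixed D.σ D.H := by
      rw [heq, hanti]
      exact ⟨(hmem _).mpr ⟨h, hhH, hτh⟩, by rw [map_add, hσe, hσf, neg_add]⟩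
    have h0 := D.lie_H ⟨h, hhH⟩ ⟨e₀ + f, ((hanti _ _).mp hefm).1⟩
    change ⁅h, e₀ + f⁆ = 0 at h0
    rw [lie_add, t.lie_h_e_smul k, t.lie_lie_smul_f k, ← sub_eq_add_neg, ← smul_sub] at h0
    have h1 : e₀ - f = 0 := (smul_eq_zero.mp h0).resolve_left two_ne_zero
    have h3 : ⁅e₀, e₀ - f⁆ = 0 := by rw [h1, lie_zero]
    rw [lie_sub, lie_self, t.lie_e_f, zero_sub, neg_eq_zero] at h3
    exact t.h_ne_zero h3

/-- A root and its image under `σ` never span an angle of `2π/3`. -/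
lemma σDual_coroot_ne_neg_one (α : D.H.root) :
    D.σDual (D.root α) ((rootSystem D.H).coroot α) ≠ -1 := by
  intro hn
  obtain ⟨β, hβ⟩ := D.exists_root_eq_σDual α
  have hpair : (rootSystem D.H).pairingIn ℤ β α = -1 := by
    rw [← hβ, root_coroot] at hn
    exact_mod_cast hn
  have hne : (rootSystem D.H).root β ≠ -(rootSystem D.H).root α := by
    intro h
    have h1 : D.root β = -D.root α := h
    rw [← hβ, h1, LinearMap.neg_apply, root_coroot_two] at hn
    norm_num at hn
  obtain ⟨γ, hγ⟩ := (rootSystem D.H).root_add_root_mem_of_pairingIn_neg (i := β) (j := α)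
    (by omega) hne
  replace hγ : D.root γ = D.root β + D.root α := hγ
  have hγσ : D.σDual (D.root γ) = D.root γ := by
    rw [hγ, map_add, hβ, σDual_σDual, add_comm]
  have hα0 : α.1.IsNonZero := LieSubalgebra.isNonZero_coe_root α
  obtain ⟨h, e, f, t, he, hf⟩ := exists_isSl2Triple_of_weight_isNonZero hα0
  have hh : h = (rootSystem D.H).coroot α := t.h_eq_coroot hα0 he hf
  have hlie : ∀ x : D.H, ⁅(x : L), ⁅e, D.σ e⁆⁆ = D.root γ x • ⁅e, D.σ e⁆ := by
    intro x
    rw [leibniz_lie, D.lie_eq_smul he, D.lie_σ_eq_smul he, smul_lie, lie_smul, ← add_smul, hγ, hβ,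
      add_comm]
    rfl
  have hmem : ⁅e, D.σ e⁆ ∈ rootSpace D.H (γ.1 : D.H → k) := D.mem_rootSpace_of_lie hlie
  -- The bracket is a root vector for the fixed root `α + σ(α)` and is negated by `σ`, which is
  -- excluded if it is nonzero. If it vanished, `σ e` would be primitive of weight `-1`, impossible
  -- in finite dimension.
  by_cases h0 : ⁅e, D.σ e⁆ = 0
  · have hp : t.HasPrimitiveVectorWith (D.σ e) (-1 : k) :=
      { ne_zero := by
          intro h1
          exact t.e_ne_zero (by rw [← D.σ_σ e, h1, map_zero])
        lie_h := by rw [hh, D.lie_σ_eq_smul he, hn]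
        lie_e := h0 }
    obtain ⟨n, hn⟩ := hp.exists_nat
    have : ((n + 1 : ℕ) : k) = 0 := by push_cast; rw [← hn]; ring
    exact absurd (Nat.cast_eq_zero.mp this) (by omega)
  · refine D.σ_ne_neg_of_fixed hγσ hmem h0 ?_
    rw [LieEquiv.map_lie, D.σ_σ, lie_skew]

end SymmetricDatum

/-! ### Comparison with restricted coroots, and the folding of the extended matrix -/

namespace SymmetricDatum

variable {k L : Type*} [Field k] [IsAlgClosed k] [CharZero k]
  [LieRing L] [LieAlgebra k L] [FiniteDimensional k L] [LieAlgebra.IsSemisimple k L]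
  (D : SymmetricDatum k L)

/-- On anti-invariant weights the coroot of a non-fixed root is a positive rational multiple of the
restricted coroot, and the restricted roots have integral values on the latter. -/
lemma exists_coroot_ratio {α : D.H.root} (hα : D.σDual (D.root α) ≠ D.root α) :
    ∃ c : ℚ, 0 < c ∧ (∀ lam : Dual k D.H, D.σDual lam = -lam →
        lam ((rootSystem D.H).coroot α) = (c : k) * lam (D.check (D.tilde α))) ∧
      ∀ β : D.H.root, ∃ z : ℤ, D.tilde β (D.check (D.tilde α)) = z := by
  have hint : ∀ β : D.H.root, ∃ z : ℤ, D.tilde β ((rootSystem D.H).coroot α) = z := by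
    intro β
    obtain ⟨γ, hγ⟩ := D.exists_root_eq_σDual β
    refine ⟨D.cartanInt β α - D.cartanInt γ α, ?_⟩
    rw [tilde, ← hγ, LinearMap.sub_apply, root_coroot, root_coroot, Int.cast_sub]
  -- The ratio is `(2 - ⟨σ(α), α^∨⟩) / 2`, that is `1`, `1/2` or `2`; the value `3/2`, belonging to
  -- the excluded pairing `-1`, would break integrality.
  rcases D.σDual_coroot_cases hα with h | h | h | h
  · have key : ∀ lam : Dual k D.H, D.σDual lam = -lam →
        lam ((rootSystem D.H).coroot α) = lam (D.check (D.tilde α)) := by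
      intro lam hlam
      rw [D.apply_coroot_eq hlam (by rw [h]; norm_num), h, sub_zero, div_self two_ne_zero, one_mul]
    refine ⟨1, one_pos, fun lam hlam ↦ by rw [key lam hlam]; simp, fun β ↦ ?_⟩
    rw [← key _ (D.σDual_tilde β)]
    exact hint β
  · have key : ∀ lam : Dual k D.H, D.σDual lam = -lam →
        lam ((rootSystem D.H).coroot α) = 1 / 2 * lam (D.check (D.tilde α)) := by
      intro lam hlam
      rw [D.apply_coroot_eq hlam (by rw [h]; norm_num), h]
      norm_num
    refine ⟨1 / 2, by norm_num, fun lam hlam ↦ by rw [key lam hlam]; norm_num, fun β ↦ ?_⟩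
    obtain ⟨z, hz⟩ := hint β
    refine ⟨2 * z, ?_⟩
    have := key _ (D.σDual_tilde β)
    rw [hz] at this
    push_cast
    rw [this]
    ring
  · exact absurd h (D.σDual_coroot_ne_neg_one α)
  · have h2 : D.σDual (D.root α) ((rootSystem D.H).coroot α) = -2 := by
      rw [h, LinearMap.neg_apply, root_coroot_two]
    have key : ∀ lam : Dual k D.H, D.σDual lam = -lam →
        lam ((rootSystem D.H).coroot α) = 2 * lam (D.check (D.tilde α)) := by
      intro lam hlam
      rw [D.apply_coroot_eq hlam (by rw [h2]; norm_num), h2]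
      norm_num
    refine ⟨2, by norm_num, fun lam hlam ↦ by rw [key lam hlam]; norm_num, fun β ↦ ?_⟩
    -- Here `α̃ = 2α`, so the restricted coroot is half of the coroot; but `β - σ(β)` takes the even
    -- value `2 ⟨β, α^∨⟩` on the latter.
    refine ⟨D.cartanInt β α, ?_⟩
    have h3 : D.σDual (D.root β) ((rootSystem D.H).coroot α) =
        -D.root β ((rootSystem D.H).coroot α) := by
      have := D.κ_σDual (D.root β) (D.root α)
      rw [h] at this
      rw [apply_coroot, apply_coroot, ← this]
      simp only [κ, map_neg, mul_neg, neg_div, neg_neg]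
    have h4 := key _ (D.σDual_tilde β)
    rw [tilde, LinearMap.sub_apply, h3, sub_neg_eq_add, ← two_mul] at h4
    rw [← root_coroot, mul_left_cancel₀ two_ne_zero h4]
    rfl

/-- The ratio between the coroot of a root and the restricted coroot. -/
def corootRatio (α : D.H.root) : ℚ :=
  open Classical in
  if hα : D.σDual (D.root α) ≠ D.root α then (D.exists_coroot_ratio hα).choose else 1

lemma corootRatio_pos (α : D.H.root) : 0 < D.corootRatio α := by
  rw [corootRatio]
  split_ifs with h
  · exact (D.exists_coroot_ratio h).choose_spec.1
  · exact one_pos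

lemma apply_coroot_eq_corootRatio_mul {α : D.H.root} (hα : D.σDual (D.root α) ≠ D.root α)
    {lam : Dual k D.H} (hlam : D.σDual lam = -lam) :
    lam ((rootSystem D.H).coroot α) = (D.corootRatio α : k) * lam (D.check (D.tilde α)) := by
  rw [corootRatio, dif_pos hα]
  exact (D.exists_coroot_ratio hα).choose_spec.2.1 lam hlam

lemma κ_tilde_self_ne_zero {α : D.H.root} (hα : D.σDual (D.root α) ≠ D.root α) :
    D.κ (D.tilde α) (D.tilde α) ≠ 0 := by
  rw [κ_tilde_self]
  refine mul_ne_zero (fun h ↦ ?_) (D.κ_root_self_ne_zero α)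
  rw [sub_eq_zero] at h
  rcases D.σDual_coroot_cases hα with h1 | h1 | h1 | h1
  · rw [h1] at h; norm_num at h
  · rw [h1] at h; norm_num at h
  · rw [h1] at h; norm_num at h
  · rw [h1, LinearMap.neg_apply, root_coroot_two] at h; norm_num at h

lemma tilde_check_self {α : D.H.root} (hα : D.σDual (D.root α) ≠ D.root α) :
    D.tilde α (D.check (D.tilde α)) = 2 := by
  rw [apply_check, mul_div_assoc, div_self (D.κ_tilde_self_ne_zero hα), mul_one]

/-- The coefficients of a simple restricted root in terms of the simple roots. -/
def restrictedCoeff (s : D.simpleRestricted) : D.base.support → ℕ :=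
  (D.exists_tilde_eq_sum s).choose

lemma eq_sum_restrictedCoeff (s : D.simpleRestricted) :
    s.1 = ∑ c, D.restrictedCoeff s c • D.root c :=
  (D.exists_tilde_eq_sum s).choose_spec.1

lemma restrictedCoeff_pos {s : D.simpleRestricted} {c : D.base.support}
    (hc : D.σDual (D.root c) ≠ D.root c) (h : D.tilde c = s.1) : 0 < D.restrictedCoeff s c :=
  ((D.exists_tilde_eq_sum s).choose_spec.2.1 c hc).1 h

lemma restrictedCoeff_eq_zero {s : D.simpleRestricted} {c : D.base.support}
    (hc : D.σDual (D.root c) ≠ D.root c) (h : D.tilde c ≠ s.1) : D.restrictedCoeff s c = 0 :=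
  ((D.exists_tilde_eq_sum s).choose_spec.2.1 c hc).2 h

lemma sum_restrictedCoeff_mul (s : D.simpleRestricted) (f : D.base.support → k)
    (hf : ∀ c : D.base.support, D.σDual (D.root c) = D.root c → f c = 0) (v : k)
    (hv : ∀ c : D.base.support, D.tilde c = s.1 → f c = v) :
    ∑ c, D.restrictedCoeff s c * f c = 2 * v :=
  (D.exists_tilde_eq_sum s).choose_spec.2.2 f hf v hv

/-! ### The extended matrix with integral entries -/

variable (ε : Dual k D.H)

open Classical in
/-- The extended Cartan matrix, with integral entries. -/
def intExt : Matrix (Option D.base.support) (Option D.base.support) ℤ :=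
  Matrix.of fun i j ↦ match i, j with
    | some α, some β => D.cartanInt β α
    | some α, none => if h : ∃ n : ℕ, ε ((rootSystem D.H).coroot α) = n then -h.choose else 0
    | none, some β => if ε ((rootSystem D.H).coroot β) = 0 then 0 else -1
    | none, none => 2

variable {D ε}

lemma intExt_map (hε : D.IsDominantSpherical ε) :
    (D.intExt ε).map (Int.cast : ℤ → k) = D.extMatrix ε := by
  classical
  ext i j
  rcases i with - | a <;> rcases j with - | b
  · simp [intExt, extMatrix]
  · simp only [intExt, extMatrix, Matrix.map_apply, Matrix.of_apply]
    split_ifs <;> simp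
  · have h := hε.dominant a a.2
    simp only [intExt, extMatrix, Matrix.map_apply, Matrix.of_apply, dif_pos h]
    rw [Int.cast_neg, Int.cast_natCast, ← h.choose_spec]
  · simp only [intExt, extMatrix, Matrix.map_apply, Matrix.of_apply]
    rw [root_coroot]

lemma cast_intExt (hε : D.IsDominantSpherical ε) (i j) :
    ((D.intExt ε i j : ℤ) : k) = D.extMatrix ε i j := by
  rw [← intExt_map hε, Matrix.map_apply]

lemma isGCM_intExt (hε : D.IsDominantSpherical ε) : IsGCM (D.intExt ε) where
  diag i := by
    have := cast_intExt hε i i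
    rcases i with - | a
    · rfl
    · simp only [extMatrix, Matrix.of_apply, root_coroot_two] at this
      exact_mod_cast this
  nonpos i j hij := by
    classical
    rcases i with - | a <;> rcases j with - | b
    · exact absurd rfl hij
    · simp only [intExt, Matrix.of_apply]
      split_ifs <;> simp
    · simp only [intExt, Matrix.of_apply]
      split_ifs <;> simp
    · have hab : b ≠ a := fun h ↦ hij (by rw [h])
      exact D.base.pairingIn_le_zero_of_ne (fun h ↦ hab (Subtype.ext h)) b.2 a.2
  zero_symm i j h := by
    classical
    have h' := cast_intExt hε i j
    have goal' := cast_intExt hε j i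
    rw [h, Int.cast_zero] at h'
    rcases i with - | a <;> rcases j with - | b
    · exact h
    · have h0 : ε ((rootSystem D.H).coroot b) = 0 := by
        by_contra h0
        simp only [extMatrix, Matrix.of_apply, if_neg h0] at h'
        norm_num at h'
      simp only [extMatrix, Matrix.of_apply, h0, neg_zero] at goal'
      exact_mod_cast goal'
    · have h0 : ε ((rootSystem D.H).coroot a) = 0 := by
        simpa [extMatrix] using h'.symm
      simp only [extMatrix, Matrix.of_apply, h0, if_true] at goal'
      exact_mod_cast goal'
    · simp only [extMatrix, Matrix.of_apply] at h' goal'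
      rw [apply_coroot, eq_comm, div_eq_zero_iff, or_iff_left (D.κ_root_self_ne_zero _),
        mul_eq_zero, or_iff_right two_ne_zero] at h'
      rw [apply_coroot, κ_comm, h', mul_zero, zero_div] at goal'
      exact_mod_cast goal'

/-! ### The restricted matrix with integral entries -/

section Realization

variable {𝔥 : Type*} [AddCommGroup 𝔥] [Module k 𝔥] (R : Realization (D.extMatrix ε) 𝔥)

lemma inclDual_root (a : D.base.support) : inclDual R (D.root a) = R.root (some a) := by
  rw [← toWeightBasis_eq, inclDual, Basis.constr_basis]

lemma incl_coroot (a : D.base.support) :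
    incl R ((rootSystem D.H).coroot a) = R.coroot (some a) := by
  rw [← RootPairing.Base.toCoweightBasis_apply D.base a, incl, Basis.constr_basis]

lemma inclDual_apply_incl (lam : Dual k D.H) (x : D.H) : inclDual R lam (incl R x) = lam x := by
  have : (LinearMap.compl₁₂ (LinearMap.id : Dual k 𝔥 →ₗ[k] 𝔥 →ₗ[k] k) (inclDual R) (incl R)) =
      (LinearMap.id : Dual k D.H →ₗ[k] D.H →ₗ[k] k) := by
    refine D.base.toWeightBasis.ext fun a ↦ D.base.toCoweightBasis.ext fun b ↦ ?_
    rw [LinearMap.compl₁₂_apply, toWeightBasis_eq, RootPairing.Base.toCoweightBasis_apply,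
      inclDual_root, incl_coroot]
    exact R.root_coroot _ _
  exact LinearMap.congr_fun (LinearMap.congr_fun this lam) x

lemma root_none_apply_incl (x : D.H) : R.root none (incl R x) = -ε x := by
  have : (R.root none).comp (incl R) = -ε := by
    refine D.base.toCoweightBasis.ext fun b ↦ ?_
    rw [LinearMap.comp_apply, RootPairing.Base.toCoweightBasis_apply, incl_coroot]
    exact R.root_coroot _ _
  exact LinearMap.congr_fun this x

lemma ε_coroot_eq_zero_iff (hε : D.IsDominantSpherical ε) {a : D.base.support}
    (ha : D.σDual (D.root a) ≠ D.root a) :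
    ε ((rootSystem D.H).coroot a) = 0 ↔ ε (D.check (D.tilde a)) = 0 := by
  rw [D.apply_coroot_eq_corootRatio_mul ha hε.special, mul_eq_zero, or_iff_right]
  exact_mod_cast (D.corootRatio_pos a).ne'

-- The entries in the row of the new node vanish at fixed simple roots and depend only on the
-- restricted root elsewhere, since the coroot ratios are nonzero. The resulting `2` is cancelled by
-- the `½` in the new restricted coroot.
open Classical in
lemma sum_restrictedCoeff_mul_extMatrix_none (hε : D.IsDominantSpherical ε)
    (s : D.simpleRestricted) : ∑ c, D.restrictedCoeff s c * D.extMatrix ε none (some c) =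
      2 * if ε (D.check s.1) = 0 then 0 else -1 := by
  refine D.sum_restrictedCoeff_mul s (fun c ↦ D.extMatrix ε none (some c)) ?_ _ ?_
  · intro c hc
    have : ε ((rootSystem D.H).coroot c) = 0 := D.apply_coroot_eq_zero_of_fixed hε.special hc
    simp only [extMatrix, Matrix.of_apply, if_pos this]
  · intro c hc
    have hcf : D.σDual (D.root c) ≠ D.root c := by
      intro h
      obtain ⟨a, ha, has⟩ := D.mem_simpleRestricted.mp s.2
      refine D.κ_tilde_self_ne_zero ha ?_
      rw [has, ← hc, tilde, h, sub_self]
      simp [κ]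
    simp only [extMatrix, Matrix.of_apply, ε_coroot_eq_zero_iff hε hcf, hc]

open Classical in
lemma restrictedMatrix_apply (hε : D.IsDominantSpherical ε) (i j : Option D.simpleRestricted) :
    restrictedMatrix R i j = match i, j with
      | some s, some t => s.1 (D.check t.1)
      | none, some t => -2 * ε (D.check t.1)
      | some s, none => if ε (D.check s.1) = 0 then 0 else -1
      | none, none => 2 := by
  rcases i with - | s <;> rcases j with - | t <;>
    simp only [restrictedMatrix, Matrix.of_apply, extRestrictedRoot, extRestrictedCoroot]
  · have := R.root_coroot none none
    simp [this, extMatrix]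
  · simp [root_none_apply_incl]
  · conv_lhs => rw [eq_sum_restrictedCoeff]
    rw [map_sum, LinearMap.sum_apply]
    simp only [map_nsmul, inclDual_root, LinearMap.smul_apply, map_smul, R.root_coroot, nsmul_eq_mul,
      smul_eq_mul]
    rw [← Finset.mul_sum, sum_restrictedCoeff_mul_extMatrix_none hε, inv_mul_cancel_left₀ two_ne_zero]
  · exact inclDual_apply_incl R _ _

end Realization

/-! ### The folding -/

/-- The integral entries of the restricted matrix. -/
lemma exists_int_restrictedMatrix (hε : D.IsDominantSpherical ε) {𝔥 : Type*} [AddCommGroup 𝔥]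
    [Module k 𝔥] (R : Realization (D.extMatrix ε) 𝔥) :
    ∃ B : Matrix (Option D.simpleRestricted) (Option D.simpleRestricted) ℤ,
      B.map (Int.cast : ℤ → k) = restrictedMatrix R := by
  classical
  have : ∀ i j, ∃ z : ℤ, (z : k) = restrictedMatrix R i j := by
    intro i j
    rw [restrictedMatrix_apply R hε]
    rcases i with - | s <;> rcases j with - | t
    · exact ⟨2, by simp⟩
    · obtain ⟨a, ha, hat⟩ := D.mem_simpleRestricted.mp t.2
      obtain ⟨z, hz⟩ := hε.spherical t.1 ⟨a, ha, hat.symm⟩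
      exact ⟨-2 * z, by simp [hz]⟩
    · dsimp only
      split_ifs
      · exact ⟨0, by simp⟩
      · exact ⟨-1, by simp⟩
    · obtain ⟨a, ha, hat⟩ := D.mem_simpleRestricted.mp t.2
      obtain ⟨b, hb, hbs⟩ := D.mem_simpleRestricted.mp s.2
      obtain ⟨z, hz⟩ := (D.exists_coroot_ratio ha).choose_spec.2.2 b
      exact ⟨z, by dsimp only; rw [← hbs, ← hat, hz]⟩
  choose B hB using this
  exact ⟨Matrix.of B, by ext i j; exact hB i j⟩

lemma σDual_simpleRestricted (s : D.simpleRestricted) : D.σDual s.1 = -s.1 := by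
  obtain ⟨b, hb, hbs⟩ := D.mem_simpleRestricted.mp s.2
  rw [← hbs, σDual_tilde]

lemma apply_coroot_nonpos {s : D.simpleRestricted} {a : D.base.support}
    (ha : D.σDual (D.root a) ≠ D.root a) (has : D.tilde a ≠ s.1) :
    ∃ n : ℕ, s.1 ((rootSystem D.H).coroot a) = -(n : k) := by
  have h : ∀ c : D.base.support, ∃ n : ℕ,
      ((D.restrictedCoeff s c • D.root c) ((rootSystem D.H).coroot a) : k) = -(n : k) := by
    intro c
    by_cases hca : c = a
    · subst hca
      exact ⟨0, by rw [D.restrictedCoeff_eq_zero ha has]; simp⟩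
    · have h1 : D.cartanInt c a ≤ 0 :=
        D.base.pairingIn_le_zero_of_ne (fun h ↦ hca (Subtype.ext h)) c.2 a.2
      obtain ⟨m, hm⟩ := Int.eq_ofNat_of_zero_le (neg_nonneg.mpr h1)
      refine ⟨D.restrictedCoeff s c * m, ?_⟩
      rw [LinearMap.smul_apply, root_coroot, show D.cartanInt c a = -(m : ℤ) by omega]
      simp
  choose n hn using h
  refine ⟨∑ c, n c, ?_⟩
  conv_lhs => rw [eq_sum_restrictedCoeff]
  rw [LinearMap.sum_apply, Finset.sum_congr rfl fun c _ ↦ hn c, Finset.sum_neg_distrib]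
  push_cast
  rfl

lemma nonpos_of_ratio {z : ℤ} {n : ℕ} {c : ℚ} (hc : 0 < c) (h : -(n : k) = (c : k) * z) : z ≤ 0 := by
  have h' : -(n : ℚ) = c * z := by exact_mod_cast h
  by_contra! hz
  have : (0 : ℚ) < c * z := mul_pos hc (by exact_mod_cast hz)
  have h2 : (0 : ℚ) ≤ n := Nat.cast_nonneg n
  linarith

/-- Signs are inherited through the positive coroot ratios: from dominance of `ε` in the row of the
new node, and from nonpositivity of the Cartan integers between distinct simple roots. Symmetry of
zeros comes from the symmetric form. -/
lemma isGCM_of_map_eq (hε : D.IsDominantSpherical ε) {𝔥 : Type*} [AddCommGroup 𝔥]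
    [Module k 𝔥] {R : Realization (D.extMatrix ε) 𝔥}
    {B : Matrix (Option D.simpleRestricted) (Option D.simpleRestricted) ℤ}
    (hB : B.map (Int.cast : ℤ → k) = restrictedMatrix R) : IsGCM B := by
  classical
  have hB' : ∀ i j, (B i j : k) = restrictedMatrix R i j := fun i j ↦ by
    rw [← hB, Matrix.map_apply]
  simp only [restrictedMatrix_apply R hε] at hB'
  refine ⟨fun i ↦ ?_, fun i j hij ↦ ?_, fun i j hij ↦ ?_⟩
  · have := hB' i i
    rcases i with - | s
    · dsimp only at this
      exact_mod_cast this
    · obtain ⟨b, hb, hbs⟩ := D.mem_simpleRestricted.mp s.2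
      simp only [← hbs, D.tilde_check_self hb] at this
      exact_mod_cast this
  · have := hB' i j
    rcases i with - | s <;> rcases j with - | t
    · exact absurd rfl hij
    · obtain ⟨a, ha, hat⟩ := D.mem_simpleRestricted.mp t.2
      obtain ⟨n, hn⟩ := hε.dominant a a.2
      rw [D.apply_coroot_eq_corootRatio_mul ha hε.special, hat] at hn
      refine nonpos_of_ratio (k := k) (n := 2 * n) (D.corootRatio_pos a) ?_
      rw [this]
      push_cast
      rw [← hn]
      ring
    · dsimp only at this
      split_ifs at this
      · exact le_of_eq (by exact_mod_cast this)
      · have h1 : B (some s) none = -1 := by exact_mod_cast this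
        rw [h1]; norm_num
    · obtain ⟨a, ha, hat⟩ := D.mem_simpleRestricted.mp t.2
      have hne : D.tilde a ≠ s.1 := fun h ↦ hij (by rw [Subtype.ext (h.symm.trans hat)])
      obtain ⟨n, hn⟩ := apply_coroot_nonpos ha hne
      rw [D.apply_coroot_eq_corootRatio_mul ha (σDual_simpleRestricted s), hat] at hn
      refine nonpos_of_ratio (k := k) (n := n) (D.corootRatio_pos a) ?_
      rw [this, ← hn]
  · have h1 := hB' i j
    have h2 := hB' j i
    rw [hij, Int.cast_zero] at h1
    rcases i with - | s <;> rcases j with - | t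
    · exact hij
    · have h0 : ε (D.check t.1) = 0 := by simpa using h1
      simp only [h0, if_true] at h2
      exact_mod_cast h2
    · have h0 : ε (D.check s.1) = 0 := by
        by_contra h0
        simp only [if_neg h0] at h1
        norm_num at h1
      simp only [h0, mul_zero] at h2
      exact_mod_cast h2
    · obtain ⟨a, ha, hat⟩ := D.mem_simpleRestricted.mp t.2
      have h0 := D.κ_tilde_self_ne_zero ha
      rw [hat] at h0
      simp only [apply_check] at h1 h2
      rw [eq_comm, div_eq_zero_iff, or_iff_left h0, mul_eq_zero, or_iff_right two_ne_zero] at h1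
      rw [κ_comm, h1, mul_zero, zero_div] at h2
      exact_mod_cast h2

variable (D) in
open Classical in
/-- The restriction of the simple roots of the extended matrix. -/
def restr : Option D.base.support → Option (Option D.simpleRestricted)
  | none => some none
  | some a => if ha : D.σDual (D.root a) ≠ D.root a then
      some (some ⟨D.tilde a, D.mem_simpleRestricted.mpr ⟨a, ha, rfl⟩⟩) else none

variable (D) in
/-- The coefficients of the restricted roots of the extended matrix. -/
def extCoeff : Option D.simpleRestricted → Option D.base.support → ℕ
  | none, none => 2
  | some s, some a => D.restrictedCoeff s a
  | _, _ => 0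

variable (D) in
open Classical in
/-- The ratios between the coroots and the restricted coroots. -/
def extRatio : Option D.base.support → ℚ
  | none => 2
  | some a => D.corootRatio a

lemma restr_eq_some_some {a : D.base.support} {t : D.simpleRestricted}
    (h : D.restr (some a) = some (some t)) : D.σDual (D.root a) ≠ D.root a ∧ D.tilde a = t.1 := by
  rw [restr] at h
  split_ifs at h with ha
  rw [Option.some_inj, Option.some_inj] at h
  exact ⟨ha, congrArg Subtype.val h⟩

lemma restr_some_ne {a : D.base.support} : D.restr (some a) ≠ some none := by
  rw [restr]
  split_ifs <;> simp

lemma restr_eq_none {a : D.base.support} (h : D.restr (some a) = none) :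
    D.σDual (D.root a) = D.root a := by
  rw [restr] at h
  split_ifs at h with ha
  exact not_not.mp ha

lemma sum_extMatrix_mul_none (a : Option D.base.support) :
    ∑ b, D.extMatrix ε a b * (D.extCoeff none b : k) = 2 * D.extMatrix ε a none := by
  rw [Fintype.sum_option]
  simp [extCoeff, mul_comm]

lemma sum_extMatrix_mul_some (a : Option D.base.support) (s : D.simpleRestricted) :
    ∑ b, D.extMatrix ε a b * (D.extCoeff (some s) b : k) =
      ∑ b, D.restrictedCoeff s b * D.extMatrix ε a (some b) := by
  rw [Fintype.sum_option]
  simp [extCoeff, mul_comm]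

lemma sum_restrictedCoeff_mul_extMatrix (a : D.base.support) (s : D.simpleRestricted) :
    ∑ b, D.restrictedCoeff s b * D.extMatrix ε (some a) (some b) =
      s.1 ((rootSystem D.H).coroot a) := by
  conv_rhs => rw [eq_sum_restrictedCoeff]
  rw [LinearMap.sum_apply]
  simp only [LinearMap.smul_apply, nsmul_eq_mul]
  rfl

lemma sum_extMatrix_of_some (hε : D.IsDominantSpherical ε) {𝔥 : Type*} [AddCommGroup 𝔥]
    [Module k 𝔥] (R : Realization (D.extMatrix ε) 𝔥) {a : Option D.base.support}
    (i : Option D.simpleRestricted) {j : Option D.simpleRestricted} (h : D.restr a = some j) :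
    ∑ b, D.extMatrix ε a b * (D.extCoeff i b : k) = (D.extRatio a : k) * restrictedMatrix R i j := by
  classical
  rw [restrictedMatrix_apply R hε]
  rcases a with - | a
  · obtain rfl : none = j := by simpa [restr] using h
    rcases i with - | s
    · rw [sum_extMatrix_mul_none]
      simp [extMatrix, extRatio]
    · rw [sum_extMatrix_mul_some, sum_restrictedCoeff_mul_extMatrix_none hε]
      simp [extRatio]
  · rcases j with - | t
    · exact absurd h restr_some_ne
    obtain ⟨ha, hat⟩ := restr_eq_some_some h
    rcases i with - | s
    · rw [sum_extMatrix_mul_none]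
      simp only [extMatrix, Matrix.of_apply, extRatio]
      rw [D.apply_coroot_eq_corootRatio_mul ha hε.special, hat]
      ring
    · rw [sum_extMatrix_mul_some, sum_restrictedCoeff_mul_extMatrix,
        D.apply_coroot_eq_corootRatio_mul ha (σDual_simpleRestricted s), hat]
      rfl

lemma sum_extMatrix_of_none (hε : D.IsDominantSpherical ε) {a : Option D.base.support}
    (i : Option D.simpleRestricted) (h : D.restr a = none) :
    ∑ b, D.extMatrix ε a b * (D.extCoeff i b : k) = 0 := by
  rcases a with - | a
  · simp [restr] at h
  have ha := restr_eq_none h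
  rcases i with - | s
  · rw [sum_extMatrix_mul_none]
    simp only [extMatrix, Matrix.of_apply]
    rw [D.apply_coroot_eq_zero_of_fixed hε.special ha, neg_zero, mul_zero]
  · rw [sum_extMatrix_mul_some, sum_restrictedCoeff_mul_extMatrix,
      D.apply_coroot_eq_zero_of_fixed (σDual_simpleRestricted s) ha]

lemma isFolding (hε : D.IsDominantSpherical ε) {𝔥 : Type*} [AddCommGroup 𝔥]
    [Module k 𝔥] {R : Realization (D.extMatrix ε) 𝔥}
    {B : Matrix (Option D.simpleRestricted) (Option D.simpleRestricted) ℤ}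
    (hB : B.map (Int.cast : ℤ → k) = restrictedMatrix R) :
    IsFolding (D.intExt ε) B (fun i b ↦ (D.extCoeff i b : ℝ)) D.restr
      (fun a ↦ (D.extRatio a : ℝ)) where
  c_pos a := by
    have : 0 < D.extRatio a := by
      rcases a with - | a
      · simp [extRatio]
      · exact D.corootRatio_pos a
    exact_mod_cast this
  P_nonneg i a := Nat.cast_nonneg _
  P_pos a i h := by
    have : 0 < D.extCoeff i a := by
      rcases a with - | a
      · obtain rfl : none = i := by simpa [restr] using h
        simp [extCoeff]
      · rcases i with - | s
        · exact absurd h restr_some_ne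
        · obtain ⟨ha, has⟩ := restr_eq_some_some h
          exact D.restrictedCoeff_pos ha has
    exact_mod_cast this
  P_zero a i j h hij := by
    have : D.extCoeff i a = 0 := by
      rcases a with - | a
      · obtain rfl : none = j := by simpa [restr] using h
        rcases i with - | s
        · exact absurd rfl hij
        · rfl
      · rcases i with - | s
        · rfl
        · rcases j with - | t
          · exact absurd h restr_some_ne
          · obtain ⟨ha, hat⟩ := restr_eq_some_some h
            exact D.restrictedCoeff_eq_zero ha fun h' ↦ hij
              (by rw [Subtype.ext (h'.symm.trans hat)])
    simp only [this, Nat.cast_zero]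
  surj i := by
    rcases i with - | s
    · exact ⟨none, rfl⟩
    · obtain ⟨a, ha, has⟩ := D.mem_simpleRestricted.mp s.2
      refine ⟨some a, ?_⟩
      rw [restr, dif_pos ha]
      simp only [has]
  mul_some i a j h := by
    have h1 := sum_extMatrix_of_some hε R i h
    simp only [← cast_intExt hε, ← hB, Matrix.map_apply] at h1
    -- The identity is known in `k` and needed in `ℝ`; as all terms are rational, it passes through
    -- `ℚ`.
    have h2 : ∑ b, (D.intExt ε a b : ℚ) * (D.extCoeff i b : ℚ) = D.extRatio a * B i j := by
      exact_mod_cast h1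
    rw [realMulVec_apply]
    exact_mod_cast h2
  mul_none i a h := by
    have h1 := sum_extMatrix_of_none (ε := ε) hε i h
    simp only [← cast_intExt hε] at h1
    have h2 : ∑ b, (D.intExt ε a b : ℤ) * (D.extCoeff i b : ℤ) = 0 := by
      exact_mod_cast h1
    rw [realMulVec_apply]
    exact_mod_cast h2

end SymmetricDatum

namespace SymmetricDatum

variable {k L : Type*} [Field k] [IsAlgClosed k] [CharZero k]
  [LieRing L] [LieAlgebra k L] [FiniteDimensional k L] [LieAlgebra.IsSemisimple k L]
  {D : SymmetricDatum k L} {ε : Dual k D.H}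

/-! ### Indecomposability -/

/-- Simple reflections suffice: one in `T` subtracts an element of the span, and one outside `T`
fixes the generators of the span by orthogonality. -/
lemma span_invariant (T : Set D.base.support)
    (hT : ∀ a ∈ T, ∀ b ∉ T, D.root a ((rootSystem D.H).coroot b) = 0) (i : D.H.root) :
    Submodule.span k ((fun a : D.base.support ↦ D.root a) '' T) ∈
      End.invtSubmodule ((rootSystem D.H).reflection i) := by
  revert i
  rw [← D.base.forall_mem_support_invtSubmodule_iff]
  intro b hb
  rw [End.mem_invtSubmodule, Submodule.span_le]
  rintro _ ⟨a, ha, rfl⟩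
  rw [SetLike.mem_coe, Submodule.mem_comap]
  have hr : (rootSystem D.H).reflection b (D.root a) =
      D.root a - D.root a ((rootSystem D.H).coroot b) • D.root b :=
    (rootSystem D.H).reflection_apply b (D.root a)
  change (rootSystem D.H).reflection b (D.root a) ∈
    Submodule.span k ((fun a : D.base.support ↦ D.root a) '' T)
  rw [hr]
  by_cases hbT : ⟨b, hb⟩ ∈ T
  · exact Submodule.sub_mem _ (Submodule.subset_span ⟨a, ha, rfl⟩)
      (Submodule.smul_mem _ _ (Submodule.subset_span ⟨⟨b, hb⟩, hbT, rfl⟩))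
  · rw [hT a ha ⟨b, hb⟩ hbT, zero_smul, sub_zero]
    exact Submodule.subset_span ⟨a, ha, rfl⟩

lemma κ_eq_zero_of_mem_span (T : Set D.base.support)
    (hε : ∀ a ∈ T, ε ((rootSystem D.H).coroot a) = 0) {lam : Dual k D.H}
    (h : lam ∈ Submodule.span k ((fun a : D.base.support ↦ D.root a) '' T)) : D.κ lam ε = 0 := by
  suffices Submodule.span k ((fun a : D.base.support ↦ D.root a) '' T) ≤
      LinearMap.ker (Dual.eval k D.H ((cartanEquivDual D.H).symm ε)) from this h
  rw [Submodule.span_le]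
  rintro _ ⟨a, ha, rfl⟩
  have := hε a ha
  rw [apply_coroot, div_eq_zero_iff, or_iff_left (D.κ_root_self_ne_zero _),
        mul_eq_zero, or_iff_right two_ne_zero, κ_comm] at this
  exact this

variable (D) in
/-- The centralizer of an element of the Cartan subalgebra, as a module over the latter. -/
def centralizerOf (z : D.H) : LieSubmodule k D.H L :=
  { LinearMap.ker (LieModule.toEnd k L L (z : L)) with
    lie_mem := fun {h y} hy ↦ by
      have hy' : ⁅(z : L), y⁆ = 0 := hy
      change ⁅(z : L), ⁅(h : L), y⁆⁆ = 0
      rw [leibniz_lie, hy', D.lie_H, zero_lie, lie_zero, add_zero] }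

lemma sl2SubmoduleOfRoot_le_centralizerOf {z : D.H} {α : LieModule.Weight k D.H L}
    (hα : α.IsNonZero) (h0 : α z = 0) : sl2SubmoduleOfRoot hα ≤ D.centralizerOf z := by
  intro y hy
  obtain ⟨h, e, f, t, he, hf⟩ := exists_isSl2Triple_of_weight_isNonZero hα
  obtain ⟨c₁, c₂, c₃, rfl⟩ := (mem_sl2SubalgebraOfRoot_iff hα t he hf).mp hy
  have h1 : ⁅(z : L), e⁆ = 0 := by
    have := lie_eq_smul_of_mem_rootSpace he z
    rw [h0, zero_smul] at this
    exact this
  have h2 : ⁅(z : L), f⁆ = 0 := by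
    have := lie_eq_smul_of_mem_rootSpace hf z
    rw [Pi.neg_apply, h0, neg_zero, zero_smul] at this
    exact this
  change ⁅(z : L), c₁ • e + c₂ • f + c₃ • ⁅e, f⁆⁆ = 0
  rw [lie_add, lie_add, lie_smul, lie_smul, lie_smul, leibniz_lie, h1, h2]
  simp

/-- The dual element of `ε` centralizes the ideal generated by the root spaces orthogonal to
`ε`. -/
lemma lie_eq_zero_of_mem_ideal {q : Submodule k (Dual k D.H)}
    (hq : ∀ i, q ∈ End.invtSubmodule ((rootSystem D.H).reflection i).toLinearMap)
    (hε : ∀ lam ∈ q, D.κ lam ε = 0) {x : L} (hx : x ∈ invtSubmoduleToLieIdeal q hq) :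
    ⁅((cartanEquivDual D.H).symm ε : L), x⁆ = 0 := by
  have hle : (invtSubmoduleToLieIdeal q hq).restr D.H ≤
      D.centralizerOf ((cartanEquivDual D.H).symm ε) := by
    rw [restr_invtSubmoduleToLieIdeal_eq_iSup]
    exact iSup_le fun α ↦ sl2SubmoduleOfRoot_le_centralizerOf α.2.2 (hε _ α.2.1)
  exact hle hx

/-- A nonempty `T` spans a Weyl-invariant subspace and so defines a nonzero ideal `I`. By simplicity
of `σ`, `I + σ(I)` is everything. The element dual to `ε` centralizes `I`, and also `σ(I)` because
`σ(ε) = -ε`; it is therefore central, hence zero. -/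
lemma eq_empty_of_orthogonal (hε : D.IsDominantSpherical ε) (hε0 : ε ≠ 0) (T : Set D.base.support)
    (hT : ∀ a ∈ T, ∀ b ∉ T, D.root a ((rootSystem D.H).coroot b) = 0)
    (hTε : ∀ a ∈ T, ε ((rootSystem D.H).coroot a) = 0) : T = ∅ := by
  by_contra hne
  obtain ⟨a, ha⟩ := Set.nonempty_iff_ne_empty.mpr hne
  set q := Submodule.span k ((fun a : D.base.support ↦ D.root a) '' T) with hqdef
  have hq := span_invariant T hT
  set I := invtSubmoduleToLieIdeal q hq with hI
  have hIσ : ∀ x ∈ I ⊔ I.comap (D.σ : L →ₗ⁅k⁆ L), D.σ x ∈ I ⊔ I.comap (D.σ : L →ₗ⁅k⁆ L) := by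
    intro x hx
    obtain ⟨y, hy, z, hz, rfl⟩ := (LieSubmodule.mem_sup _ _ _).mp hx
    rw [map_add, add_comm]
    refine (LieSubmodule.mem_sup _ _ _).mpr ⟨D.σ z, ?_, D.σ y, ?_, rfl⟩
    · exact (LieIdeal.mem_comap (f := (D.σ : L →ₗ⁅k⁆ L))).mp hz
    · refine (LieIdeal.mem_comap (f := (D.σ : L →ₗ⁅k⁆ L))).mpr ?_
      change D.σ (D.σ y) ∈ I
      rwa [D.σ_σ]
  have hκ : ∀ lam ∈ q, D.κ lam ε = 0 := fun lam h ↦ κ_eq_zero_of_mem_span T hTε h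
  rcases D.simple _ hIσ with h | h
  · have h1 : a.1 ∈ I.rootSet := (mem_rootSet_invtSubmoduleToLieIdeal q hq).mpr
      (Submodule.subset_span ⟨a, ha, rfl⟩)
    have hIbot : I = ⊥ := le_bot_iff.mp (h ▸ le_sup_left)
    rw [LieIdeal.mem_rootSet, hIbot] at h1
    exact (a.1 : LieModule.Weight k D.H L).genWeightSpace_ne_bot L (le_bot_iff.mp h1)
  · have hcent : ∀ x : L, ⁅((cartanEquivDual D.H).symm ε : L), x⁆ = 0 := by
      intro x
      have hx : x ∈ I ⊔ I.comap (D.σ : L →ₗ⁅k⁆ L) := h ▸ LieSubmodule.mem_top x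
      obtain ⟨y, hy, z, hz, rfl⟩ := (LieSubmodule.mem_sup _ _ _).mp hx
      have h2 : ⁅((cartanEquivDual D.H).symm ε : L), D.σ z⁆ = 0 :=
        lie_eq_zero_of_mem_ideal hq hκ (LieIdeal.mem_comap (f := (D.σ : L →ₗ⁅k⁆ L)).mp hz)
      have h3 := congrArg D.σ h2
      rw [LieEquiv.map_lie, D.σ_σ, ← coe_σH, ← cartanEquivDual_symm_σDual, hε.special, map_neg,
        map_zero] at h3
      have h4 : ⁅((cartanEquivDual D.H).symm ε : L), z⁆ = 0 := by
        rw [NegMemClass.coe_neg, neg_lie, neg_eq_zero] at h3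
        exact h3
      rw [lie_add, lie_eq_zero_of_mem_ideal hq hκ hy, h4, add_zero]
    have h5 : ((cartanEquivDual D.H).symm ε : L) ∈ LieAlgebra.center k L := by
      rw [LieModule.mem_maxTrivSubmodule]
      intro x
      rw [← lie_skew, hcent, neg_zero]
    rw [LieAlgebra.center_eq_bot, LieSubmodule.mem_bot] at h5
    refine hε0 ?_
    have h6 : (cartanEquivDual D.H).symm ε = 0 := Subtype.ext h5
    simpa using h6

/-- In a decomposition, the side without the new node is a set of simple roots orthogonal to `ε` and
to the remaining simple roots, so it is empty. -/
lemma indecomposable_intExt (hε : D.IsDominantSpherical ε) (hε0 : ε ≠ 0) :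
    Indecomposable (D.intExt ε) := by
  classical
  refine ⟨⟨none⟩, ?_⟩
  have key : ∀ S : Set (Option D.base.support), none ∉ S → S.Nonempty →
      ∃ i ∈ S, ∃ j ∈ Sᶜ, D.intExt ε i j ≠ 0 ∨ D.intExt ε j i ≠ 0 := by
    intro S hS hSn
    by_contra! hall
    have hc : ∀ i ∈ S, ∀ j ∈ Sᶜ, D.extMatrix ε i j = 0 ∧ D.extMatrix ε j i = 0 := by
      intro i hi j hj
      rw [← cast_intExt hε, ← cast_intExt hε, (hall i hi j hj).1, (hall i hi j hj).2]
      simp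
    have h := eq_empty_of_orthogonal hε hε0 {a | some a ∈ S}
      (fun a ha b hb ↦ (hc _ ha (some b) hb).2) (fun a ha ↦ by
        have := (hc _ ha none hS).1
        simp only [extMatrix, Matrix.of_apply, neg_eq_zero] at this
        exact this)
    obtain ⟨i, hi⟩ := hSn
    rcases i with - | a
    · exact hS hi
    · exact (h ▸ (show a ∈ {a | some a ∈ S} from hi) : a ∈ (∅ : Set D.base.support))
  intro S hS hSc
  by_cases h : none ∈ S
  · obtain ⟨i, hi, j, hj, hij⟩ := key Sᶜ (fun h' ↦ h' h) hSc
    exact ⟨j, by simpa using hj, i, hi, hij.symm⟩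
  · exact key S h hS

/-! ### The weight zero -/

variable (D) in
/-- The sum of the positive roots is strictly dominant. -/
lemma exists_pos_dominant : ∃ u : D.base.support → ℕ, (∀ a, 0 < u a) ∧
    ∀ a : D.base.support, ∑ b : D.base.support, D.cartanInt b a * u b = 2 := by
  classical
  have hΔ : ∀ a : D.base.support, D.base.IsPos a := fun a ↦
    RootPairing.Base.isPos_of_mem_support a.2
  set Q : Finset D.H.root := Finset.univ.filter D.base.IsPos with hQ
  have hQm : ∀ β, β ∈ Q ↔ D.base.IsPos β := fun β ↦ by simp [hQ]
  choose! n hn using fun β (hβ : D.base.IsPos β) ↦ D.exists_nat_of_isPos hβ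
  have hsum : ∑ β ∈ Q, D.root β = ∑ b : D.base.support, (∑ β ∈ Q, n β b) • D.root b := by
    rw [Finset.sum_congr rfl fun β hβ ↦ hn β ((hQm β).mp hβ), Finset.sum_comm]
    exact Finset.sum_congr rfl fun b _ ↦ (Finset.sum_smul ..).symm
  refine ⟨fun b ↦ ∑ β ∈ Q, n β b, fun a ↦ ?_, fun a ↦ ?_⟩
  · have ha : D.base.IsPos (a : D.H.root) := hΔ a
    have h1 : n a = Pi.single a 1 := by
      apply D.sum_smul_root_injective
      rw [← hn a ha]
      simp [Pi.single_apply]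
    refine Finset.sum_pos' (fun _ _ ↦ Nat.zero_le _) ⟨a, (hQm _).mpr ha, ?_⟩
    rw [h1]
    simp
  · have ha : D.base.IsPos (a : D.H.root) := hΔ a
    have h2 : (∑ β ∈ Q, D.root β) ((rootSystem D.H).coroot a) = 2 := by
      rw [← Finset.add_sum_erase Q _ ((hQm _).mpr ha), LinearMap.add_apply, root_coroot_two]
      have hmaps : ∀ β ∈ Q.erase (a : D.H.root),
          (rootSystem D.H).reflectionPerm a β ∈ Q.erase (a : D.H.root) := by
        intro β hβ
        rw [Finset.mem_erase, hQm] at hβ ⊢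
        refine ⟨fun h ↦ ?_, hβ.2.reflectionPerm a.2 hβ.1⟩
        -- If `s_a(β) = a`, then `β = s_a(a) = -a` has negative height. Thus the simple reflection
        -- permutes the positive roots other than `a`, whose sum then pairs to zero with the coroot
        -- of `a`.
        have h7 : (rootSystem D.H).reflectionPerm a a = β := by
          have := congrArg ((rootSystem D.H).reflectionPerm a) h
          rw [RootPairing.reflectionPerm_self] at this
          exact this.symm
        have h9 := D.base.height_reflectionPerm_self a
        rw [RootPairing.indexNeg_neg, h7] at h9
        have h10 := hβ.2
        rw [RootPairing.Base.isPos_iff] at h10 ha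
        omega
      have h3 : (rootSystem D.H).reflection a (∑ β ∈ Q.erase a, D.root β) =
          ∑ β ∈ Q.erase a, D.root β := by
        rw [map_sum]
        refine Finset.sum_nbij' (fun β ↦ (rootSystem D.H).reflectionPerm a β)
          (fun β ↦ (rootSystem D.H).reflectionPerm a β) ?_ ?_ ?_ ?_ ?_
        · exact hmaps
        · exact hmaps
        · exact fun β _ ↦ (rootSystem D.H).reflectionPerm_self _ _
        · exact fun β _ ↦ (rootSystem D.H).reflectionPerm_self _ _
        · exact fun β _ ↦ ((rootSystem D.H).root_reflectionPerm _ _).symm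
      rw [RootPairing.reflection_apply] at h3
      have h4 := sub_eq_self.mp h3
      rw [smul_eq_zero, or_iff_left ((rootSystem D.H).ne_zero _)] at h4
      have h5 : (∑ β ∈ Q.erase ↑a, D.root β) ((rootSystem D.H).coroot a) = 0 := h4
      rw [h5, add_zero]
    rw [hsum, LinearMap.sum_apply] at h2
    have h3 : ∑ b : D.base.support, ((D.cartanInt b a : ℤ) : k) * ((∑ β ∈ Q, n β b : ℕ) : k) = 2 := by
      rw [← h2]
      refine Finset.sum_congr rfl fun b _ ↦ ?_
      rw [LinearMap.smul_apply, root_coroot, nsmul_eq_mul, mul_comm]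
    exact_mod_cast h3

lemma exists_pos_intExt_zero (hε : D.IsDominantSpherical (0 : Dual k D.H)) :
    ∃ u : Option D.base.support → ℝ, (∀ a, 0 < u a) ∧ ∀ a, 0 < realMulVec (D.intExt 0) u a := by
  classical
  obtain ⟨u, hu, hMu⟩ := D.exists_pos_dominant
  refine ⟨fun a ↦ a.elim 1 fun a ↦ (u a : ℝ), fun a ↦ ?_, fun a ↦ ?_⟩
  · rcases a with - | a
    · simp
    · simpa using hu a
  · rw [realMulVec_apply, Fintype.sum_option]
    rcases a with - | a
    · simp [intExt]
    · have h0 : D.intExt 0 (some a) none = 0 := by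
        have := cast_intExt hε (some a) none
        simp only [extMatrix, Matrix.of_apply, LinearMap.zero_apply, neg_zero] at this
        exact_mod_cast this
      have h1 : ∑ b, ((D.intExt 0 (some a) (some b) : ℤ) : ℝ) * (u b : ℝ) = 2 := by
        have := hMu a
        simp only [intExt, Matrix.of_apply]
        exact_mod_cast this
      simp only [h0, Option.elim, h1]
      norm_num

end SymmetricDatum

/-! ### Integral test vectors and the extended matrices of each type -/

lemma IsPerron.submatrix {ι κ : Type*} [Fintype ι] [Fintype κ] {A : Matrix ι ι ℤ} {t : ℝ}
    {u p : ι → ℝ} (h : IsPerron A t u p) (e : κ ≃ ι) :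
    IsPerron (A.submatrix e e) t (u ∘ e) (p ∘ e) where
  u_pos i := h.u_pos (e i)
  p_pos i := h.p_pos (e i)
  right := by
    ext i
    have := congrFun h.right (e i)
    rw [realMulVec_apply] at this ⊢
    exact (e.sum_comp fun j ↦ (A (e i) j : ℝ) * u j).trans this
  left := by
    ext i
    have := congrFun h.left (e i)
    rw [realMulVec_apply] at this ⊢
    exact (e.sum_comp fun j ↦ (A j (e i) : ℝ) * p j).trans this

lemma realMulVec_intCast {ι : Type*} [Fintype ι] (A : Matrix ι ι ℤ) (v : ι → ℤ) (i : ι) :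
    realMulVec A (fun j ↦ (v j : ℝ)) i = ((∑ j, A i j * v j : ℤ) : ℝ) := by
  rw [realMulVec_apply]
  push_cast
  rfl

namespace IsPerron

variable {ι : Type*} [Fintype ι] {A : Matrix ι ι ℤ} {t : ℝ} {u p : ι → ℝ}

lemma pos_of_intVec (h : IsPerron A t u p) {v : ι → ℤ} (hv : ∀ i, 0 ≤ v i)
    (hAv : ∀ i, 0 ≤ ∑ j, A i j * v j) (hAv0 : ∃ i, ∑ j, A i j * v j ≠ 0) : 0 < t := by
  refine h.pos_of_realMulVec (v := fun j ↦ (v j : ℝ)) (fun i ↦ by exact_mod_cast hv i)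
    (fun i ↦ ?_) (fun h0 ↦ ?_)
  · rw [realMulVec_intCast]; exact_mod_cast hAv i
  · obtain ⟨i, hi⟩ := hAv0
    have := congrFun h0 i
    rw [realMulVec_intCast, Pi.zero_apply] at this
    exact hi (by exact_mod_cast this)

lemma neg_of_intVec (h : IsPerron A t u p) {v : ι → ℤ} (hv : ∀ i, 0 ≤ v i)
    (hAv : ∀ i, ∑ j, A i j * v j ≤ 0) (hAv0 : ∃ i, ∑ j, A i j * v j ≠ 0) : t < 0 := by
  refine h.neg_of_realMulVec (v := fun j ↦ (v j : ℝ)) (fun i ↦ by exact_mod_cast hv i)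
    (fun i ↦ ?_) (fun h0 ↦ ?_)
  · rw [realMulVec_intCast]; exact_mod_cast hAv i
  · obtain ⟨i, hi⟩ := hAv0
    have := congrFun h0 i
    rw [realMulVec_intCast, Pi.zero_apply] at this
    exact hi (by exact_mod_cast this)

lemma eq_zero_of_intVec (h : IsPerron A t u p) {v : ι → ℤ} (hv : ∀ i, 0 ≤ v i)
    (hv0 : ∃ i, v i ≠ 0) (hAv : ∀ i, ∑ j, A i j * v j = 0) : t = 0 := by
  refine h.eq_zero_of_realMulVec (v := fun j ↦ (v j : ℝ)) (fun i ↦ by exact_mod_cast hv i)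
    (fun h0 ↦ ?_) (funext fun i ↦ ?_)
  · obtain ⟨i, hi⟩ := hv0
    have : (v i : ℝ) = 0 := congrFun h0 i
    exact hi (by exact_mod_cast this)
  · rw [realMulVec_intCast, hAv i]; simp

end IsPerron

namespace RootType

/-- The matrix of a restricted root system of type `X`, extended by means of its first fundamental
weight. -/
def extended (X : RootType) : Matrix (Option (Fin X.rank)) (Option (Fin X.rank)) ℤ :=
  Matrix.of fun i j ↦ match i, j with
    | some i, some j => X.cartanMatrix i j
    | none, some j => if (j : ℕ) = 0 then -2 * X.firstValue else 0
    | some i, none => if (i : ℕ) = 0 then -1 else 0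
    | none, none => 2

lemma sum_fin_ite {n : ℕ} (m : ℕ) (c : ℤ) :
    ∑ j : Fin n, (if (j : ℕ) = m then c else 0) = if m < n then c else 0 := by
  split_ifs with h
  · rw [Finset.sum_eq_single_of_mem (⟨m, h⟩ : Fin n) (Finset.mem_univ _)]
    · simp
    · intro j _ hj
      exact if_neg fun h' ↦ hj (Fin.ext h')
  · exact Finset.sum_eq_zero fun j _ ↦ if_neg fun h' : (j : ℕ) = m ↦ h (h' ▸ j.2)

/-- The value of the extended matrix on a vector. -/
lemma sum_extended_none (X : RootType) (hX : 0 < X.rank) (v : ℕ → ℤ) (v₀ : ℤ) :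
    ∑ j, X.extended none j * j.elim v₀ (fun j ↦ v j) = 2 * v₀ - 2 * X.firstValue * v 0 := by
  rw [Fintype.sum_option]
  have : ∀ j : Fin X.rank, X.extended none (some j) * (some j).elim v₀ (fun j ↦ v j) =
      if (j : ℕ) = 0 then -2 * X.firstValue * v 0 else 0 := by
    intro j
    simp only [extended, Matrix.of_apply, Option.elim]
    split_ifs with h
    · rw [h]
    · rw [zero_mul]
  rw [Finset.sum_congr rfl fun j _ ↦ this j, sum_fin_ite, if_pos hX]
  simp only [extended, Matrix.of_apply, Option.elim]
  ring

lemma sum_extended_some (X : RootType) (v : ℕ → ℤ) (v₀ : ℤ) (i : Fin X.rank) :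
    ∑ j, X.extended (some i) j * j.elim v₀ (fun j ↦ v j) =
      (if (i : ℕ) = 0 then -v₀ else 0) + ∑ j, X.cartanMatrix i j * v j := by
  rw [Fintype.sum_option]
  simp only [extended, Matrix.of_apply, Option.elim]
  split_ifs <;> simp

lemma sum_A {n : ℕ} (i : Fin n) : ∑ j : Fin n, CartanMatrix.A n i j =
    (if (i : ℕ) = 0 then 1 else 0) + if (i : ℕ) + 1 = n then 1 else 0 := by
  -- Each row is a sum of indicators of single columns. The inner condition on `i = 0` is needed
  -- because `i - 1` truncates to `0` there.
  have : ∀ j : Fin n, CartanMatrix.A n i j = (if (j : ℕ) = i then 2 else 0) +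
      (if (j : ℕ) = i + 1 then -1 else 0) +
      (if (j : ℕ) = i - 1 then (if (i : ℕ) = 0 then 0 else -1) else 0) := by
    intro j
    simp only [CartanMatrix.A, Matrix.of_apply, Fin.ext_iff]
    split_ifs <;> omega
  simp only [this, Finset.sum_add_distrib, sum_fin_ite]
  have := i.2
  split_ifs <;> omega

lemma sum_B {n : ℕ} (hn : 2 ≤ n) (i : Fin n) :
    ∑ j : Fin n, CartanMatrix.B n i j * (if (j : ℕ) + 1 = n then 1 else 2) =
      if (i : ℕ) = 0 then 2 else 0 := by
  have : ∀ j : Fin n, CartanMatrix.B n i j * (if (j : ℕ) + 1 = n then 1 else 2) =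
      (if (j : ℕ) = i then (if (i : ℕ) + 1 = n then 2 else 4) else 0) +
      (if (j : ℕ) = i + 1 then -2 else 0) +
      (if (j : ℕ) = i - 1 then (if (i : ℕ) = 0 then 0 else -2) else 0) := by
    intro j
    simp only [CartanMatrix.B, Matrix.of_apply, Fin.ext_iff]
    have := i.2
    have := j.2
    split_ifs <;> omega
  simp only [this, Finset.sum_add_distrib, sum_fin_ite]
  have := i.2
  split_ifs <;> omega

lemma sum_C {n : ℕ} (hn : 2 ≤ n) (i : Fin n) :
    ∑ j : Fin n, CartanMatrix.C n i j = if (i : ℕ) = 0 then 1 else 0 := by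
  have : ∀ j : Fin n, CartanMatrix.C n i j = (if (j : ℕ) = i then 2 else 0) +
      (if (j : ℕ) = i + 1 then -1 else 0) +
      (if (j : ℕ) = i - 1 then (if (i : ℕ) = 0 then 0 else if (i : ℕ) + 1 = n then -2 else -1)
        else 0) := by
    intro j
    simp only [CartanMatrix.C, Matrix.of_apply, Fin.ext_iff]
    split_ifs <;> omega
  simp only [this, Finset.sum_add_distrib, sum_fin_ite]
  have := i.2
  split_ifs <;> omega

lemma sum_D {n : ℕ} (hn : 4 ≤ n) (i : Fin n) :
    ∑ j : Fin n, CartanMatrix.D n i j * (if (j : ℕ) + 2 < n then 2 else 1) =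
      if (i : ℕ) = 0 then 2 else 0 := by
  have : ∀ j : Fin n, CartanMatrix.D n i j * (if (j : ℕ) + 2 < n then 2 else 1) =
      (if (j : ℕ) = i then (if (i : ℕ) + 2 < n then 4 else 2) else 0) +
      (if (j : ℕ) = i + 1 then (if (i : ℕ) + 3 < n then -2 else 0) else 0) +
      (if (j : ℕ) = i - 1 then (if 0 < (i : ℕ) ∧ (i : ℕ) + 2 < n then -2 else 0) else 0) +
      (if (j : ℕ) = n - 2 then (if (i : ℕ) + 3 = n then -1 else 0) else 0) +
      (if (j : ℕ) = n - 1 then (if (i : ℕ) + 3 = n then -1 else 0) else 0) +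
      (if (j : ℕ) = n - 3 then (if n ≤ (i : ℕ) + 2 then -2 else 0) else 0) := by
    intro j
    simp only [CartanMatrix.D, Matrix.of_apply, Fin.ext_iff]
    have := i.2
    have := j.2
    grind (splits := 20)
  simp only [this, Finset.sum_add_distrib, sum_fin_ite]
  have := i.2
  grind (splits := 20)

end RootType

namespace RootType

lemma rank_pos {X : RootType} (hX : X.Admissible) : 0 < X.rank := by
  cases X <;> simp only [Admissible, rank] at hX ⊢ <;> omega

lemma firstValue_ne_zero (X : RootType) : X.firstValue ≠ 0 := by
  unfold firstValue
  split <;> norm_num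

/-- The type of the extended matrix, in terms of the sign of its Perron eigenvalue. -/
lemma sign_extended {X : RootType} (hX : X.Admissible) {t : ℝ} {u p : Option (Fin X.rank) → ℝ}
    (h : IsPerron X.extended t u p) : (0 < t ↔ X.IsA) ∧ (t = 0 ↔ X.IsBBCCD) := by
  have hpos : 0 < t → X.IsA ∧ ¬X.IsBBCCD → (0 < t ↔ X.IsA) ∧ (t = 0 ↔ X.IsBBCCD) :=
    fun ht hX ↦ ⟨iff_of_true ht hX.1, iff_of_false ht.ne' hX.2⟩
  have hzero : t = 0 → ¬X.IsA ∧ X.IsBBCCD → (0 < t ↔ X.IsA) ∧ (t = 0 ↔ X.IsBBCCD) :=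
    fun ht hX ↦ ⟨iff_of_false ht.not_gt hX.1, iff_of_true ht hX.2⟩
  have hneg : t < 0 → ¬X.IsA ∧ ¬X.IsBBCCD → (0 < t ↔ X.IsA) ∧ (t = 0 ↔ X.IsBBCCD) :=
    fun ht hX ↦ ⟨iff_of_false ht.not_gt hX.1, iff_of_false ht.ne hX.2⟩
  have hr := rank_pos hX
  -- The relation between `v₀` and `v 0` kills the row of the new node, and the column of that node
  -- cancels the only nonzero row of the Cartan matrix, so the vector is null.
  have affine : ∀ (v : ℕ → ℤ) (v₀ : ℤ), 0 < v₀ → (∀ n, 0 ≤ v n) →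
      v₀ = X.firstValue * v 0 → (∀ i : Fin X.rank, ∑ j : Fin X.rank, X.cartanMatrix i j * v j =
        if (i : ℕ) = 0 then v₀ else 0) → t = 0 := by
    intro v v₀ hv₀ hv h0 hi
    refine h.eq_zero_of_intVec (v := fun j ↦ j.elim v₀ fun j ↦ v j) ?_ ⟨none, hv₀.ne'⟩ ?_
    · rintro (- | i)
      · exact hv₀.le
      · exact hv i
    · rintro (- | i)
      · rw [sum_extended_none X hr, h0]; ring
      · rw [sum_extended_some, hi]
        split_ifs <;> simp
  have finite : X.firstValue = 1 → (∀ i : Fin X.rank, ∑ j : Fin X.rank, X.cartanMatrix i j =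
      (if (i : ℕ) = 0 then 1 else 0) + if (i : ℕ) + 1 = X.rank then 1 else 0) → 0 < t := by
    intro hfv hA
    have hsome : ∀ i : Fin X.rank, ∑ j, X.extended (some i) j *
        j.elim 1 (fun j ↦ (1 : ℕ → ℤ) j) = if (i : ℕ) + 1 = X.rank then 1 else 0 := by
      intro i
      rw [sum_extended_some]
      simp only [Pi.one_apply, mul_one, hA]
      split_ifs <;> simp
    refine h.pos_of_intVec (v := fun j ↦ j.elim 1 (fun j ↦ (1 : ℕ → ℤ) j)) ?_ ?_ ?_
    · rintro (- | i) <;> simp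
    · rintro (- | i)
      · rw [sum_extended_none X hr, hfv]; simp
      · rw [hsome]; split_ifs <;> norm_num
    · refine ⟨some ⟨X.rank - 1, Nat.sub_lt hr one_pos⟩, ?_⟩
      have hlast : X.rank - 1 + 1 = X.rank := Nat.sub_add_cancel hr
      exact ((hsome _).trans (if_pos hlast)).trans_ne one_ne_zero
  cases X with
  | A n =>
    exact hpos (finite (by simp [firstValue]) sum_A) ⟨trivial, id⟩
  | B n =>
    refine hzero ?_ ⟨id, trivial⟩
    rcases Nat.lt_or_ge n 2 with hn | hn
    · obtain rfl : n = 1 := by simp only [Admissible] at hX; omega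
      -- In rank one the weight takes the value `2` on the coroot, and `2 = firstValue * 1` gives
      -- the null vector; the general pattern of twos ending in a one starts at rank two.
      exact affine (fun _ ↦ 1) 2 two_pos (fun _ ↦ zero_le_one) (by simp [firstValue]) (by decide)
    · have hfv : (B n).firstValue = 1 := by unfold firstValue; split <;> simp_all
      refine affine (fun j ↦ if j + 1 = n then 1 else 2) 2 two_pos (fun _ ↦ by split_ifs <;> norm_num)
        ?_ (fun i ↦ sum_B hn i)
      rw [hfv, if_neg (by omega)]; norm_num
  | C n =>
    refine hzero (affine (fun _ ↦ 1) 1 one_pos (fun _ ↦ zero_le_one) (by simp [firstValue])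
      fun i ↦ ?_) ⟨id, trivial⟩
    simp only [mul_one]
    exact sum_C hX i
  | D n =>
    refine hzero (affine (fun j ↦ if j + 2 < n then 2 else 1) 2 two_pos
      (fun _ ↦ by split_ifs <;> norm_num) ?_ (fun i ↦ sum_D hX i)) ⟨id, trivial⟩
    rw [if_pos (by simp only [Admissible] at hX; omega)]
    simp [firstValue]
  | BC n =>
    refine hzero ?_ ⟨id, trivial⟩
    rcases Nat.lt_or_ge n 2 with hn | hn
    · obtain rfl : n = 1 := by simp only [Admissible] at hX; omega
      exact affine (fun _ ↦ 1) 2 two_pos (fun _ ↦ zero_le_one) (by simp [firstValue]) (by decide)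
    · have hfv : (BC n).firstValue = 1 := by unfold firstValue; split <;> simp_all
      refine affine (fun j ↦ if j + 1 = n then 1 else 2) 2 two_pos (fun _ ↦ by split_ifs <;> norm_num)
        ?_ (fun i ↦ sum_B hn i)
      rw [hfv, if_neg (by omega)]; norm_num
  -- The vector is null on every row except at the branch node, where the value is `-1`. For `E7`
  -- and `E8` it is extended by zero, which only adds nonpositive entries; for `F4` and `G2` the
  -- single negative row is the third and the second.
  | E6 =>
    refine hneg (h.neg_of_intVec
      (v := fun j ↦ j.elim 6 fun j ↦ (![6, 3, 6, 6, 4, 2] : Fin 6 → ℤ) j) ?_ ?_ ?_) ⟨id, id⟩ <;> decide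
  | E7 =>
    refine hneg (h.neg_of_intVec
      (v := fun j ↦ j.elim 6 fun j ↦ (![6, 3, 6, 6, 4, 2, 0] : Fin 7 → ℤ) j) ?_ ?_ ?_)
      ⟨id, id⟩ <;> decide
  | E8 =>
    refine hneg (h.neg_of_intVec
      (v := fun j ↦ j.elim 6 fun j ↦ (![6, 3, 6, 6, 4, 2, 0, 0] : Fin 8 → ℤ) j) ?_ ?_ ?_)
      ⟨id, id⟩ <;> decide
  | F4 =>
    refine hneg (h.neg_of_intVec
      (v := fun j ↦ j.elim 4 fun j ↦ (![4, 4, 2, 1] : Fin 4 → ℤ) j) ?_ ?_ ?_) ⟨id, id⟩ <;> decide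
  | G2 =>
    refine hneg (h.neg_of_intVec
      (v := fun j ↦ j.elim 1 fun j ↦ (![1, 1] : Fin 2 → ℤ) j) ?_ ?_ ?_) ⟨id, id⟩ <;> decide

end RootType

/-! ### Transfer to the given matrices and conclusion -/

namespace Realization

variable {k : Type*} [Field k] [CharZero k] {ι 𝔥 : Type*} [Fintype ι] [DecidableEq ι]
  [AddCommGroup 𝔥] [Module k 𝔥] {A : Matrix ι ι ℤ} {M : Matrix ι ι k}

lemma finite_iff_of_map_eq (hM : A.map (Int.cast : ℤ → k) = M) (R : Realization M 𝔥)
    (hG : IsGCM A) (hI : Indecomposable A) {t : ℝ} {u p : ι → ℝ} (h : IsPerron A t u p) :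
    Module.Finite k R.KacMoodyAlgebra ↔ 0 < t := by
  subst hM
  exact R.finite_iff_of_isPerron hG hI h

lemma finite_of_map_eq (hM : A.map (Int.cast : ℤ → k) = M) (R : Realization M 𝔥)
    (hG : IsGCM A) {u : ι → ℝ} (hu : ∀ i, 0 < u i) (hAu : ∀ i, 0 < realMulVec A u i) :
    Module.Finite k R.KacMoodyAlgebra := by
  subst hM
  exact R.finite_of_pos hG hu hAu

end Realization

/-- At a node with no outgoing entries `(A u)_i = 2 u i`, which is positive for positive `u`, so
there is no positive null vector. This applies to the new node when `ε = 0`. -/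
lemma not_isAffineType_of_row {k : Type*} [Field k] [CharZero k] {ι : Type*} [Fintype ι]
    {A : Matrix ι ι ℤ} {i : ι} (hi : A i i = 2) (h : ∀ j, j ≠ i → A i j = 0) :
    ¬IsAffineType (A.map (Int.cast : ℤ → k)) := by
  rintro ⟨B, hB, -, -, hBA⟩
  obtain rfl := map_intCast_injective hB
  obtain ⟨u, hu, hBu⟩ := hBA.exists_pos
  have := congrFun hBu i
  rw [realMulVec_apply, Finset.sum_eq_single_of_mem i (Finset.mem_univ i)
    (fun j _ hj ↦ by rw [h j hj]; simp), hi, Pi.zero_apply] at this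
  have := hu i
  push_cast at *
  linarith

namespace SymmetricDatum

variable {k L : Type*} [Field k] [IsAlgClosed k] [CharZero k]
  [LieRing L] [LieAlgebra k L] [FiniteDimensional k L] [LieAlgebra.IsSemisimple k L]
  {D : SymmetricDatum k L} {ε : Dual k D.H} {𝔥 : Type*} [AddCommGroup 𝔥] [Module k 𝔥]

/-- For a non-zero weight, the types of the extended matrix and of its restriction are governed by
the sign of one real number. -/
lemma exists_isPerron_restricted (hε : D.IsDominantSpherical ε) (hε0 : ε ≠ 0)
    (R : Realization (D.extMatrix ε) 𝔥) :
    ∃ (B : Matrix (Option D.simpleRestricted) (Option D.simpleRestricted) ℤ) (t : ℝ)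
      (u p : Option D.simpleRestricted → ℝ), B.map (Int.cast : ℤ → k) = restrictedMatrix R ∧
      IsPerron B t u p ∧ (Module.Finite k R.KacMoodyAlgebra ↔ 0 < t) ∧
      (IsFiniteType (restrictedMatrix R) ↔ 0 < t) ∧ (R.IsOfAffineType ↔ t = 0) ∧
      (IsAffineType (restrictedMatrix R) ↔ t = 0) := by
  classical
  obtain ⟨B, hB⟩ := exists_int_restrictedMatrix hε R
  have hGM := isGCM_intExt hε
  have hGB := isGCM_of_map_eq hε hB
  have hI := indecomposable_intExt hε hε0
  have hF := isFolding hε hB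
  have hBI := hF.indecomposable hGM hI
  obtain ⟨t, u, p, h⟩ := hI.exists_isPerron hGM
  obtain ⟨t', u', p', h'⟩ := hBI.exists_isPerron hGB
  obtain ⟨hsign, hsign0⟩ := hF.sign_eq h h'
  refine ⟨B, t', u', p', hB, h', ?_, ?_, ?_, ?_⟩
  · rw [← hsign]
    exact R.finite_iff_of_map_eq (intExt_map hε) hGM hI h
  · rw [← hB]
    exact h'.isFiniteType_iff hBI hGB
  · rw [Realization.IsOfAffineType, ← hsign0, ← intExt_map hε]
    exact h.isAffineType_iff hI hGM
  · rw [← hB]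
    exact h'.isAffineType_iff hBI hGB

lemma zero_weight (hε : D.IsDominantSpherical (0 : Dual k D.H))
    (R : Realization (D.extMatrix 0) 𝔥) :
    Module.Finite k R.KacMoodyAlgebra ∧ IsFiniteType (restrictedMatrix R) ∧ ¬R.IsOfAffineType ∧
      ¬IsAffineType (restrictedMatrix R) := by
  classical
  obtain ⟨B, hB⟩ := exists_int_restrictedMatrix hε R
  have hGM := isGCM_intExt hε
  have hGB := isGCM_of_map_eq hε hB
  obtain ⟨u, hu, hMu⟩ := exists_pos_intExt_zero hε
  refine ⟨R.finite_of_map_eq (intExt_map hε) hGM hu hMu, ?_, ?_, ?_⟩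
  · rw [← hB]
    exact (isFolding hε hB).isFiniteType hGM hGB hu hMu k
  · rw [Realization.IsOfAffineType, ← intExt_map hε]
    refine not_isAffineType_of_row (i := none) (hGM.diag _) fun j hj ↦ ?_
    rcases j with - | b
    · exact absurd rfl hj
    · simp [intExt]
  · rw [← hB]
    refine not_isAffineType_of_row (i := none) (hGB.diag _) fun j hj ↦ ?_
    rcases j with - | t
    · exact absurd rfl hj
    · have h1 : (B none (some t) : k) = restrictedMatrix R none (some t) := by
        rw [← hB, Matrix.map_apply]
      rw [restrictedMatrix_apply R hε] at h1
      simp only [LinearMap.zero_apply, mul_zero] at h1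
      exact_mod_cast h1

lemma submatrix_eq_extended (hε : D.IsDominantSpherical ε) {R : Realization (D.extMatrix ε) 𝔥}
    {B : Matrix (Option D.simpleRestricted) (Option D.simpleRestricted) ℤ}
    (hB : B.map (Int.cast : ℤ → k) = restrictedMatrix R) {X : RootType}
    {num : Fin X.rank ≃ D.simpleRestricted} (hX : D.IsNumbering X num)
    (hfirst : D.IsFirstWeight X num ε) :
    B.submatrix (Equiv.optionCongr num) (Equiv.optionCongr num) = X.extended := by
  classical
  ext i j
  have h1 : (B (Equiv.optionCongr num i) (Equiv.optionCongr num j) : k) =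
      restrictedMatrix R (Equiv.optionCongr num i) (Equiv.optionCongr num j) := by
    rw [← hB, Matrix.map_apply]
  rw [restrictedMatrix_apply R hε] at h1
  rw [Matrix.submatrix_apply]
  rcases i with - | i <;> rcases j with - | j
  · simp only [Equiv.optionCongr_apply, Option.map_none] at h1 ⊢
    simp only [RootType.extended, Matrix.of_apply]
    exact_mod_cast h1
  · simp only [Equiv.optionCongr_apply, Option.map_none, Option.map_some, hfirst j] at h1 ⊢
    simp only [RootType.extended, Matrix.of_apply]
    split_ifs at h1 ⊢
    · exact_mod_cast h1
    · rw [mul_zero] at h1; exact_mod_cast h1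
  · simp only [Equiv.optionCongr_apply, Option.map_none, Option.map_some, hfirst i] at h1 ⊢
    simp only [RootType.extended, Matrix.of_apply]
    have := X.firstValue_ne_zero
    by_cases hi : (i : ℕ) = 0
    · rw [if_pos hi]
      rw [if_pos hi, if_neg (by exact_mod_cast this)] at h1
      exact_mod_cast h1
    · rw [if_neg hi]
      rw [if_neg hi, if_pos rfl] at h1
      exact_mod_cast h1
  · simp only [Equiv.optionCongr_apply, Option.map_some, hX.cartan i j] at h1 ⊢
    simp only [RootType.extended, Matrix.of_apply]
    exact_mod_cast h1

end SymmetricDatum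

end ExtKM

end

theorem proposition21
    {k L : Type*} [Field k] [IsAlgClosed k] [CharZero k]
    [LieRing L] [LieAlgebra k L] [FiniteDimensional k L] [LieAlgebra.IsSemisimple k L]
    (D : ExtKM.SymmetricDatum k L)
    (ε : Module.Dual k D.H) (hε : D.IsDominantSpherical ε)
    {𝔥 : Type*} [AddCommGroup 𝔥] [Module k 𝔥]
    (R : ExtKM.Realization (D.extMatrix ε) 𝔥) :
    (Module.Finite k R.KacMoodyAlgebra ↔
      ExtKM.IsFiniteType (ExtKM.SymmetricDatum.restrictedMatrix R)) ∧
    (R.IsOfAffineType ↔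
      ExtKM.IsAffineType (ExtKM.SymmetricDatum.restrictedMatrix R)) ∧
    (∀ (X : ExtKM.RootType) (num : Fin X.rank ≃ D.simpleRestricted),
      D.IsNumbering X num → D.IsFirstWeight X num ε →
        (Module.Finite k R.KacMoodyAlgebra ↔ X.IsA) ∧
        (ExtKM.IsFiniteType (ExtKM.SymmetricDatum.restrictedMatrix R) ↔ X.IsA) ∧
        (R.IsOfAffineType ↔ X.IsBBCCD) ∧
        (ExtKM.IsAffineType (ExtKM.SymmetricDatum.restrictedMatrix R) ↔ X.IsBBCCD)) := by
  by_cases hε0 : ε = 0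
  · subst hε0
    obtain ⟨h1, h2, h3, h4⟩ := ExtKM.SymmetricDatum.zero_weight hε R
    refine ⟨iff_of_true h1 h2, iff_of_false h3 h4, fun X num hX hfirst ↦ ?_⟩
    -- The distinguished weight does not vanish on the first simple restricted coroot, so the weight
    -- zero is excluded here.
    have := hfirst ⟨0, ExtKM.RootType.rank_pos hX.admissible⟩
    rw [if_pos rfl, LinearMap.zero_apply] at this
    exact absurd (Nat.cast_eq_zero.mp this.symm) X.firstValue_ne_zero
  · obtain ⟨B, t, u, p, hB, h, h1, h2, h3, h4⟩ := ExtKM.SymmetricDatum.exists_isPerron_restricted hε hε0 R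
    refine ⟨h1.trans h2.symm, h3.trans h4.symm, fun X num hX hfirst ↦ ?_⟩
    have h5 := h.submatrix (Equiv.optionCongr num)
    rw [ExtKM.SymmetricDatum.submatrix_eq_extended hε hB hX hfirst] at h5
    obtain ⟨h6, h7⟩ := ExtKM.RootType.sign_extended hX.admissible h5
    exact ⟨h1.trans h6, h2.trans h6, h3.trans h7, h4.trans h7⟩
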